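/- **Notation.** $[x]_j=x(x+1)\cdots(x+j-1)$, $[x]_0=1$, $[x_1,\dots,x_n]_j=[x_1]_j\cdots[x_n]_j$. Let $u,v\in\mathbb R$ with $u+v>0$; put $\mathsf C_{u,v}=2$ if $u\le 0$ or $u\ge 1$, and $\mathsf C_{u,v}=2u$ if $0<u<1$. Put $x^u_j(s)=-4(u+j-s/2)^2$ and $x^v_j(s)=-4(v+j+s/2)^2$ for integers $j\ge 0$. *Continuous dual Hahn measure.* For $x>0$ let $$\mathsf{CDH}^c(x;a,b,c)=\frac1{8\pi}\,\frac{|\Gamma(a+\frac{i\sqrt x}{2})\Gamma(b+\frac{i\sqrt x}{2})\Gamma(c+\frac{i\sqrt x}{2})|^2}{\Gamma(a+b)\Gamma(a+c)\Gamma(b+c)\sqrt x\,|\Gamma(i\sqrt x)|^2},$$ $$m_j(a,b,c)=\frac{[2a,a+b,a+c]_j\,(a+j)\,\Gamma(b-a)\Gamma(c-a)}{[1,a-b+1,a-c+1]_j\;a\;\Gamma(-2a)\Gamma(b+c)}(-1)^j .$$ Let $a\in\mathbb R$, and let $\mathcal F=\{x_0<\dots<x_{\lfloor -a\rfloor}\}$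 if $a<0$, $\mathcal F=\varnothing$ if $a\ge0$. The Borel measure $\mathsf{CDH}(\cdot;a,b,c;\mathcal F)$ on $\mathbb R$ is * (P) if $a\ge 0$, and either $b=\bar c\notin\mathbb R$ with $\mathrm{Re}\,b>0$, or $b,c>0$ are real: $\mathsf{CDH}^c(x;a,b,c)\mathbf 1_{x>0}\,dx$; * (N1) if $a<0$, and either $b=\bar c\notin\mathbb R$ with $\mathrm{Re}\,b>0$, or $b,c\in\mathbb R$ with $a+b,a+c>0$: $\mathsf{CDH}^c(x;a,b,c)\mathbf 1_{x>0}\,dx+\sum_{j=0}^{\lfloor -a\rfloor}m_j(a,b,c)\,\delta_{x_j}$; * (N2) if $a<0$, $b,c\in\mathbb R$, $b,\,b+c,\,c-a>0$ and $a+b=-k$ with $k\in\mathbb Z_{\ge0}$: $\sum_{j=0}^{k}m_j(a,b,c)\,\delta_{x_j}$. *Marginals.* For $s\in[0,\mathsf C_{u,v})$ let $\mathfrak p_s$ be the (infinite) Borel measure on $\mathbb R$ with density $$\frac{(v+u)(v+u+1)}{8\pi}\,\frac{|\Gamma(\frac s2+v+\frac{i\sqrt r}{2})\Gamma(-\frac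 s2+u+\frac{i\sqrt r}{2})|^2}{\sqrt r\,|\Gamma(i\sqrt r)|^2}\quad(r>0)$$ together with the following atoms. If $u-s/2<0$, the points $x^u_j(s)$, $0\le j\le\lfloor -u+s/2\rfloor$, carry the masses $$\frac{\Gamma(v-u+s)\Gamma(v+u+2)}{\Gamma(-2u+s)}\cdot\frac{(u+j-s/2)\,[2u-s,v+u]_j}{(u-s/2)\,[1,1-v+u-s]_j};$$ if $v+s/2<0$, the points $x^v_j(s)$, $0\le j\le\lfloor -v-s/2\rfloor$, carry the masses $$\frac{\Gamma(u-v-s)\Gamma(2+v+u)}{\Gamma(-2v-s)}\cdot\frac{(v+j+s/2)\,[2v+s,v+u]_j}{(v+s/2)\,[1,1-u+v+s]_j}.$$ Let $\mathcal S_s$ be the union of $(0,\infty)$ and this set of atoms. *Transitions.* For $s<t$ in $[0,\mathsf C_{u,v})$ put * for $m>0$: $\mathfrak p_{s,t}(m,\cdot)=\mathsf{CDH}\big(\cdot;\,u-\tfrac t2,\ \tfrac{t-s}2+\tfrac{i\sqrt m}2,\ \tfrac{t-s}2-\tfrac{i\sqrt m}2;\ \mathcal F\big)$ with $\mathcal F=\{x^u_k(t):0\le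 k\le\lfloor -u+\tfrac t2\rfloor\}$ if $u-\tfrac t2<0$; * if $u-\tfrac s2<0$ and $0\le j\le\lfloor -u+\tfrac s2\rfloor$: $\mathfrak p_{s,t}(x^u_j(s),\cdot)=\mathsf{CDH}\big(\cdot;\,u-\tfrac t2,\ -u+\tfrac t2-j,\ u+\tfrac t2-s+j;\ \mathcal F\big)$ with the same $\mathcal F$; * if $v+\tfrac s2<0$ and $0\le j\le\lfloor -v-\tfrac s2\rfloor$: $\mathfrak p_{s,t}(x^v_j(s),\cdot)=\mathsf{CDH}\big(\cdot;\,v+j+\tfrac t2,\ \tfrac t2-s-v-j,\ u-\tfrac t2;\ \mathcal F\big)$ with $\mathcal F=\{x^v_k(t): j\le k\le\lfloor -v-\tfrac t2\rfloor\}$ if $v+j+\tfrac t2<0$; * $\mathfrak p_{s,t}(m,\cdot)=0$ for all other $m$. **Lemma.** Let $u+v>0$ and $0\le s<t<w<\mathsf C_{u,v}$. Then $m\mapsto\mathfrak p_{s,t}(m,V)$ is Borel measurable for every Borel $V\subset\mathbb R$; for every $m\in\mathcal S_s$, $\mathfrak p_{s,t}(m,\cdot)$ is a probability measure with $\mathfrak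 p_{s,t}(m,\mathbb R\setminus\mathcal S_t)=0$; and for every Borel $V\subset\mathbb R$ and every $m\in\mathbb R$, $$\int_{\mathbb R}\mathfrak p_s(dm')\,\mathfrak p_{s,t}(m',V)=\mathfrak p_t(V)\qquad\text{and}\qquad\int_{\mathbb R}\mathfrak p_{s,t}(m,dr)\,\mathfrak p_{t,w}(r,V)=\mathfrak p_{s,w}(m,V).$$ -/

import Mathlib

open MeasureTheory

namespace DualHahn

noncomputable section

/-- The right end `C_{u,v}` of the time window: `2` if `u ≤ 0` or `u ≥ 1`, and `2u` if
`0 < u < 1`. It does not depend on `v`. -/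
def timeBound (u : ℝ) : ℝ := if u ≤ 0 ∨ 1 ≤ u then 2 else 2 * u

/-- The location `x^u_j(s) = -4 (u + j - s/2)²`. -/
def xU (u s : ℝ) (j : ℕ) : ℝ := -4 * (u + j - s / 2) ^ 2

/-- The location `x^v_j(s) = -4 (v + j + s/2)²`. -/
def xV (v s : ℝ) (j : ℕ) : ℝ := -4 * (v + j + s / 2) ^ 2

/-- The Pochhammer symbol `[z]_j = z (z + 1) ⋯ (z + j - 1)` over `ℂ`. -/
def poch (z : ℂ) (j : ℕ) : ℂ := (ascPochhammer ℂ j).eval z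

/-- The Pochhammer symbol over `ℝ`. -/
def pochR (x : ℝ) (j : ℕ) : ℝ := (ascPochhammer ℝ j).eval x

/-! ### The orthogonality measure of the continuous dual Hahn polynomials -/

/-- The Lebesgue density `CDH^c(x; a, b, c)`, supported on `x > 0`. For the parameters in use the
product `Γ(a+b) Γ(a+c) Γ(b+c)` is a (positive) real number, so `re` only changes the type. -/
def cdhDensity (a : ℝ) (b c : ℂ) (x : ℝ) : ℝ :=
  if 0 < x then
    1 / (8 * Real.pi) *
      (‖Complex.Gamma (a + Complex.I * (√x / 2 : ℝ)) * Complex.Gamma (b + Complex.I * (√x / 2 : ℝ)) *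
          Complex.Gamma (c + Complex.I * (√x / 2 : ℝ))‖ ^ 2 /
        ((Complex.Gamma (a + b) * Complex.Gamma (a + c) * Complex.Gamma (b + c)).re * √x *
          ‖Complex.Gamma (Complex.I * (√x : ℝ))‖ ^ 2))
  else 0

/-- The mass `CDH^d(x_j; a, b, c)` of the `j`-th atom; a real number for the parameters in use. -/
def cdhMass (a : ℝ) (b c : ℂ) (j : ℕ) : ℝ :=
  ((poch (2 * a) j * poch (a + b) j * poch (a + c) j * (a + j) *
      Complex.Gamma (b - a) * Complex.Gamma (c - a)) /
    (poch 1 j * poch (a - b + 1) j * poch (a - c + 1) j * a *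
      Complex.Gamma (-2 * a) * Complex.Gamma (b + c)) * (-1) ^ j).re

/-- `b` and `c` are nonreal complex conjugates of positive real part. -/
def ConjPair (b c : ℂ) : Prop := c = (starRingEnd ℂ) b ∧ b.im ≠ 0 ∧ 0 < b.re

/-- `b` and `c` are both real. -/
def RealPair (b c : ℂ) : Prop := b.im = 0 ∧ c.im = 0

/-- Parameters with an absolutely continuous part only. -/
def CaseP (a : ℝ) (b c : ℂ) : Prop :=
  0 ≤ a ∧ (ConjPair b c ∨ (RealPair b c ∧ 0 < b.re ∧ 0 < c.re))

/-- Parameters with an absolutely continuous part and atoms. -/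
def CaseN1 (a : ℝ) (b c : ℂ) : Prop :=
  a < 0 ∧ (ConjPair b c ∨ (RealPair b c ∧ 0 < a + b.re ∧ 0 < a + c.re))

/-- Parameters with atoms only; here `a + b = -k` with `k` a nonnegative integer. -/
def CaseN2 (a : ℝ) (b c : ℂ) : Prop :=
  a < 0 ∧ RealPair b c ∧ 0 < b.re ∧ 0 < b.re + c.re ∧ 0 < c.re - a ∧ ∃ k : ℕ, a + b.re = -k

open Classical in
/-- The continuous dual Hahn measure `CDH(·; a, b, c; F)`. The finite set `F` of possible atoms,
which has `⌊-a⌋ + 1` elements when `a < 0`, is given by its increasing enumeration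
`pts 0 < pts 1 < ⋯ < pts ⌊-a⌋`. With atoms only, the masses vanish beyond the index
`k = -(a + b) ≤ ⌊-a⌋`. -/
def cdh (a : ℝ) (b c : ℂ) (pts : ℕ → ℝ) : Measure ℝ :=
  if CaseP a b c then
    volume.withDensity fun x => ENNReal.ofReal (cdhDensity a b c x)
  else if CaseN1 a b c then
    (volume.withDensity fun x => ENNReal.ofReal (cdhDensity a b c x)) +
      ∑ j ∈ Finset.range (⌊-a⌋₊ + 1), ENNReal.ofReal (cdhMass a b c j) • Measure.dirac (pts j)
  else if CaseN2 a b c then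
    ∑ j ∈ Finset.range (⌊-(a + b.re)⌋₊ + 1),
      ENNReal.ofReal (cdhMass a b c j) • Measure.dirac (pts j)
  else 0

/-! ### The marginal measures -/

/-- The density of the absolutely continuous part of the marginal measure at time `s`. -/
def marginalDensity (u v s r : ℝ) : ℝ :=
  if 0 < r then
    (v + u) * (v + u + 1) / (8 * Real.pi) *
      (‖Complex.Gamma ((s / 2 + v : ℝ) + Complex.I * (√r / 2 : ℝ)) *
          Complex.Gamma ((-(s / 2) + u : ℝ) + Complex.I * (√r / 2 : ℝ))‖ ^ 2 /
        (√r * ‖Complex.Gamma (Complex.I * (√r : ℝ))‖ ^ 2))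
  else 0

/-- The mass of the marginal measure at `x^u_j(s)`, when `u - s/2 < 0`. -/
def marginalMassU (u v s : ℝ) (j : ℕ) : ℝ :=
  Real.Gamma (v - u + s) * Real.Gamma (v + u + 2) / Real.Gamma (-2 * u + s) *
    (((u + j - s / 2) * (pochR (2 * u - s) j * pochR (v + u) j)) /
      ((u - s / 2) * (pochR 1 j * pochR (1 - v + u - s) j)))

/-- The mass of the marginal measure at `x^v_j(s)`, when `v + s/2 < 0`. -/
def marginalMassV (u v s : ℝ) (j : ℕ) : ℝ :=
  Real.Gamma (u - v - s) * Real.Gamma (2 + v + u) / Real.Gamma (-2 * v - s) *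
    (((v + j + s / 2) * (pochR (2 * v + s) j * pochR (v + u) j)) /
      ((v + s / 2) * (pochR 1 j * pochR (1 - u + v + s) j)))

/-- The (infinite) marginal measure `p_s`. -/
def marginal (u v s : ℝ) : Measure ℝ :=
  (volume.withDensity fun r => ENNReal.ofReal (marginalDensity u v s r)) +
    (if u - s / 2 < 0 then
      ∑ j ∈ Finset.range (⌊-u + s / 2⌋₊ + 1),
        ENNReal.ofReal (marginalMassU u v s j) • Measure.dirac (xU u s j)
    else 0) +
    (if v + s / 2 < 0 then
      ∑ j ∈ Finset.range (⌊-v - s / 2⌋₊ + 1),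
        ENNReal.ofReal (marginalMassV u v s j) • Measure.dirac (xV v s j)
    else 0)

/-- The atoms `S^{d,u}_s`; empty unless `u - s/2 < 0`. -/
def atomsU (u s : ℝ) : Set ℝ :=
  {x | u - s / 2 < 0 ∧ ∃ j : ℕ, j ≤ ⌊-u + s / 2⌋₊ ∧ x = xU u s j}

/-- The atoms `S^{d,v}_s`; empty unless `v + s/2 < 0`. -/
def atomsV (v s : ℝ) : Set ℝ :=
  {x | v + s / 2 < 0 ∧ ∃ j : ℕ, j ≤ ⌊-v - s / 2⌋₊ ∧ x = xV v s j}

/-- The total support `S_s`. -/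
def supp (u v s : ℝ) : Set ℝ := Set.Ioi 0 ∪ atomsU u s ∪ atomsV v s

/-! ### The transition measures -/

/-- The transition measure `p_{s,t}(m, ·)`, zero for `m ∉ S_s`. At most one summand below is
nonzero: the points `x^u_j(s)` (resp. `x^v_j(s)`) are distinct and nonpositive, and `u - s/2 < 0`
and `v + s/2 < 0` exclude each other when `u + v > 0`.

From `x^v_j(s)` the first parameter is `a = v + j + t/2`, and the `⌊-a⌋ + 1` atoms (for `a < 0`)
sit at `-4 (a + i)² = x^v_{j+i}(t)`, the points of `S^{d,v}_t` of index at least `j`. -/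
def transition (u v s t m : ℝ) : Measure ℝ :=
  (if 0 < m then
    cdh (u - t / 2) (((t - s) / 2 : ℝ) + Complex.I * (√m / 2 : ℝ))
      (((t - s) / 2 : ℝ) - Complex.I * (√m / 2 : ℝ)) (xU u t)
  else 0) +
  (if u - s / 2 < 0 then
    ∑ j ∈ Finset.range (⌊-u + s / 2⌋₊ + 1),
      if m = xU u s j then
        cdh (u - t / 2) (-u + t / 2 - j : ℝ) (u + t / 2 - s + j : ℝ) (xU u t)
      else 0
  else 0) +
  (if v + s / 2 < 0 then
    ∑ j ∈ Finset.range (⌊-v - s / 2⌋₊ + 1),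
      if m = xV v s j then
        cdh (v + j + t / 2) (t / 2 - s - v - j : ℝ) (u - t / 2 : ℝ) (fun i => xV v t (j + i))
      else 0
  else 0)

end

end DualHahn

/-!
The proof rests on one computation. With `phi p n x = ∏_{k<n} ((p + k)² + x/4)`, the transition
measure from a point `m` of the support at time `s` satisfies

  `∫ phi (u - t/2) n x p_{s,t}(m, dx) = phi (u - s/2) n m` for all `n`

(`hasMoments_transition`). Composing two such identities, both sides of the Chapman-Kolmogorov
equation have the same moments, and these grow slowly enough, like `Bⁿ (n!)²`, to determine a
measure on a half-line (`ext_of_moments`, `bind_eq_of_hasMoments`): the symmetrised law of the square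
root has exponential moments.

The moments of the continuous dual Hahn measure are `∫ phi a n = [a+b]_n [a+c]_n`
(`contInt_add_atomSum`, `atomSum_of_terminating`). As `(a² + x/4) CDH(a, b, c)` is
`(a+b)(a+c) CDH(a+1, b, c)`, for the density and for each atom, they all follow from the total mass
being `1`. That the mass does not change under `a ↦ a + 1` is the case of the first moment. For the
absolutely continuous part it is a residue computation: the weight times `y² - (ab+bc+ca)` is, up to
a factor, the even part on the imaginary axis of `(cot π(z-a) + cot π(z+a)) Φ(z)`, with `Φ` invariant
under `z ↦ 1 - z`, so the unit strip `0 ≤ Re z ≤ 1` yields its integral (`integral_cdhWeight_mul`). It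
vanishes for `a ≥ 0`, and for `a < 0` it is the boundary term of a telescoping sum over the atoms
(`sum_atomFactor`, `atomFactor_boundary`). For `a > 0` the mass is then constant in `a`, since
`‖Γ(σ + iy)‖ / Γ(σ)` increases with `σ` and Gamma ratios tend to `1` (`contMass_const`). By symmetry
real parameters can be moved to `0, 1/2, 1/2`, where the weight is `sech`; conjugate parameters
are compared at `a → ∞` with real ones (`contMass_conj`).

The marginal measures are infinite and have no moments. They are limits for `K → ∞` of multiples of
the probability measures `CDH(u - s/2, v + s/2, K + s/2)`, whose densities increase to the marginal
density (`tendsto_lintegral_approx`). The moments `[u+v]_n [u+K]_n` of these do not depend on `s`, so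
the transition measures carry the approximation at time `s` to the one at time `t`, and the ratio
of the scaling factors tends to `1` (`lintegral_transition_marginal`).
-/

namespace DualHahn

/-! ### The Gamma function on vertical lines -/

theorem poch_eq_prod (z : ℂ) (n : ℕ) : poch z n = ∏ j ∈ Finset.range n, (z + j) := by
  induction n with
  | zero => simp [poch]
  | succ n ih => rw [Finset.prod_range_succ, ← ih, poch, poch, ascPochhammer_succ_eval]

theorem pochR_eq_prod (x : ℝ) (n : ℕ) : pochR x n = ∏ j ∈ Finset.range n, (x + j) := by
  induction n with
  | zero => simp [pochR]
  | succ n ih => rw [Finset.prod_range_succ, ← ih, pochR, pochR, ascPochhammer_succ_eval]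

open Filter Topology Complex in
/-- `‖Γ(σ + iy)‖ / Γ(σ)` increases with `σ > 0`: it is the product of the factors
`(1 + y² / (σ + k)²)^(-1/2)`. -/
theorem norm_Gamma_mul_Gamma_le {σ τ : ℝ} (hσ : 0 < σ) (h : σ ≤ τ) (y : ℝ) :
    ‖Gamma (σ + I * y)‖ * Real.Gamma τ ≤ ‖Gamma (τ + I * y)‖ * Real.Gamma σ := by
  have hτ : 0 < τ := hσ.trans_le h
  have hG : ∀ r : ℝ, 0 < r → Real.Gamma r = ‖Gamma (r : ℂ)‖ := fun r hr => by
    rw [Gamma_ofReal, norm_real, Real.norm_of_nonneg (Real.Gamma_pos_of_pos hr).le]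
  rw [hG τ hτ, hG σ hσ]
  refine le_of_tendsto_of_tendsto
    ((GammaSeq_tendsto_Gamma (σ + I * y)).norm.mul (GammaSeq_tendsto_Gamma (τ : ℂ)).norm)
    ((GammaSeq_tendsto_Gamma (τ + I * y)).norm.mul (GammaSeq_tendsto_Gamma (σ : ℂ)).norm) ?_
  filter_upwards [eventually_gt_atTop 0] with n hn
  have hn' : (0 : ℝ) < n := by exact_mod_cast hn
  simp only [GammaSeq, norm_div, norm_mul, norm_prod]
  have hp : ∀ z : ℂ, ‖(n : ℂ) ^ z‖ = (n : ℝ) ^ z.re := fun z => by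
    rw [show (n : ℂ) = ((n : ℝ) : ℂ) by simp, norm_cpow_eq_rpow_re_of_pos hn']
  rw [hp, hp, hp, hp]
  have hpos : ∀ r : ℝ, 0 < r → ∀ w : ℝ,
      0 < ∏ j ∈ Finset.range (n + 1), ‖(r : ℂ) + I * w + j‖ := fun r hr w =>
    Finset.prod_pos fun j _ => norm_pos_iff.2 fun h0 => by
      have := congrArg re h0
      simp at this
      linarith [(Nat.cast_nonneg j : (0 : ℝ) ≤ j)]
  have hpos' : ∀ r : ℝ, 0 < r → 0 < ∏ j ∈ Finset.range (n + 1), ‖(r : ℂ) + j‖ := fun r hr => by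
    simpa using hpos r hr 0
  rw [div_mul_div_comm, div_mul_div_comm]
  have e1 : (σ + I * y : ℂ).re = σ := by simp
  have e2 : (τ + I * y : ℂ).re = τ := by simp
  rw [e1, e2, ofReal_re, ofReal_re]
  have hnum : (n : ℝ) ^ σ * ‖(n.factorial : ℂ)‖ * ((n : ℝ) ^ τ * ‖(n.factorial : ℂ)‖) =
    (n : ℝ) ^ τ * ‖(n.factorial : ℂ)‖ * ((n : ℝ) ^ σ * ‖(n.factorial : ℂ)‖) := by ring
  rw [hnum]
  refine div_le_div_of_nonneg_left (by positivity)
    (mul_pos (hpos τ hτ y) (hpos' σ hσ)) ?_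
  rw [← Finset.prod_mul_distrib, ← Finset.prod_mul_distrib]
  refine Finset.prod_le_prod (fun j _ => by positivity) fun j _ => ?_
  refine abs_le_of_sq_le_sq' ?_ (by positivity) |>.2
  rw [mul_pow, mul_pow]
  simp only [← normSq_eq_norm_sq, normSq_apply]
  simp
  have hj : (0 : ℝ) ≤ j := by positivity
  have : (σ + j) ^ 2 ≤ (τ + j) ^ 2 := by gcongr
  nlinarith [mul_le_mul_of_nonneg_left this (sq_nonneg y)]

open Filter Topology Complex in
/-- Stirling's formula for the modulus, in the form of a ratio limit. -/
theorem tendsto_norm_Gamma_add_nat {z : ℂ} (hz : 0 < z.re) :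
    Tendsto (fun n : ℕ => ‖Gamma (z + n + 1)‖ / ((n : ℝ) ^ z.re * n.factorial)) atTop (𝓝 1) := by
  have h0 := Gamma_ne_zero_of_re_pos hz
  have h1 := ((GammaSeq_tendsto_Gamma z).norm.inv₀ (norm_ne_zero_iff.2 h0)).const_mul ‖Gamma z‖
  rw [mul_inv_cancel₀ (norm_ne_zero_iff.2 h0)] at h1
  refine h1.congr' ?_
  filter_upwards [eventually_gt_atTop 0] with n hn
  have hn' : (0 : ℝ) < n := by exact_mod_cast hn
  have h2 := Gamma_add_nat_div_Gamma_eq (n := n + 1) z (fun k hk => by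
    rw [hk] at hz
    simp at hz
    linarith [(Nat.cast_nonneg k : (0 : ℝ) ≤ k)])
  rw [← poch, poch_eq_prod, div_eq_iff h0] at h2
  push_cast at h2
  rw [add_assoc, h2, GammaSeq]
  simp only [norm_div, norm_mul]
  rw [show (n : ℂ) = ((n : ℝ) : ℂ) by simp, norm_cpow_eq_rpow_re_of_pos hn']
  simp
  field_simp

open Filter Topology Complex in
theorem tendsto_norm_Gamma_ratio {z₁ z₂ z₃ z₄ : ℂ} (h₁ : 0 < z₁.re) (h₂ : 0 < z₂.re)
    (h₃ : 0 < z₃.re) (h₄ : 0 < z₄.re) (h : z₁.re + z₂.re = z₃.re + z₄.re) :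
    Tendsto (fun n : ℕ => ‖Gamma (z₁ + n + 1)‖ * ‖Gamma (z₂ + n + 1)‖ /
      (‖Gamma (z₃ + n + 1)‖ * ‖Gamma (z₄ + n + 1)‖)) atTop (𝓝 1) := by
  have := ((tendsto_norm_Gamma_add_nat h₁).mul (tendsto_norm_Gamma_add_nat h₂)).div
    ((tendsto_norm_Gamma_add_nat h₃).mul (tendsto_norm_Gamma_add_nat h₄)) (by simp)
  simp only [mul_one, div_one] at this
  refine this.congr' ?_
  filter_upwards [eventually_gt_atTop 0] with n hn
  have hn' : (0 : ℝ) < n := by exact_mod_cast hn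
  have e : (n : ℝ) ^ z₁.re * (n : ℝ) ^ z₂.re = (n : ℝ) ^ z₃.re * (n : ℝ) ^ z₄.re := by
    rw [← Real.rpow_add hn', ← Real.rpow_add hn', h]
  have p1 := Real.rpow_pos_of_pos hn' z₁.re
  have p2 := Real.rpow_pos_of_pos hn' z₂.re
  have p3 := Real.rpow_pos_of_pos hn' z₃.re
  have p4 := Real.rpow_pos_of_pos hn' z₄.re
  have pf : (0 : ℝ) < n.factorial := by positivity
  simp only [Pi.div_apply]
  rw [div_mul_div_comm, div_mul_div_comm, div_div_div_eq,
    show (n : ℝ) ^ z₁.re * n.factorial * ((n : ℝ) ^ z₂.re * n.factorial) =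
      (n : ℝ) ^ z₃.re * n.factorial * ((n : ℝ) ^ z₄.re * n.factorial) by
        linear_combination (n.factorial : ℝ) ^ 2 * e]
  rw [mul_comm (‖Gamma (z₁ + n + 1)‖ * ‖Gamma (z₂ + n + 1)‖),
    mul_div_mul_left _ _ (by positivity)]

open Filter Topology Complex in
theorem tendsto_norm_Gamma_ratio_zero {z₁ z₂ : ℂ} (h₁ : 0 < z₁.re) (h : z₁.re < z₂.re) :
    Tendsto (fun n : ℕ => ‖Gamma (z₁ + n + 1)‖ / ‖Gamma (z₂ + n + 1)‖) atTop (𝓝 0) := by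
  have h1 := (tendsto_norm_Gamma_add_nat h₁).div
    (tendsto_norm_Gamma_add_nat (h₁.trans h)) (by simp)
  have h2 : Tendsto (fun n : ℕ => (n : ℝ) ^ (-(z₂.re - z₁.re))) atTop (𝓝 0) :=
    (tendsto_rpow_neg_atTop (sub_pos.2 h)).comp tendsto_natCast_atTop_atTop
  have := h1.mul h2
  simp only [mul_zero] at this
  refine this.congr' ?_
  filter_upwards [eventually_gt_atTop 0] with n hn
  have hn' : (0 : ℝ) < n := by exact_mod_cast hn
  have p1 := Real.rpow_pos_of_pos hn' z₁.re
  have p2 := Real.rpow_pos_of_pos hn' z₂.re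
  have pf : (0 : ℝ) < n.factorial := by positivity
  simp only [Pi.div_apply]
  rw [neg_sub, Real.rpow_sub hn', div_div_div_eq, div_mul_div_comm,
    show ‖Gamma (z₁ + n + 1)‖ * ((n : ℝ) ^ z₂.re * n.factorial) * (n : ℝ) ^ z₁.re =
      ((n : ℝ) ^ z₂.re * n.factorial * (n : ℝ) ^ z₁.re) * ‖Gamma (z₁ + n + 1)‖ by ring,
    show (n : ℝ) ^ z₁.re * n.factorial * ‖Gamma (z₂ + n + 1)‖ * (n : ℝ) ^ z₂.re =
      ((n : ℝ) ^ z₂.re * n.factorial * (n : ℝ) ^ z₁.re) * ‖Gamma (z₂ + n + 1)‖ by ring,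
    mul_div_mul_left _ _ (by positivity)]

open Complex in
theorem norm_Gamma_conj_line (σ y : ℝ) : ‖Gamma (σ - I * y)‖ = ‖Gamma (σ + I * y)‖ := by
  rw [← norm_conj (Gamma (σ + I * y)), ← Gamma_conj]
  congr 2
  simp [sub_eq_add_neg]

open Complex in
theorem norm_sin_sq (x y : ℝ) : ‖sin (x + I * y)‖ ^ 2 = Real.sin x ^ 2 + Real.sinh y ^ 2 := by
  rw [mul_comm I, sin_add_mul_I, ← normSq_eq_norm_sq, ← ofReal_sin, ← ofReal_cos, ← ofReal_cosh,
    ← ofReal_sinh, normSq_apply]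
  simp only [add_re, mul_re, ofReal_re, ofReal_im, mul_zero, sub_zero, I_re, add_im, mul_im,
    I_im, mul_one, zero_mul, add_zero, zero_add]
  nlinarith [Real.cos_sq_add_sin_sq x, Real.cosh_sq y, Real.sin_sq_add_cos_sq x]

open Complex in
theorem norm_Gamma_one_add_I_mul_sq {y : ℝ} (hy : y ≠ 0) :
    ‖Gamma (1 + I * y)‖ ^ 2 = Real.pi * y / Real.sinh (Real.pi * y) := by
  have hz : I * y ≠ 0 := by simpa using hy
  have h1 : ‖Gamma (1 + I * y)‖ ^ 2 = ‖Gamma (1 + I * y) * Gamma (1 - I * y)‖ := by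
    have := norm_Gamma_conj_line 1 y
    rw [ofReal_one] at this
    rw [norm_mul, this, sq]
  rw [h1, add_comm (1 : ℂ), Gamma_add_one _ hz, mul_assoc, Gamma_mul_Gamma_one_sub, norm_mul, norm_div]
  have h2 := norm_sin_sq 0 (Real.pi * y)
  have h3 : ((0 : ℝ) : ℂ) + I * ((Real.pi * y : ℝ) : ℂ) = Real.pi * (I * y) := by
    push_cast; ring
  rw [h3] at h2
  have h4 : ‖sin (Real.pi * (I * y))‖ = |Real.sinh (Real.pi * y)| := by
    rw [← abs_of_nonneg (norm_nonneg (sin (Real.pi * (I * y))))]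
    exact (sq_eq_sq_iff_abs_eq_abs _ _).1 (by simpa using h2)
  rw [h4, norm_mul, norm_I, one_mul, norm_real, norm_real, Real.norm_of_nonneg Real.pi_pos.le,
    Real.norm_eq_abs]
  rcases lt_or_gt_of_ne hy with h | h
  · rw [abs_of_neg h, abs_of_neg (Real.sinh_neg_iff.2 (mul_neg_of_pos_of_neg Real.pi_pos h))]
    rw [div_neg, mul_neg, neg_mul, neg_neg]
    ring
  · rw [abs_of_pos h, abs_of_pos (Real.sinh_pos_iff.2 (mul_pos Real.pi_pos h))]
    ring

open Complex in
theorem inv_norm_Gamma_I_mul_sq (y : ℝ) :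
    (‖Gamma (I * y)‖ ^ 2)⁻¹ = y * Real.sinh (Real.pi * y) / Real.pi := by
  rcases eq_or_ne y 0 with rfl | hy
  · simp
  have h := norm_Gamma_one_add_I_mul_sq hy
  have hz : I * y ≠ 0 := by simpa using hy
  rw [add_comm, Gamma_add_one _ hz, norm_mul, mul_pow, norm_mul, norm_I, one_mul, norm_real,
    Real.norm_eq_abs, sq_abs] at h
  have hs : Real.sinh (Real.pi * y) ≠ 0 := by
    rw [Ne, Real.sinh_eq_zero]
    exact mul_ne_zero Real.pi_pos.ne' hy
  have h5 : ‖Gamma (I * y)‖ ^ 2 = Real.pi / (y * Real.sinh (Real.pi * y)) := by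
    rw [eq_div_iff (mul_ne_zero hy hs)]
    rw [eq_div_iff hs] at h
    have : y * (‖Gamma (I * y)‖ ^ 2 * (y * Real.sinh (Real.pi * y))) = y * Real.pi := by
      linear_combination h
    exact mul_left_cancel₀ hy this
  rw [h5, inv_div]

open Complex in
/-- Each step multiplies by a number of modulus at least `|Im z|`. -/
theorem norm_Gamma_le_norm_Gamma_add_nat {z : ℂ} (hz : 1 ≤ |z.im|) (n : ℕ) :
    ‖Gamma z‖ ≤ ‖Gamma (z + n)‖ := by
  induction n with
  | zero => simp
  | succ n ih =>
    have him : (z + n).im = z.im := by simp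
    have h1 : 1 ≤ ‖z + n‖ := hz.trans (him ▸ abs_im_le_norm (z + n))
    have h0 : z + n ≠ 0 := norm_pos_iff.1 (by linarith)
    push_cast
    rw [← add_assoc, Gamma_add_one _ h0, norm_mul]
    exact ih.trans (le_mul_of_one_le_left (norm_nonneg _) h1)

open Complex in
/-- Exponential decay of `Γ` in vertical strips, with a polynomial loss. -/
theorem exists_norm_Gamma_le (A B : ℝ) : ∃ C : ℝ, 0 < C ∧ ∃ N : ℕ, ∀ z : ℂ, A ≤ z.re → z.re ≤ B →
    1 ≤ |z.im| → ‖Gamma z‖ ≤ C * |z.im| ^ N * Real.exp (-(Real.pi / 2) * |z.im|) := by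
  -- the line `Re z = 1`, by the reflection formula
  have h1 : ∀ y : ℝ, 1 ≤ |y| → ‖Gamma (1 + I * y)‖ ≤
      4 * |y| * Real.exp (-(Real.pi / 2) * |y|) := by
    intro y hy
    have hy0 : y ≠ 0 := fun h => by simp [h] at hy; linarith
    have hsq := norm_Gamma_one_add_I_mul_sq hy0
    refine abs_le_of_sq_le_sq' ?_ (by positivity) |>.2
    rw [hsq]
    have e : Real.pi * y / Real.sinh (Real.pi * y) = Real.pi * |y| / Real.sinh (Real.pi * |y|) := by
      rcases abs_cases y with h | h
      · rw [h.1]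
      · rw [h.1, mul_neg, Real.sinh_neg, neg_div_neg_eq]
    rw [e]
    have hpi := Real.pi_gt_three
    have hx : 3 ≤ Real.pi * |y| := by nlinarith
    have hs : Real.exp (Real.pi * |y|) / 4 ≤ Real.sinh (Real.pi * |y|) := by
      rw [Real.sinh_eq]
      have : Real.exp (-(Real.pi * |y|)) ≤ 1 := Real.exp_le_one_iff.2 (by linarith)
      have : Real.pi * |y| + 1 ≤ Real.exp (Real.pi * |y|) := Real.add_one_le_exp _
      linarith
    rw [div_le_iff₀ (lt_of_lt_of_le (by positivity) hs)]
    have e2 : (4 * |y| * Real.exp (-(Real.pi / 2) * |y|)) ^ 2 =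
        16 * |y| ^ 2 * (Real.exp (Real.pi * |y|))⁻¹ := by
      rw [mul_pow, ← Real.exp_nat_mul, ← Real.exp_neg]
      push_cast
      ring_nf
    rw [e2]
    calc Real.pi * |y| ≤ 4 * |y| ^ 2 := by nlinarith [Real.pi_lt_four]
      _ = 16 * |y| ^ 2 * (Real.exp (Real.pi * |y|))⁻¹ * (Real.exp (Real.pi * |y|) / 4) := by
        field_simp
        ring
      _ ≤ _ := by gcongr
  -- the lines `Re z = k + 1`
  have h2 : ∀ k : ℕ, ∃ C : ℝ, 0 < C ∧ ∀ y : ℝ, 1 ≤ |y| →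
      ‖Gamma (((k + 1 : ℕ) : ℝ) + I * y)‖ ≤
      C * |y| ^ (k + 1) * Real.exp (-(Real.pi / 2) * |y|) := by
    intro k
    induction k with
    | zero => exact ⟨4, by norm_num, fun y hy => by simpa using h1 y hy⟩
    | succ k ih =>
      obtain ⟨C, hC, h⟩ := ih
      refine ⟨C * (k + 2), by positivity, fun y hy => ?_⟩
      have hne : ((k + 1 : ℕ) : ℝ) + I * (y : ℂ) ≠ 0 := fun h0 => by
        have := congrArg re h0
        simp at this
        linarith [(Nat.cast_nonneg k : (0 : ℝ) ≤ k)]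
      have e : (((k + 1 + 1 : ℕ) : ℝ) : ℂ) + I * y = ((k + 1 : ℕ) : ℝ) + I * y + 1 := by
        push_cast; ring
      rw [e, Gamma_add_one _ hne, norm_mul]
      have hn : ‖((k + 1 : ℕ) : ℝ) + I * (y : ℂ)‖ ≤ (k + 2) * |y| := by
        refine (norm_add_le _ _).trans ?_
        rw [norm_real, norm_mul, norm_I, norm_real]
        simp only [Real.norm_eq_abs, one_mul, Nat.cast_add, Nat.cast_one]
        rw [abs_of_nonneg (by positivity)]
        nlinarith [(Nat.cast_nonneg k : (0 : ℝ) ≤ k)]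
      calc _ ≤ (k + 2) * |y| * (C * |y| ^ (k + 1) * Real.exp (-(Real.pi / 2) * |y|)) := by
            gcongr
            exact h y hy
        _ = _ := by ring
  obtain ⟨k, hk⟩ := exists_nat_ge (1 - A)
  obtain ⟨M, hM⟩ := exists_nat_ge (B + k)
  obtain ⟨C, hC, h3⟩ := h2 M
  have hcont : ContinuousOn Real.Gamma (Set.Icc 1 ((M + 1 : ℕ) : ℝ)) := fun x hx =>
    (Real.differentiableAt_Gamma (fun m h => by
      have := hx.1; rw [h] at this
      linarith [(Nat.cast_nonneg m : (0 : ℝ) ≤ m)])).continuousAt.continuousWithinAt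
  obtain ⟨K, hK⟩ := isCompact_Icc.bddAbove_image hcont
  have hGM : 0 < Real.Gamma ((M + 1 : ℕ) : ℝ) := Real.Gamma_pos_of_pos (by positivity)
  refine ⟨(|K| + 1) / Real.Gamma ((M + 1 : ℕ) : ℝ) * C, by positivity, M + 1,
    fun z hA hB hz => (norm_Gamma_le_norm_Gamma_add_nat hz k).trans ?_⟩
  have hr1 : 1 ≤ z.re + k := by linarith
  have hr2 : z.re + k ≤ ((M + 1 : ℕ) : ℝ) := by push_cast; linarith
  have e : z + k = ((z.re + k : ℝ) : ℂ) + I * (z.im : ℝ) := by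
    apply Complex.ext <;> simp
  have h4 := norm_Gamma_mul_Gamma_le (by linarith) hr2 z.im
  rw [e]
  rw [← le_div_iff₀ hGM] at h4
  have hGK : Real.Gamma (z.re + k) ≤ |K| + 1 :=
    (hK ⟨z.re + k, ⟨hr1, hr2⟩, rfl⟩).trans ((le_abs_self K).trans (by linarith))
  have h5 := h3 z.im hz
  calc _ ≤ _ := h4
    _ ≤ (C * |z.im| ^ (M + 1) * Real.exp (-(Real.pi / 2) * |z.im|)) * (|K| + 1) /
        Real.Gamma ((M + 1 : ℕ) : ℝ) := by
      gcongr
    _ = _ := by ring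

open Filter Topology Complex in
theorem tendsto_tsum_inv_sq_add_sq {β : ℝ} (hβ : 0 < β) :
    Tendsto (fun y : ℝ => ∑' j : ℕ, (((j : ℝ) + β) ^ 2 + y ^ 2)⁻¹) atTop (𝓝 0) := by
  have hs : Summable fun j : ℕ => (((j : ℝ) + β) ^ 2)⁻¹ := by
    have := (Real.summable_one_div_nat_add_rpow β 2).2 (by norm_num)
    refine this.congr fun j => ?_
    rw [abs_of_pos (by positivity)]
    norm_num
  have := tendsto_tsum_of_dominated_convergence (𝓕 := atTop) (g := fun _ : ℕ => (0 : ℝ))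
    (f := fun (y : ℝ) (j : ℕ) => (((j : ℝ) + β) ^ 2 + y ^ 2)⁻¹) hs
    (fun j => ?_) (Eventually.of_forall fun y j => ?_)
  · simpa using this
  · exact tendsto_inv_atTop_zero.comp
      (tendsto_atTop_add_const_left _ _ (tendsto_pow_atTop two_ne_zero))
  · rw [Real.norm_of_nonneg (by positivity)]
    gcongr
    nlinarith [sq_nonneg y]

open Filter Topology Complex in
theorem summable_inv_sq_add_sq {β : ℝ} (hβ : 0 < β) (y : ℝ) :
    Summable fun j : ℕ => (((j : ℝ) + β) ^ 2 + y ^ 2)⁻¹ := by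
  have hs : Summable fun j : ℕ => (((j : ℝ) + β) ^ 2)⁻¹ := by
    have := (Real.summable_one_div_nat_add_rpow β 2).2 (by norm_num)
    refine this.congr fun j => ?_
    rw [abs_of_pos (by positivity)]
    norm_num
  refine hs.of_nonneg_of_le (fun j => by positivity) fun j => ?_
  gcongr
  nlinarith [sq_nonneg y]

open Filter Topology Complex in
/-- Second differences of `log ‖Γ‖` along a vertical line vanish at infinity. In the product formula
the factor of index `j` deviates from `1` by at most `C / ((j + β)² + y²)`. -/
theorem tendsto_norm_Gamma_second_difference {β : ℝ} (hβ : 0 < β) (γ : ℝ) :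
    Tendsto (fun y : ℝ => ‖Gamma (β + I * (y + γ : ℝ)) * Gamma (β + I * (y - γ : ℝ))‖ ^ 2 /
      ‖Gamma (β + I * y)‖ ^ 4) atTop (𝓝 1) := by
  have hre : ∀ w : ℝ, 0 < (β + I * w : ℂ).re := fun w => by simpa using hβ
  have hne : ∀ w : ℝ, ‖Gamma (β + I * w)‖ ≠ 0 := fun w =>
    norm_ne_zero_iff.2 (Gamma_ne_zero_of_re_pos (hre w))
  suffices h : Tendsto (fun y : ℝ => ‖Gamma (β + I * y)‖ ^ 4 /
      ‖Gamma (β + I * (y + γ : ℝ)) * Gamma (β + I * (y - γ : ℝ))‖ ^ 2) atTop (𝓝 1) by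
    simpa using h.inv₀ one_ne_zero
  set C : ℝ := 2 * γ ^ 2 + γ ^ 4
  have hC : 0 ≤ C := by positivity
  have key : ∀ y : ℝ, 1 ≤ y → |‖Gamma (β + I * y)‖ ^ 4 /
      ‖Gamma (β + I * (y + γ : ℝ)) * Gamma (β + I * (y - γ : ℝ))‖ ^ 2 - 1| ≤
      Real.exp (C * ∑' j : ℕ, (((j : ℝ) + β) ^ 2 + y ^ 2)⁻¹) - 1 := by
    intro y hy
    have hlim := ((((GammaSeq_tendsto_Gamma (β + I * y)).norm.pow 4).div
      (((GammaSeq_tendsto_Gamma (β + I * (y + γ : ℝ))).mul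
        (GammaSeq_tendsto_Gamma (β + I * (y - γ : ℝ)))).norm.pow 2)
        (by rw [norm_mul]; exact pow_ne_zero _ (mul_ne_zero (hne _) (hne _)))).sub_const 1).abs
    refine le_of_tendsto hlim ?_
    filter_upwards [eventually_gt_atTop 0] with n hn
    have hn' : (0 : ℝ) < n := by exact_mod_cast hn
    have hG : ∀ w : ℝ, ‖GammaSeq (β + I * w) n‖ ^ 2 = ((n : ℝ) ^ β * n.factorial) ^ 2 /
        ∏ j ∈ Finset.range (n + 1), (((j : ℝ) + β) ^ 2 + w ^ 2) := by
      intro w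
      rw [GammaSeq, norm_div, norm_mul, show (n : ℂ) = ((n : ℝ) : ℂ) by simp,
        norm_cpow_eq_rpow_re_of_pos hn', norm_prod, div_pow, ← Finset.prod_pow]
      congr 1
      · simp
      · refine Finset.prod_congr rfl fun j _ => ?_
        rw [← normSq_eq_norm_sq, normSq_apply]
        simp
        ring
    have hpp : ∀ w : ℝ, 0 < ∏ j ∈ Finset.range (n + 1), (((j : ℝ) + β) ^ 2 + w ^ 2) := fun w =>
      Finset.prod_pos fun j _ => by positivity
    have hquot : ‖GammaSeq (β + I * y) n‖ ^ 4 /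
        ‖GammaSeq (β + I * (y + γ : ℝ)) n * GammaSeq (β + I * (y - γ : ℝ)) n‖ ^ 2 =
        ∏ j ∈ Finset.range (n + 1), (1 + (2 * γ ^ 2 * (((j : ℝ) + β) ^ 2 - y ^ 2) + γ ^ 4) /
          (((j : ℝ) + β) ^ 2 + y ^ 2) ^ 2) := by
      rw [norm_mul, mul_pow, hG, hG, show ‖GammaSeq (β + I * y) n‖ ^ 4 =
        (‖GammaSeq (β + I * y) n‖ ^ 2) ^ 2 by ring, hG, div_pow, div_mul_div_comm]
      have hE : ((n : ℝ) ^ β * n.factorial) ^ 2 ≠ 0 := by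
        have := Real.rpow_pos_of_pos hn' β
        positivity
      rw [← sq (((n : ℝ) ^ β * n.factorial) ^ 2), div_div_div_cancel_left' _ _ (pow_ne_zero 2 hE),
        ← Finset.prod_mul_distrib, ← Finset.prod_pow, ← Finset.prod_div_distrib]
      refine Finset.prod_congr rfl fun j _ => ?_
      have : ((j : ℝ) + β) ^ 2 + y ^ 2 ≠ 0 := by positivity
      field_simp
      ring
    rw [Pi.div_apply, hquot]
    refine (Finset.norm_prod_one_add_sub_one_le (R := ℝ) (Finset.range (n + 1)) fun j => (2 * γ ^ 2 *
      (((j : ℝ) + β) ^ 2 - y ^ 2) + γ ^ 4) / (((j : ℝ) + β) ^ 2 + y ^ 2) ^ 2).trans ?_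
    gcongr
    rw [← tsum_mul_left]
    refine (Finset.sum_le_sum fun j _ => ?_).trans
      (((summable_inv_sq_add_sq hβ y).mul_left C).sum_le_tsum _ fun j _ => by positivity)
    rw [norm_div, Real.norm_eq_abs, Real.norm_of_nonneg (by positivity : 0 ≤ (((j : ℝ) + β) ^ 2 + y ^ 2) ^ 2),
      div_le_iff₀ (by positivity)]
    have hs : 0 < ((j : ℝ) + β) ^ 2 + y ^ 2 := by positivity
    have e : C * (((j : ℝ) + β) ^ 2 + y ^ 2)⁻¹ * (((j : ℝ) + β) ^ 2 + y ^ 2) ^ 2 =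
        C * (((j : ℝ) + β) ^ 2 + y ^ 2) := by field_simp
    rw [e, abs_le]
    have h4 : 0 ≤ γ ^ 4 := by positivity
    have h2 : 0 ≤ γ ^ 2 := by positivity
    have hj : 0 ≤ ((j : ℝ) + β) ^ 2 := by positivity
    have hy2 : 1 ≤ y ^ 2 := by nlinarith
    constructor <;> simp only [C] <;> nlinarith [mul_nonneg h2 hj, mul_nonneg h2 (sq_nonneg y),
      mul_nonneg h4 hj, mul_nonneg h4 (sub_nonneg.2 hy2)]
  have hz : Tendsto (fun y : ℝ => Real.exp (C * ∑' j : ℕ, (((j : ℝ) + β) ^ 2 + y ^ 2)⁻¹) - 1)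
      atTop (𝓝 0) := by
    have h1 := (tendsto_tsum_inv_sq_add_sq hβ).const_mul C
    rw [mul_zero] at h1
    simpa using ((Real.continuous_exp.tendsto 0).comp h1).sub_const 1
  rw [tendsto_iff_norm_sub_tendsto_zero]
  refine squeeze_zero' (Eventually.of_forall fun _ => norm_nonneg _) ?_ hz
  filter_upwards [eventually_ge_atTop 1] with y hy using key y hy

/-! ### A residue computation on the unit strip -/

open Filter Topology Complex in
/-- A quotient of holomorphic functions extends holomorphically across the simple zeros of the
denominator at which the numerator vanishes. -/
theorem exists_differentiableOn_quotient {U : Set ℂ} (hU : IsOpen U) {N D : ℂ → ℂ}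
    (hN : DifferentiableOn ℂ N U) (hD : DifferentiableOn ℂ D U)
    (h0 : ∀ z ∈ U, D z = 0 → N z = 0 ∧ deriv D z ≠ 0) :
    ∃ Q : ℂ → ℂ, DifferentiableOn ℂ Q U ∧ ∀ z, D z ≠ 0 → Q z = N z / D z := by
  classical
  refine ⟨fun z => if D z = 0 then deriv N z / deriv D z else N z / D z, fun p hp => ?_,
    fun z hz => if_neg hz⟩
  have hUp : U ∈ 𝓝 p := hU.mem_nhds hp
  refine DifferentiableAt.differentiableWithinAt ?_
  by_cases hDp : D p = 0
  · obtain ⟨hNp, hD'⟩ := h0 p hp hDp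
    have h1 : DifferentiableAt ℂ (dslope N p) p :=
      ((differentiableOn_dslope hUp).2 hN).differentiableAt hUp
    have h2 : DifferentiableAt ℂ (dslope D p) p :=
      ((differentiableOn_dslope hUp).2 hD).differentiableAt hUp
    have h3 : dslope D p p ≠ 0 := by rwa [dslope_same]
    refine (h1.div h2 h3).congr_of_eventuallyEq ?_
    filter_upwards [h2.continuousAt.eventually_ne h3] with z hz
    rcases eq_or_ne z p with rfl | hzp
    · simp [hDp, dslope_same]
    · have hzp' := sub_ne_zero.2 hzp
      rw [dslope_of_ne _ hzp, slope_def_field, hDp, sub_zero] at hz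
      have hDz : D z ≠ 0 := fun h => hz (by simp [h])
      rw [if_neg hDz, Pi.div_apply, dslope_of_ne _ hzp, dslope_of_ne _ hzp, slope_def_field,
        slope_def_field, hDp, hNp]
      field_simp
      simp [mul_comm]
  · have hc := (hD.differentiableAt hUp).continuousAt.eventually_ne hDp
    refine ((hN.differentiableAt hUp).div (hD.differentiableAt hUp) hDp).congr_of_eventuallyEq ?_
    filter_upwards [hc] with z hz
    simp [hz]

/-- The open vertical strip `-ε < Re z < 1 + ε`. -/
def strip (ε : ℝ) : Set ℂ := {z | -ε < z.re ∧ z.re < 1 + ε}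

theorem isOpen_strip (ε : ℝ) : IsOpen (strip ε) :=
  (isOpen_lt continuous_const Complex.continuous_re).inter
    (isOpen_lt Complex.continuous_re continuous_const)

theorem strip_mono {ε δ : ℝ} (h : ε ≤ δ) : strip ε ⊆ strip δ := fun _ hz =>
  ⟨by linarith [hz.1], by linarith [hz.2]⟩

open Complex in
theorem sin_pi_mul_sub_ne_zero {z : ℂ} (hz : z.im ≠ 0) (a : ℝ) : sin (Real.pi * (z - a)) ≠ 0 := by
  rw [Ne, sin_eq_zero_iff]
  rintro ⟨k, hk⟩
  have := congrArg im hk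
  simp [Real.pi_ne_zero, hz] at this

open Complex in
/-- The poles of `cot π(z - a)` in the closed unit strip lie at `z₀ ≡ a` (and at the reflected
boundary point when `z₀ ∈ {0, 1}`); subtracting `Φ z₀` removes them. -/
theorem exists_cot_mul_sub_extension {Φ : ℂ → ℂ} {ε : ℝ} (hε : 0 < ε)
    (hΦ : DifferentiableOn ℂ Φ (strip ε)) (hsymm : ∀ z, Φ (1 - z) = Φ z) {a z₀ : ℝ}
    (h0 : 0 ≤ z₀) (h1 : z₀ ≤ 1) {m : ℤ} (hm : z₀ = a + m) :
    ∃ δ : ℝ, 0 < δ ∧ ∃ Q : ℂ → ℂ, DifferentiableOn ℂ Q (strip δ) ∧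
      ∀ z : ℂ, z.im ≠ 0 → Q z = cot (Real.pi * (z - a)) * (Φ z - Φ z₀) := by
  obtain ⟨δ, hδ, hδε, hδ1⟩ : ∃ δ : ℝ, 0 < δ ∧ δ ≤ ε ∧ ∀ k : ℤ, -δ < z₀ + k → z₀ + k < 1 + δ →
      Φ ((z₀ + k : ℝ) : ℂ) = Φ z₀ := by
    by_cases hz : z₀ = 0 ∨ z₀ = 1
    · refine ⟨min ε 1, lt_min hε one_pos, min_le_left _ _, fun k hk1 hk2 => ?_⟩
      have hk1' : -1 < z₀ + k := by linarith [min_le_right ε 1]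
      have hk2' : z₀ + k < 2 := by linarith [min_le_right ε 1]
      have e01 := hsymm 0
      rcases hz with rfl | rfl
      · have : -1 < k := by exact_mod_cast (by simpa using hk1' : (-1 : ℝ) < k)
        have : k < 2 := by exact_mod_cast (by simpa using hk2' : (k : ℝ) < 2)
        obtain rfl | rfl : k = 0 ∨ k = 1 := by omega
        · simp
        · simpa using e01
      · have : -2 < k := by
          have : (-2 : ℝ) < k := by linarith
          exact_mod_cast this
        have : k < 1 := by
          have : (k : ℝ) < 1 := by linarith
          exact_mod_cast this
        obtain rfl | rfl : k = 0 ∨ k = -1 := by omega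
        · simp
        · simpa using e01.symm
    · push Not at hz
      have p0 : 0 < z₀ := lt_of_le_of_ne h0 (Ne.symm hz.1)
      have p1 : 0 < 1 - z₀ := sub_pos.2 (lt_of_le_of_ne h1 hz.2)
      refine ⟨min ε (min z₀ (1 - z₀)), lt_min hε (lt_min p0 p1), min_le_left _ _,
        fun k hk1 hk2 => ?_⟩
      have m1 := (min_le_right ε (min z₀ (1 - z₀))).trans (min_le_left _ _)
      have m2 := (min_le_right ε (min z₀ (1 - z₀))).trans (min_le_right _ _)
      have : -1 < k := by
        have : (-1 : ℝ) < k := by linarith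
        exact_mod_cast this
      have : k < 1 := by
        have : (k : ℝ) < 1 := by linarith
        exact_mod_cast this
      obtain rfl : k = 0 := by omega
      simp
  have hder : ∀ z : ℂ, HasDerivAt (fun z : ℂ => sin (Real.pi * (z - a)))
      (cos (Real.pi * (z - a)) * Real.pi) z := fun z => by
    have := (((hasDerivAt_id z).sub_const (a : ℂ)).const_mul (Real.pi : ℂ)).csin
    simpa using this
  obtain ⟨Q, hQ, hQe⟩ := exists_differentiableOn_quotient (isOpen_strip δ)
    (N := fun z => cos (Real.pi * (z - a)) * (Φ z - Φ z₀))
    (D := fun z => sin (Real.pi * (z - a)))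
    ((Differentiable.differentiableOn (by fun_prop)).mul
      ((hΦ.mono (strip_mono hδε)).sub_const _))
    (fun z _ => (hder z).differentiableAt.differentiableWithinAt) (fun z hz hs => by
      have hs' := hs
      rw [sin_eq_zero_iff] at hs
      obtain ⟨k, hk⟩ := hs
      have hpi : (Real.pi : ℂ) ≠ 0 := ofReal_ne_zero.2 Real.pi_ne_zero
      have hz' : z = ((z₀ + (k - m : ℤ) : ℝ) : ℂ) := by
        have : z - a = k := mul_left_cancel₀ hpi (by rw [hk]; ring)
        rw [hm]
        push_cast
        linear_combination this
      constructor
      · have := hδ1 (k - m) (by have := hz.1; rwa [hz', ofReal_re] at this)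
          (by have := hz.2; rwa [hz', ofReal_re] at this)
        rw [← hz'] at this
        simp [this]
      · rw [(hder z).deriv]
        refine mul_ne_zero (fun hc => ?_) hpi
        have := sin_sq_add_cos_sq (Real.pi * (z - a))
        rw [hs', hc] at this
        simp at this)
  refine ⟨δ, hδ, Q, hQ, fun z hz => ?_⟩
  rw [hQe z (sin_pi_mul_sub_ne_zero hz a), cot_eq_cos_div_sin]
  ring

open Complex in
theorem norm_cot_add_I_le {w : ℂ} (hw : 0 < w.im) :
    ‖cot w + I‖ ≤ Real.exp (-w.im) / Real.sinh w.im := by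
  have hsinh := Real.sinh_pos_iff.2 hw
  have h1 : Real.sinh w.im ≤ ‖sin w‖ := by
    have := norm_sin_sq w.re w.im
    rw [show (w.re : ℂ) + I * w.im = w by rw [mul_comm]; exact re_add_im w] at this
    exact abs_le_of_sq_le_sq' (by nlinarith [sq_nonneg (Real.sin w.re)]) (norm_nonneg _) |>.2
  have h2 : sin w ≠ 0 := norm_pos_iff.1 (hsinh.trans_le h1)
  have h3 : cot w + I = exp (w * I) / sin w := by
    rw [exp_mul_I, cot_eq_cos_div_sin]
    field_simp
  rw [h3, norm_div, norm_exp]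
  have : (w * I).re = -w.im := by simp
  rw [this]
  gcongr

open Complex in
theorem cot_neg_arg (w : ℂ) : cot (-w) = -cot w := by
  rw [cot_eq_cos_div_sin, cot_eq_cos_div_sin, cos_neg, sin_neg, div_neg]

/-- The antisymmetric kernel `cot π(z - a) + cot π(z + a)`. -/
noncomputable def cotKernel (a : ℝ) (z : ℂ) : ℂ :=
  Complex.cot (Real.pi * (z - a)) + Complex.cot (Real.pi * (z + a))

open Complex in
theorem cot_add_pi (w : ℂ) : cot (w + Real.pi) = cot w := by
  rw [cot_eq_cos_div_sin, cot_eq_cos_div_sin, cos_add_pi, sin_add_pi, neg_div_neg_eq]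

open Complex in
theorem cotKernel_neg (a : ℝ) (z : ℂ) : cotKernel a (-z) = -cotKernel a z := by
  rw [cotKernel, cotKernel, show (Real.pi : ℂ) * (-z - a) = -(Real.pi * (z + a)) by ring,
    show (Real.pi : ℂ) * (-z + a) = -(Real.pi * (z - a)) by ring, cot_neg_arg, cot_neg_arg]
  ring

open Complex in
theorem cotKernel_one_add (a : ℝ) (z : ℂ) : cotKernel a (1 + z) = cotKernel a z := by
  rw [cotKernel, cotKernel, show (Real.pi : ℂ) * (1 + z - a) = (Real.pi * (z - a)) + Real.pi by ring,
    show (Real.pi : ℂ) * (1 + z + a) = (Real.pi * (z + a)) + Real.pi by ring, cot_add_pi, cot_add_pi]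

open Complex in
theorem norm_cotKernel_add_le (a : ℝ) {z : ℂ} (hz : 0 < z.im) :
    ‖cotKernel a z + 2 * I‖ ≤
      2 * (Real.exp (-(Real.pi * z.im)) / Real.sinh (Real.pi * z.im)) := by
  have h1 := norm_cot_add_I_le (w := Real.pi * (z - a)) (by simpa using mul_pos Real.pi_pos hz)
  have h2 := norm_cot_add_I_le (w := Real.pi * (z + a)) (by simpa using mul_pos Real.pi_pos hz)
  rw [show cotKernel a z + 2 * I = (cot (Real.pi * (z - a)) + I) + (cot (Real.pi * (z + a)) + I) by
    rw [cotKernel]; ring]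
  refine (norm_add_le _ _).trans ?_
  simp at h1 h2
  linarith

open Complex in
theorem norm_cotKernel_sub_le (a : ℝ) {z : ℂ} (hz : z.im < 0) :
    ‖cotKernel a z - 2 * I‖ ≤
      2 * (Real.exp (-(Real.pi * -z.im)) / Real.sinh (Real.pi * -z.im)) := by
  have := norm_cotKernel_add_le a (z := -z) (by simpa using hz)
  rw [cotKernel_neg, show -cotKernel a z + 2 * I = -(cotKernel a z - 2 * I) by ring, norm_neg]
    at this
  simpa using this

open Filter Topology in
theorem tendsto_exp_neg_div_sinh :
    Tendsto (fun Y : ℝ => 2 * (Real.exp (-(Real.pi * Y)) / Real.sinh (Real.pi * Y))) atTop (𝓝 0) := by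
  have hpi : Tendsto (fun Y : ℝ => Real.pi * Y) atTop atTop :=
    tendsto_id.const_mul_atTop Real.pi_pos
  have h1 : Tendsto (fun Y : ℝ => Real.exp (-(Real.pi * Y))) atTop (𝓝 0) :=
    Real.tendsto_exp_neg_atTop_nhds_zero.comp hpi
  have h2 : Tendsto (fun Y : ℝ => Real.sinh (Real.pi * Y)) atTop atTop := by
    refine tendsto_atTop_mono' _ ?_ hpi
    filter_upwards [eventually_ge_atTop 0] with Y hY
    exact Real.self_le_sinh_iff.2 (mul_nonneg Real.pi_pos.le hY)
  simpa using (h1.div_atTop h2).const_mul 2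

open Filter Topology Complex in
/-- Residue evaluation on the unit strip. For `Φ` holomorphic near the closed strip, invariant under
`z ↦ 1 - z` and vanishing at `±i∞`, the function `cotKernel a * (Φ - Φ z₀)` is holomorphic, odd under
`z ↦ 1 - z`, and tends to `±2i Φ z₀` at `±i∞`. Integrating it around the rectangle
`[0, 1] × [-Y, Y]` leaves twice its integral over the imaginary axis and the two horizontal edges; the
term with `Φ z₀` drops out of the sum over `±iy`, as the kernel is odd. -/
theorem tendsto_integral_cotKernel_mul {Φ : ℂ → ℂ} {ε : ℝ} (hε : 0 < ε)
    (hΦ : DifferentiableOn ℂ Φ (strip ε)) (hsymm : ∀ z, Φ (1 - z) = Φ z) {a z₀ : ℝ}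
    (h0 : 0 ≤ z₀) (h1 : z₀ ≤ 1) {m : ℤ} (hm : z₀ = a + m)
    (hdecay : ∀ δ : ℝ, 0 < δ → ∃ Y₀ : ℝ, ∀ z : ℂ, 0 ≤ z.re → z.re ≤ 1 → Y₀ ≤ |z.im| → ‖Φ z‖ ≤ δ) :
    Tendsto (fun Y : ℝ => ∫ y in (-Y)..Y,
      (cotKernel a (I * y) * Φ (I * y) + cotKernel a (-(I * y)) * Φ (-(I * y))))
      atTop (𝓝 (-4 * Φ z₀)) := by
  obtain ⟨δ₁, hδ₁, Q₁, hQ₁, hQe₁⟩ := exists_cot_mul_sub_extension hε hΦ hsymm h0 h1 hm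
  obtain ⟨δ₂, hδ₂, Q₂, hQ₂, hQe₂⟩ := exists_cot_mul_sub_extension hε hΦ hsymm
    (a := -a) (z₀ := 1 - z₀) (m := 1 - m) (by linarith) (by linarith)
    (by push_cast; rw [hm]; ring)
  set G : ℂ → ℂ := fun z => Q₁ z + Q₂ z with hGdef
  have hδ : 0 < min δ₁ δ₂ := lt_min hδ₁ hδ₂
  have hG : DifferentiableOn ℂ G (strip (min δ₁ δ₂)) :=
    (hQ₁.mono (strip_mono (min_le_left _ _))).add (hQ₂.mono (strip_mono (min_le_right _ _)))
  have hGe : ∀ z : ℂ, z.im ≠ 0 → G z = cotKernel a z * (Φ z - Φ z₀) := by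
    intro z hz
    have : Φ ((1 - z₀ : ℝ) : ℂ) = Φ z₀ := by push_cast; exact hsymm _
    rw [hGdef]
    simp only
    rw [hQe₁ z hz, hQe₂ z hz, this, cotKernel]
    push_cast
    rw [sub_neg_eq_add]
    ring
  have hcont : ∀ r : ℝ, 0 ≤ r → r ≤ 1 → Continuous fun y : ℝ => G (r + y * I) := fun r hr0 hr1 =>
    hG.continuousOn.comp_continuous (by fun_prop) fun y => by
      constructor <;> simp <;> linarith
  -- the integral along the boundary of the rectangle
  have hrect : ∀ Y : ℝ, ∫ y in (-Y)..Y,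
      (cotKernel a (I * y) * Φ (I * y) + cotKernel a (-(I * y)) * Φ (-(I * y))) =
      I * ((∫ x : ℝ in (0 : ℝ)..1, G (x + Y * I)) - ∫ x : ℝ in (0 : ℝ)..1, G (x + (-Y : ℝ) * I)) := by
    intro Y
    have hR := integral_boundary_rect_eq_zero_of_differentiableOn G (((-Y : ℝ) : ℂ) * I)
      (1 + (Y : ℂ) * I) (hG.mono fun z hz => by
        have h := hz.1
        simp [Set.mem_preimage] at h
        exact ⟨by linarith, by linarith⟩)
    have hae : ∀ f g : ℝ → ℂ, (∀ y, y ≠ 0 → f y = g y) →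
        ∫ y in (-Y)..Y, f y = ∫ y in (-Y)..Y, g y := fun f g hfg => by
      refine intervalIntegral.integral_congr_ae ?_
      filter_upwards [Measure.ae_ne volume 0] with y hy _ using hfg y hy
    have e1 : ∫ y in (-Y)..Y, G (1 + y * I) = -∫ y in (-Y)..Y, G (0 + y * I) := by
      have : ∫ y in (-Y)..Y, G (0 + y * I) = ∫ y in (-Y)..Y, G (0 + (-y : ℝ) * I) := by
        rw [intervalIntegral.integral_comp_neg (fun y : ℝ => G (0 + y * I)), neg_neg]
      rw [this, ← intervalIntegral.integral_neg]
      refine hae _ _ fun y hy => ?_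
      rw [hGe _ (by simpa using hy), hGe _ (by simpa using hy), cotKernel_one_add]
      have : Φ (1 + y * I) = Φ (-(y * I)) := by rw [← hsymm]; congr 1; ring
      have e : (0 : ℂ) + ((-y : ℝ) : ℂ) * I = -(y * I) := by push_cast; ring
      rw [this, e, cotKernel_neg]
      ring
    have e2 : ∫ y in (-Y)..Y,
        (cotKernel a (I * y) * Φ (I * y) + cotKernel a (-(I * y)) * Φ (-(I * y))) =
        ∫ y in (-Y)..Y, (G (0 + y * I) + G (0 + (-y : ℝ) * I)) := by
      refine hae _ _ fun y hy => ?_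
      rw [hGe _ (by simpa using hy), hGe _ (by simpa using hy)]
      have e : (0 : ℂ) + ((-y : ℝ) : ℂ) * I = -(I * y) := by push_cast; ring
      have e' : (0 : ℂ) + (y : ℂ) * I = I * y := by ring
      rw [e, e', cotKernel_neg]
      ring
    have hi : ∀ Y, IntervalIntegrable (fun y : ℝ => G (0 + y * I)) volume (-Y) Y := fun Y => by
      have := (hcont 0 le_rfl zero_le_one).intervalIntegrable (μ := volume) (-Y) Y
      simpa using this
    have hi' : IntervalIntegrable (fun y : ℝ => G (0 + (-y : ℝ) * I)) volume (-Y) Y := by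
      have := ((hcont 0 le_rfl zero_le_one).comp continuous_neg).intervalIntegrable
        (μ := volume) (-Y) Y
      simpa [Function.comp_def] using this
    rw [e2, intervalIntegral.integral_add (hi Y) hi',
      intervalIntegral.integral_comp_neg (fun y : ℝ => G (0 + y * I)), neg_neg]
    simp only [mul_re, ofReal_re, I_re, mul_zero, ofReal_im, I_im, mul_one, sub_self, add_re,
      one_re, add_zero, mul_im, zero_add, add_im, one_im, smul_eq_mul, ofReal_one, ofReal_zero] at hR
    simp only [zero_add] at e1 ⊢
    rw [e1] at hR
    linear_combination I * hR + 2 * (∫ y in (-Y)..Y, G (y * I)) * I_sq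
  -- the horizontal edges
  set η : ℝ → ℝ := fun Y => 2 * (Real.exp (-(Real.pi * Y)) / Real.sinh (Real.pi * Y)) with hη
  have hedge : ∀ σ : ℝ, (σ = 1 ∨ σ = -1) → Tendsto (fun Y : ℝ => ∫ x : ℝ in (0 : ℝ)..1,
      G (x + (σ * Y : ℝ) * I)) atTop (𝓝 (2 * σ * I * Φ z₀)) := by
    intro σ hσ
    have hk : ∀ Y : ℝ, 0 < Y → ∀ x : ℝ,
        ‖cotKernel a (x + (σ * Y : ℝ) * I) + 2 * σ * I‖ ≤ η Y := by
      intro Y hY x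
      rcases hσ with rfl | rfl
      · have := norm_cotKernel_add_le a (z := x + ((1 * Y : ℝ) : ℂ) * I) (by simpa using hY)
        simpa using this
      · have := norm_cotKernel_sub_le a (z := x + ((-1 * Y : ℝ) : ℂ) * I) (by simpa using hY)
        simpa [sub_eq_add_neg] using this
    have hσn : ‖(2 * σ * I : ℂ)‖ = 2 := by rcases hσ with rfl | rfl <;> simp
    rw [Metric.tendsto_atTop]
    intro e he
    obtain ⟨Y₀, hY₀⟩ := hdecay (e / 8) (by positivity)
    have hη0 : Tendsto (fun Y => η Y * (1 + ‖Φ z₀‖)) atTop (𝓝 0) := by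
      simpa using tendsto_exp_neg_div_sinh.mul_const (1 + ‖Φ z₀‖)
    have hη1 := tendsto_exp_neg_div_sinh
    obtain ⟨Y₁, hY₁⟩ := (eventually_atTop).1 (hη0.eventually (gt_mem_nhds (by positivity : 0 < e / 8)))
    obtain ⟨Y₂, hY₂⟩ := (eventually_atTop).1 (hη1.eventually (gt_mem_nhds (by norm_num : (0 : ℝ) < 2)))
    refine ⟨max (max Y₀ Y₁) (max Y₂ 1), fun Y hY => ?_⟩
    simp only [ge_iff_le, max_le_iff] at hY
    have hYpos : 0 < Y := by linarith [hY.2.2]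
    have hint : IntervalIntegrable (fun x : ℝ => G (x + (σ * Y : ℝ) * I)) volume 0 1 := by
      refine ContinuousOn.intervalIntegrable ?_
      refine hG.continuousOn.comp (by fun_prop) fun x hx => ?_
      rw [Set.uIcc_of_le zero_le_one] at hx
      constructor <;> simp <;> linarith [hx.1, hx.2]
    have hc : (2 * σ * I * Φ z₀ : ℂ) = ∫ _x : ℝ in (0 : ℝ)..1, (2 * σ * I * Φ z₀ : ℂ) := by simp
    rw [dist_eq_norm, hc, ← intervalIntegral.integral_sub hint (by simp)]
    refine lt_of_le_of_lt (intervalIntegral.norm_integral_le_of_norm_le_const (C := 3 * e / 4)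
      fun x hx => ?_) (by simp; linarith)
    rw [Set.uIoc_of_le zero_le_one] at hx
    have him : ((x : ℂ) + ((σ * Y : ℝ) : ℂ) * I).im = σ * Y := by simp
    have him0 : ((x : ℂ) + ((σ * Y : ℝ) : ℂ) * I).im ≠ 0 := by
      rw [him]; rcases hσ with rfl | rfl <;> simp [hYpos.ne']
    have habs : |σ * Y| = Y := by
      rcases hσ with rfl | rfl <;> simp [abs_of_pos hYpos]
    rw [hGe _ him0]
    set z : ℂ := (x : ℂ) + ((σ * Y : ℝ) : ℂ) * I with hz
    have hΦz := hY₀ z (by simp [hz]; exact hx.1.le) (by simp [hz]; exact hx.2)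
      (by rw [him, habs]; exact hY.1.1)
    have hkz := hk Y hYpos x
    rw [← hz] at hkz
    have hY1 := hY₁ Y hY.1.2
    have hY2 : η Y < 2 := hY₂ Y hY.2.1
    have hη' : 0 ≤ η Y := (norm_nonneg _).trans hkz
    calc ‖cotKernel a z * (Φ z - Φ z₀) - 2 * σ * I * Φ z₀‖
        = ‖(cotKernel a z + 2 * σ * I) * Φ z - 2 * σ * I * Φ z -
            (cotKernel a z + 2 * σ * I) * Φ z₀‖ := by congr 1; ring
      _ ≤ η Y * ‖Φ z‖ + 2 * ‖Φ z‖ + η Y * ‖Φ z₀‖ := by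
          refine (norm_sub_le _ _).trans (add_le_add ((norm_sub_le _ _).trans (add_le_add ?_ ?_)) ?_)
          · rw [norm_mul]; gcongr
          · rw [norm_mul, hσn]
          · rw [norm_mul]; gcongr
      _ ≤ 2 * (e / 8) + 2 * (e / 8) + e / 8 := by
          have : η Y * ‖Φ z₀‖ ≤ η Y * (1 + ‖Φ z₀‖) := by nlinarith
          have : η Y * ‖Φ z‖ ≤ 2 * (e / 8) := by nlinarith [norm_nonneg (Φ z)]
          linarith
      _ ≤ 3 * e / 4 := by linarith
  have t1 := hedge 1 (Or.inl rfl)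
  have t2 := hedge (-1) (Or.inr rfl)
  have := (t1.sub t2).const_mul I
  simp only [hrect]
  refine (this.congr fun Y => ?_).trans_eq ?_
  · simp
  · congr 1
    push_cast
    linear_combination (4 * Φ z₀) * I_sq

/-! ### The first moment of the weight -/

open Complex in
theorem measurable_Gamma : Measurable Gamma := by
  have := differentiable_one_div_Gamma.continuous.measurable.inv
  simpa [Function.comp_def, Pi.inv_def] using this

open Complex in
theorem exists_norm_Gamma_add_le (b : ℂ) (A B : ℝ) : ∃ C : ℝ, 0 < C ∧ ∃ N : ℕ, ∀ z : ℂ,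
    A ≤ z.re → z.re ≤ B → |b.im| + 1 ≤ |z.im| →
    ‖Gamma (b + z)‖ ≤ C * |z.im| ^ N * Real.exp (-(Real.pi / 2) * |z.im|) := by
  obtain ⟨C, hC, N, h⟩ := exists_norm_Gamma_le (b.re + A) (b.re + B)
  refine ⟨C * 2 ^ N * Real.exp (Real.pi / 2 * |b.im|), by positivity, N, fun z hA hB hz => ?_⟩
  have e : (b + z).im = b.im + z.im := by simp
  have h1 : |z.im| - |b.im| ≤ |b.im + z.im| := by
    have := abs_sub_abs_le_abs_sub z.im (-b.im)
    rwa [abs_neg, sub_neg_eq_add, add_comm z.im] at this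
  have h2 : |b.im + z.im| ≤ 2 * |z.im| := (abs_add_le _ _).trans (by linarith)
  have h3 := h (b + z) (by simpa using hA) (by simpa using hB) (by rw [e]; linarith)
  rw [e] at h3
  refine h3.trans ?_
  have h4 : Real.exp (-(Real.pi / 2) * |b.im + z.im|) ≤
      Real.exp (Real.pi / 2 * |b.im|) * Real.exp (-(Real.pi / 2) * |z.im|) := by
    rw [← Real.exp_add]
    gcongr
    nlinarith [Real.pi_pos]
  calc C * |b.im + z.im| ^ N * Real.exp (-(Real.pi / 2) * |b.im + z.im|)
      ≤ C * (2 * |z.im|) ^ N *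
        (Real.exp (Real.pi / 2 * |b.im|) * Real.exp (-(Real.pi / 2) * |z.im|)) := by gcongr
    _ = _ := by rw [mul_pow]; ring

open Complex in
theorem norm_sin_le_exp (w : ℂ) : ‖sin w‖ ≤ Real.exp |w.im| := by
  have h := norm_sin_sq w.re w.im
  rw [show (w.re : ℂ) + I * w.im = w by rw [mul_comm]; exact re_add_im w] at h
  have h1 : ‖sin w‖ ≤ Real.cosh w.im := by
    refine abs_le_of_sq_le_sq' ?_ (Real.cosh_pos _).le |>.2
    rw [h, Real.cosh_sq]
    linarith [Real.sin_sq_le_one w.re]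
  refine h1.trans ?_
  rw [← Real.cosh_abs, Real.cosh_eq]
  have : Real.exp (-|w.im|) ≤ Real.exp |w.im| := by
    gcongr; linarith [abs_nonneg w.im]
  linarith

open Complex in
/-- Reflection formula. -/
theorem inv_Gamma_one_sub {w : ℂ} (hw : sin (Real.pi * w) ≠ 0) :
    (Gamma (1 - w))⁻¹ = Gamma w * sin (Real.pi * w) / Real.pi := by
  have h := Gamma_mul_Gamma_one_sub w
  have hpi : (Real.pi : ℂ) ≠ 0 := ofReal_ne_zero.2 Real.pi_ne_zero
  have h1 : Gamma (1 - w) ≠ 0 := fun h0 => by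
    rw [h0, mul_zero] at h
    exact (div_ne_zero hpi hw) h.symm
  rw [eq_div_iff hw] at h
  rw [inv_eq_iff_eq_inv, ← one_div, eq_div_iff (by
    rintro h2
    rw [div_eq_zero_iff, or_iff_left hpi] at h2
    rw [mul_right_comm, h2, zero_mul] at h
    exact hpi h.symm), mul_div_assoc', div_eq_one_iff_eq hpi]
  linear_combination h

/-- The auxiliary function on the unit strip whose value at `z₀ ≡ ±a` is the residue produced by the
first-moment identity of the weight. -/
noncomputable def gammaPhi (a : ℝ) (b c z : ℂ) : ℂ :=
  Complex.Gamma (b + z) * Complex.Gamma (b + 1 - z) * (Complex.Gamma (c + z) *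
    Complex.Gamma (c + 1 - z)) * ((Complex.Gamma (1 - a - z))⁻¹ * (Complex.Gamma (z - a))⁻¹)

theorem gammaPhi_one_sub (a : ℝ) (b c z : ℂ) : gammaPhi a b c (1 - z) = gammaPhi a b c z := by
  rw [gammaPhi, gammaPhi, show b + (1 - z) = b + 1 - z by ring, show b + 1 - (1 - z) = b + z by ring,
    show c + (1 - z) = c + 1 - z by ring, show c + 1 - (1 - z) = c + z by ring,
    show (1 : ℂ) - a - (1 - z) = z - a by ring, show 1 - z - (a : ℂ) = 1 - a - z by ring]
  ring

open Complex in
theorem differentiableOn_gammaPhi (a : ℝ) {b c : ℂ} :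
    DifferentiableOn ℂ (gammaPhi a b c) (strip (min b.re c.re)) := by
  intro z hz
  have hb := min_le_left b.re c.re
  have hc := min_le_right b.re c.re
  have hG : ∀ w : ℂ, 0 < w.re → DifferentiableAt ℂ Gamma w := fun w hw =>
    differentiableAt_Gamma w fun m h => by
      rw [h] at hw
      simp at hw
      linarith [(Nat.cast_nonneg m : (0 : ℝ) ≤ m)]
  have h1 : ∀ d : ℂ, min b.re c.re ≤ d.re → DifferentiableAt ℂ (fun z => Gamma (d + z)) z :=
    fun d hd => (hG _ (by simp; linarith [hz.1])).comp z (by fun_prop)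
  have h2 : ∀ d : ℂ, min b.re c.re ≤ d.re → DifferentiableAt ℂ (fun z => Gamma (d + 1 - z)) z :=
    fun d hd => (hG _ (by simp; linarith [hz.2])).comp z (by fun_prop)
  have h3 : DifferentiableAt ℂ (fun z => (Gamma (1 - a - z))⁻¹) z :=
    (differentiable_one_div_Gamma _).comp z (f := fun z => 1 - (a : ℂ) - z) (by fun_prop)
  have h4 : DifferentiableAt ℂ (fun z => (Gamma (z - a))⁻¹) z :=
    (differentiable_one_div_Gamma _).comp z (f := fun z => z - (a : ℂ)) (by fun_prop)
  exact ((((h1 b hb).mul (h2 b hb)).mul ((h1 c hc).mul (h2 c hc))).mul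
    (h3.mul h4)).differentiableWithinAt

open Filter Topology in
theorem exists_pow_mul_exp_le (C : ℝ) (N : ℕ) {δ : ℝ} (hδ : 0 < δ) :
    ∃ Y : ℝ, 0 < Y ∧ ∀ t : ℝ, Y ≤ t → C * t ^ N * Real.exp (-Real.pi * t) ≤ δ := by
  have h := (Real.tendsto_pow_mul_exp_neg_atTop_nhds_zero N).const_mul |C|
  rw [mul_zero] at h
  obtain ⟨Y, hY⟩ := eventually_atTop.1 (h.eventually (gt_mem_nhds hδ))
  refine ⟨max Y 1, by positivity, fun t ht => ?_⟩
  have ht1 : 1 ≤ t := (le_max_right _ _).trans ht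
  have := hY t ((le_max_left _ _).trans ht)
  refine le_trans ?_ this.le
  rw [mul_assoc]
  have hp := Real.pi_gt_three
  have he : Real.exp (-Real.pi * t) ≤ Real.exp (-t) := by
    gcongr; nlinarith
  calc C * (t ^ N * Real.exp (-Real.pi * t)) ≤ |C| * (t ^ N * Real.exp (-Real.pi * t)) := by
        gcongr; exact le_abs_self C
    _ ≤ _ := by gcongr

open Complex in
/-- `gammaPhi` vanishes at `±i∞`: six Gamma factors with exponent `-π/2` each, against two sines. -/
theorem exists_norm_gammaPhi_le (a : ℝ) (b c : ℂ) (δ : ℝ) (hδ : 0 < δ) :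
    ∃ Y₀ : ℝ, ∀ z : ℂ, 0 ≤ z.re → z.re ≤ 1 → Y₀ ≤ |z.im| → ‖gammaPhi a b c z‖ ≤ δ := by
  have key : ∀ d : ℂ, ∃ C : ℝ, 0 < C ∧ ∃ N : ℕ, ∀ z : ℂ, 0 ≤ z.re → z.re ≤ 1 →
      |d.im| + 1 ≤ |z.im| → ‖Gamma (d + z) * Gamma (d + 1 - z)‖ ≤
        C * |z.im| ^ N * Real.exp (-Real.pi * |z.im|) := by
    intro d
    obtain ⟨C₁, hC₁, N₁, h₁⟩ := exists_norm_Gamma_add_le d 0 1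
    obtain ⟨C₂, hC₂, N₂, h₂⟩ := exists_norm_Gamma_add_le (d + 1) (-1) 0
    refine ⟨C₁ * C₂, by positivity, N₁ + N₂, fun z hz0 hz1 hz => ?_⟩
    have g1 := h₁ z hz0 hz1 hz
    have g2 := h₂ (-z) (by simpa using hz1) (by simpa using hz0) (by simpa using hz)
    rw [neg_im, abs_neg, ← sub_eq_add_neg] at g2
    rw [norm_mul]
    refine (mul_le_mul g1 g2 (norm_nonneg _) (by positivity)).trans_eq ?_
    rw [show -Real.pi * |z.im| = -(Real.pi / 2) * |z.im| + -(Real.pi / 2) * |z.im| by ring,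
      Real.exp_add]
    ring
  obtain ⟨Ca, hCa, Na, ha⟩ := key a
  obtain ⟨Cb, hCb, Nb, hb⟩ := key b
  obtain ⟨Cc, hCc, Nc, hc⟩ := key c
  obtain ⟨Y, hY, hYd⟩ := exists_pow_mul_exp_le (Cb * Cc * Ca) (Nb + Nc + Na) hδ
  refine ⟨max Y (max (|b.im| + 1) (|c.im| + 1)), fun z hz0 hz1 hz => ?_⟩
  simp only [max_le_iff] at hz
  have him : z.im ≠ 0 := fun h => by
    rw [h, abs_zero] at hz
    linarith [hz.1]
  have hz1' : 1 ≤ |z.im| := by linarith [hz.2.1, abs_nonneg b.im]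
  refine le_trans ?_ (hYd |z.im| hz.1)
  have hA := ha z hz0 hz1 (by simpa using hz1')
  have hB := hb z hz0 hz1 hz.2.1
  have hC := hc z hz0 hz1 hz.2.2
  have s1 : sin (Real.pi * (a + z)) ≠ 0 := by
    have := sin_pi_mul_sub_ne_zero him (-a)
    rw [ofReal_neg, sub_neg_eq_add] at this
    rwa [add_comm (a : ℂ)]
  have s2 : sin (Real.pi * (a + 1 - z)) ≠ 0 := by
    have := sin_pi_mul_sub_ne_zero (z := -z) (by simpa using him) (-(a + 1))
    rwa [show -z - ((-(a + 1) : ℝ) : ℂ) = a + 1 - z by push_cast; ring] at this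
  have i1 := inv_Gamma_one_sub s1
  have i2 := inv_Gamma_one_sub s2
  rw [show (1 : ℂ) - (a + z) = 1 - a - z by ring] at i1
  rw [show (1 : ℂ) - (a + 1 - z) = z - a by ring] at i2
  have hsin : ∀ w : ℂ, |w.im| = Real.pi * |z.im| → ‖sin w‖ ≤ Real.exp (Real.pi * |z.im|) :=
    fun w hw => hw ▸ norm_sin_le_exp w
  have n1 := hsin (Real.pi * (a + z)) (by simp [abs_mul, abs_of_pos Real.pi_pos])
  have n2 := hsin (Real.pi * (a + 1 - z)) (by simp [abs_mul, abs_of_pos Real.pi_pos])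
  have hinv : ‖(Gamma (1 - a - z))⁻¹ * (Gamma (z - a))⁻¹‖ ≤ Ca * |z.im| ^ Na *
      Real.exp (-Real.pi * |z.im|) * (Real.exp (Real.pi * |z.im|) * Real.exp (Real.pi * |z.im|)) := by
    rw [i1, i2, show Gamma (a + z) * sin (Real.pi * (a + z)) / Real.pi *
      (Gamma (a + 1 - z) * sin (Real.pi * (a + 1 - z)) / Real.pi) =
      (Gamma (a + z) * Gamma (a + 1 - z)) * (sin (Real.pi * (a + z)) * sin (Real.pi * (a + 1 - z))) *
        ((Real.pi : ℂ)⁻¹ * (Real.pi : ℂ)⁻¹) by ring, norm_mul, norm_mul]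
    have hp1 : ‖(Real.pi : ℂ)⁻¹ * (Real.pi : ℂ)⁻¹‖ ≤ 1 := by
      rw [norm_mul, norm_inv, norm_real, Real.norm_of_nonneg Real.pi_pos.le]
      have : Real.pi⁻¹ ≤ 1 := inv_le_one_of_one_le₀ (by linarith [Real.pi_gt_three])
      have h0 : 0 ≤ Real.pi⁻¹ := by positivity
      nlinarith
    rw [norm_mul (sin _)]
    refine (mul_le_of_le_one_right (by positivity) hp1).trans ?_
    gcongr
  rw [gammaPhi, norm_mul, norm_mul]
  calc _ ≤ (Cb * |z.im| ^ Nb * Real.exp (-Real.pi * |z.im|)) *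
        (Cc * |z.im| ^ Nc * Real.exp (-Real.pi * |z.im|)) * (Ca * |z.im| ^ Na *
      Real.exp (-Real.pi * |z.im|) *
        (Real.exp (Real.pi * |z.im|) * Real.exp (Real.pi * |z.im|))) := by gcongr
    _ = Cb * Cc * Ca * |z.im| ^ (Nb + Nc + Na) * Real.exp (-Real.pi * |z.im|) *
        ((Real.exp (-Real.pi * |z.im|) * Real.exp (Real.pi * |z.im|)) *
         (Real.exp (-Real.pi * |z.im|) * Real.exp (Real.pi * |z.im|))) := by ring
    _ = _ := by rw [← Real.exp_add]; simp

/-- `b` and `c` form a pair closed under complex conjugation: both real, or conjugate to each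
other. -/
def IsPair (b c : ℂ) : Prop := c = (starRingEnd ℂ) b ∨ (b.im = 0 ∧ c.im = 0)

/-- The weight of the continuous dual Hahn polynomials in the variable `y = √x / 2`. The factor
`2 y sinh(2πy) / π` is `|Γ(2iy)|⁻²`. -/
noncomputable def cdhWeight (a : ℝ) (b c : ℂ) (y : ℝ) : ℝ :=
  ‖Complex.Gamma (a + Complex.I * y) * Complex.Gamma (b + Complex.I * y) *
    Complex.Gamma (c + Complex.I * y)‖ ^ 2 * (2 * y * Real.sinh (Real.pi * (2 * y)) / Real.pi)

theorem two_mul_sinh_nonneg (y : ℝ) : 0 ≤ 2 * y * Real.sinh (Real.pi * (2 * y)) / Real.pi := by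
  refine div_nonneg ?_ Real.pi_pos.le
  rcases le_total 0 y with h | h
  · exact mul_nonneg (by positivity) (Real.sinh_nonneg_iff.2 (by positivity))
  · refine mul_nonneg_of_nonpos_of_nonpos (by linarith) (Real.sinh_nonpos_iff.2 ?_)
    nlinarith [Real.pi_pos]

theorem cdhWeight_nonneg (a : ℝ) (b c : ℂ) (y : ℝ) : 0 ≤ cdhWeight a b c y :=
  mul_nonneg (by positivity) (two_mul_sinh_nonneg y)

theorem measurable_cdhWeight (a : ℝ) (b c : ℂ) : Measurable (cdhWeight a b c) := by
  unfold cdhWeight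
  have h : ∀ d : ℂ, Measurable fun y : ℝ => Complex.Gamma (d + Complex.I * y) := fun d =>
    measurable_Gamma.comp (by fun_prop)
  have hs : Measurable fun y : ℝ => Real.sinh (Real.pi * (2 * y)) :=
    Real.continuous_sinh.measurable.comp (by fun_prop)
  exact (((((h a).mul (h b)).mul (h c)).norm).pow_const 2).mul
    (((measurable_id.const_mul 2).mul hs).div_const _)

open Complex in
theorem IsPair.gamma_mul_conj {b c : ℂ} (h : IsPair b c) (y : ℝ) :
    (starRingEnd ℂ) (Gamma (b + I * y) * Gamma (c + I * y)) =
      Gamma (b - I * y) * Gamma (c - I * y) := by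
  rw [map_mul, ← Gamma_conj, ← Gamma_conj]
  simp only [map_add, map_mul, conj_I, conj_ofReal, neg_mul, ← sub_eq_add_neg]
  rcases h with rfl | ⟨h1, h2⟩
  · rw [conj_conj, mul_comm]
  · rw [conj_eq_iff_im.2 h1, conj_eq_iff_im.2 h2]

open Complex in
/-- The weight as a product of values of holomorphic functions at `±iy`. -/
theorem cdhWeight_eq (a : ℝ) {b c : ℂ} (h : IsPair b c) (y : ℝ) :
    (cdhWeight a b c y : ℂ) = Gamma (a + I * y) * Gamma (a - I * y) *
      (Gamma (b + I * y) * Gamma (b - I * y)) * (Gamma (c + I * y) * Gamma (c - I * y)) *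
      (-2 * (I * y) * sin (2 * Real.pi * (I * y)) / Real.pi) := by
  have h1 : (starRingEnd ℂ) (Gamma (a + I * y)) = Gamma (a - I * y) := by
    rw [← Gamma_conj]
    simp [sub_eq_add_neg]
  have h2 : sin (2 * Real.pi * (I * y)) = I * Real.sinh (Real.pi * (2 * y)) := by
    rw [show 2 * (Real.pi : ℂ) * (I * y) = ((Real.pi * (2 * y) : ℝ) : ℂ) * I by push_cast; ring,
      sin_mul_I, ← ofReal_sinh]
    ring
  rw [cdhWeight, h2]
  push_cast
  rw [← mul_conj', mul_assoc (Gamma _) (Gamma _) (Gamma _), map_mul, h1, h.gamma_mul_conj]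
  have := I_sq
  linear_combination ((Gamma (a + I * y) * (Gamma (b + I * y) * Gamma (c + I * y)) *
    (Gamma (a - I * y) * (Gamma (b - I * y) * Gamma (c - I * y)))) *
    (2 * y * sinh (Real.pi * (2 * y)) / Real.pi)) * this

open Complex in
theorem exists_cdhWeight_le_of_abs_ge (a : ℝ) (b c : ℂ) : ∃ C : ℝ, 0 < C ∧ ∃ N : ℕ, ∃ Y : ℝ, 0 < Y ∧
    ∀ y : ℝ, Y ≤ |y| → cdhWeight a b c y ≤ C * |y| ^ N * Real.exp (-Real.pi * |y|) := by
  have key : ∀ d : ℂ, ∃ C : ℝ, 0 < C ∧ ∃ N : ℕ, ∀ y : ℝ, |d.im| + 1 ≤ |y| →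
      ‖Gamma (d + I * y)‖ ≤ C * |y| ^ N * Real.exp (-(Real.pi / 2) * |y|) := by
    intro d
    obtain ⟨C, hC, N, h⟩ := exists_norm_Gamma_add_le d 0 0
    exact ⟨C, hC, N, fun y hy => by simpa using h (I * y) (by simp) (by simp) (by simpa using hy)⟩
  obtain ⟨Ca, hCa, Na, ha⟩ := key a
  obtain ⟨Cb, hCb, Nb, hb⟩ := key b
  obtain ⟨Cc, hCc, Nc, hc⟩ := key c
  refine ⟨(Ca * Cb * Cc) ^ 2, by positivity, 2 * (Na + Nb + Nc) + 1,
    max (|b.im| + 1) (|c.im| + 1), by positivity, fun y hy => ?_⟩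
  simp only [max_le_iff] at hy
  have hA := ha y (by simp; linarith [hy.1, abs_nonneg b.im])
  have hB := hb y hy.1
  have hC := hc y hy.2
  have hsinh : 2 * y * Real.sinh (Real.pi * (2 * y)) / Real.pi ≤
      |y| * (Real.exp (Real.pi * |y|) * Real.exp (Real.pi * |y|)) := by
    have e : 2 * y * Real.sinh (Real.pi * (2 * y)) =
        2 * |y| * Real.sinh (Real.pi * (2 * |y|)) := by
      rcases abs_cases y with h | h
      · rw [h.1]
      · rw [h.1, show Real.pi * (2 * -y) = -(Real.pi * (2 * y)) by ring, Real.sinh_neg]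
        ring
    rw [e, ← Real.exp_add, div_le_iff₀ Real.pi_pos, Real.sinh_eq]
    have e1 : Real.pi * |y| + Real.pi * |y| = Real.pi * (2 * |y|) := by ring
    rw [e1]
    have p1 := Real.exp_pos (Real.pi * (2 * |y|))
    have p2 := Real.exp_pos (-(Real.pi * (2 * |y|)))
    have h3 := Real.pi_gt_three
    have hy0 := abs_nonneg y
    have : |y| * Real.exp (Real.pi * (2 * |y|)) ≤ |y| * Real.exp (Real.pi * (2 * |y|)) * Real.pi := by
      nlinarith [mul_nonneg hy0 p1.le]
    nlinarith [mul_nonneg hy0 p2.le]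
  rw [cdhWeight, norm_mul, norm_mul]
  calc _ ≤ ((Ca * |y| ^ Na * Real.exp (-(Real.pi / 2) * |y|)) *
        (Cb * |y| ^ Nb * Real.exp (-(Real.pi / 2) * |y|)) *
        (Cc * |y| ^ Nc * Real.exp (-(Real.pi / 2) * |y|))) ^ 2 *
        (|y| * (Real.exp (Real.pi * |y|) * Real.exp (Real.pi * |y|))) := by
          refine mul_le_mul ?_ hsinh (two_mul_sinh_nonneg y) (by positivity)
          gcongr
    _ = (Ca * Cb * Cc) ^ 2 * |y| ^ (2 * (Na + Nb + Nc) + 1) *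
        ((Real.exp (-(Real.pi / 2) * |y|)) ^ 6 * Real.exp (Real.pi * |y|) ^ 2) := by ring
    _ = _ := by
      congr 1
      rw [← Real.exp_nat_mul, ← Real.exp_nat_mul, ← Real.exp_add]
      congr 1
      push_cast
      ring

open Complex in
/-- Near `y = 0` a pole of `Γ(a + iy)` is compensated by the zero of `|Γ(2iy)|⁻²`. -/
theorem exists_cdhWeight_le_of_abs_le (a : ℝ) {b c : ℂ} (hb : 0 < b.re) (hc : 0 < c.re) (Y : ℝ) :
    ∃ K : ℝ, ∀ y : ℝ, |y| ≤ Y → cdhWeight a b c y ≤ K := by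
  set g : ℝ → ℝ := fun y => ‖(Gamma (1 - (a + I * y)))⁻¹ * Gamma (b + I * y) *
    Gamma (c + I * y)‖ ^ 2 * (4 * Real.cosh (Real.pi * y)) with hg
  have hG : ∀ d : ℂ, 0 < d.re → Continuous fun y : ℝ => Gamma (d + I * y) := fun d hd => by
    refine continuous_iff_continuousAt.2 fun y => ?_
    refine ContinuousAt.comp (f := fun y : ℝ => d + I * (y : ℂ)) ?_ (by fun_prop)
    refine (differentiableAt_Gamma _ fun m h => ?_).continuousAt
    have := congrArg re h
    simp at this
    linarith [(Nat.cast_nonneg m : (0 : ℝ) ≤ m)]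
  have hcont : Continuous g := by
    have h1 : Continuous fun y : ℝ => (Gamma (1 - (a + I * y)))⁻¹ :=
      differentiable_one_div_Gamma.continuous.comp (by fun_prop)
    exact ((((h1.mul (hG b hb)).mul (hG c hc)).norm).pow 2).mul
      (continuous_const.mul (Real.continuous_cosh.comp (by fun_prop)))
  have hle : ∀ y, cdhWeight a b c y ≤ g y := by
    intro y
    rcases eq_or_ne y 0 with rfl | hy
    · have : cdhWeight a b c 0 = 0 := by simp [cdhWeight]
      rw [this]
      positivity
    have hs : sin (Real.pi * (a + I * y)) ≠ 0 := by
      have := sin_pi_mul_sub_ne_zero (z := I * y) (by simpa using hy) (-a)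
      rwa [ofReal_neg, sub_neg_eq_add, add_comm] at this
    have hsn : Real.sinh (Real.pi * y) ^ 2 ≤ ‖sin (Real.pi * (a + I * y))‖ ^ 2 := by
      have := norm_sin_sq (Real.pi * a) (Real.pi * y)
      rw [show ((Real.pi * a : ℝ) : ℂ) + I * ((Real.pi * y : ℝ) : ℂ) = Real.pi * (a + I * y) by
        push_cast; ring] at this
      rw [this]
      nlinarith [sq_nonneg (Real.sin (Real.pi * a))]
    have hkey : 2 * y * Real.sinh (Real.pi * (2 * y)) / Real.pi ≤
        ‖sin (Real.pi * (a + I * y)) / Real.pi‖ ^ 2 * (4 * Real.cosh (Real.pi * y)) := by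
      rw [norm_div, norm_real, Real.norm_of_nonneg Real.pi_pos.le, div_pow,
        show Real.pi * (2 * y) = 2 * (Real.pi * y) by ring, Real.sinh_two_mul]
      have hc1 := Real.cosh_pos (Real.pi * y)
      have h2 : Real.pi * y * Real.sinh (Real.pi * y) ≤ Real.sinh (Real.pi * y) ^ 2 := by
        rcases le_total 0 y with h | h
        · have h0 : 0 ≤ Real.pi * y := mul_nonneg Real.pi_pos.le h
          have := Real.self_le_sinh_iff.2 h0
          nlinarith [Real.sinh_nonneg_iff.2 h0]
        · have h0 : Real.pi * y ≤ 0 := mul_nonpos_of_nonneg_of_nonpos Real.pi_pos.le h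
          have := Real.sinh_le_self_iff.2 h0
          nlinarith [Real.sinh_nonpos_iff.2 h0]
      have h3 : Real.pi * y * Real.sinh (Real.pi * y) ≤ ‖sin (Real.pi * (a + I * y))‖ ^ 2 :=
        h2.trans hsn
      have e : 2 * y * (2 * Real.sinh (Real.pi * y) * Real.cosh (Real.pi * y)) / Real.pi =
          (Real.pi * y * Real.sinh (Real.pi * y)) / Real.pi ^ 2 * (4 * Real.cosh (Real.pi * y)) := by
        field_simp
        ring
      rw [e]
      gcongr
    rw [hg]
    simp only
    rw [inv_Gamma_one_sub hs, cdhWeight]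
    calc _ ≤ ‖Gamma (a + I * y) * Gamma (b + I * y) * Gamma (c + I * y)‖ ^ 2 *
          (‖sin (Real.pi * (a + I * y)) / Real.pi‖ ^ 2 * (4 * Real.cosh (Real.pi * y))) := by gcongr
      _ = _ := by
        rw [← mul_assoc, ← mul_pow, ← norm_mul]
        congr 3
        ring
  obtain ⟨K, hK⟩ := (isCompact_Icc (a := -Y) (b := Y)).bddAbove_image hcont.continuousOn
  exact ⟨K, fun y hy => (hle y).trans (hK ⟨y, abs_le.1 hy, rfl⟩)⟩

theorem exists_cdhWeight_le (a : ℝ) {b c : ℂ} (hb : 0 < b.re) (hc : 0 < c.re) (k : ℕ) :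
    ∃ K : ℝ, ∀ y : ℝ, (1 + y ^ 2) ^ k * cdhWeight a b c y ≤ K := by
  obtain ⟨C, hC, N, Y, hY, h⟩ := exists_cdhWeight_le_of_abs_ge a b c
  obtain ⟨Y', hY', h'⟩ := exists_pow_mul_exp_le (C * 2 ^ k) (2 * k + N) one_pos
  obtain ⟨K, hK⟩ := exists_cdhWeight_le_of_abs_le a hb hc (max (max Y Y') 1)
  refine ⟨max 1 ((1 + (max (max Y Y') 1) ^ 2) ^ k * K), fun y => ?_⟩
  rcases le_total |y| (max (max Y Y') 1) with hy | hy
  · refine le_trans ?_ (le_max_right _ _)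
    have h1 : y ^ 2 ≤ (max (max Y Y') 1) ^ 2 := by
      rw [← sq_abs y]; gcongr
    have h2 := hK y hy
    have h3 := cdhWeight_nonneg a b c y
    gcongr
  · refine le_trans ?_ (le_max_left _ _)
    simp only [max_le_iff] at hy
    refine le_trans ?_ (h' |y| hy.1.2)
    have h1 : 1 + y ^ 2 ≤ 2 * |y| ^ 2 := by
      rw [← sq_abs y]
      nlinarith [hy.2]
    calc _ ≤ (2 * |y| ^ 2) ^ k * (C * |y| ^ N * Real.exp (-Real.pi * |y|)) := by
          refine mul_le_mul (by gcongr) (h y hy.1.1) (cdhWeight_nonneg _ _ _ _) (by positivity)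
      _ = _ := by ring

theorem integrable_pow_mul_cdhWeight (a : ℝ) {b c : ℂ} (hb : 0 < b.re) (hc : 0 < c.re) (k : ℕ) :
    Integrable fun y : ℝ => (1 + y ^ 2) ^ k * cdhWeight a b c y := by
  obtain ⟨K, hK⟩ := exists_cdhWeight_le a hb hc (k + 1)
  refine (integrable_inv_one_add_sq.const_mul K).mono'
    (((by fun_prop : Measurable fun y : ℝ => (1 + y ^ 2) ^ k)).mul
      (measurable_cdhWeight a b c)).aestronglyMeasurable (Filter.Eventually.of_forall fun y => ?_)
  have h0 : 0 < 1 + y ^ 2 := by positivity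
  rw [Real.norm_of_nonneg (mul_nonneg (by positivity) (cdhWeight_nonneg _ _ _ _)),
    ← div_eq_mul_inv, le_div_iff₀ h0]
  refine le_trans (le_of_eq ?_) (hK y)
  ring

open Filter Topology Complex in
/-- The first-moment identity for the weight. The right side vanishes for `a ≥ 0`; for `a < 0` it is
the boundary term of the telescoping sum over the atoms. -/
theorem integral_cdhWeight_mul {a : ℝ} {b c : ℂ} (h : IsPair b c) (hb : 0 < b.re) (hc : 0 < c.re)
    {z₀ : ℝ} (h0 : 0 ≤ z₀) (h1 : z₀ ≤ 1) {m : ℤ} (hm : z₀ = a + m) :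
    ∫ y : ℝ, (cdhWeight a b c y : ℂ) * ((y : ℂ) ^ 2 - (a * b + b * c + c * a)) =
      4 * Real.pi * gammaPhi a b c z₀ := by
  have hpi : (Real.pi : ℂ) ≠ 0 := ofReal_ne_zero.2 Real.pi_ne_zero
  have hT := tendsto_integral_cotKernel_mul (lt_min hb hc) (differentiableOn_gammaPhi a)
    (gammaPhi_one_sub a b c) h0 h1 hm (exists_norm_gammaPhi_le a b c)
  have hprod : ∀ z : ℂ, z.im ≠ 0 → cotKernel a z * gammaPhi a b c z =
      sin (2 * Real.pi * z) / Real.pi ^ 2 * (Gamma (a + z) * Gamma (a + 1 - z) *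
        (Gamma (b + z) * Gamma (b + 1 - z)) * (Gamma (c + z) * Gamma (c + 1 - z))) := by
    intro z hz
    have t1 : sin (Real.pi * (z - a)) ≠ 0 := sin_pi_mul_sub_ne_zero hz a
    have t2 : sin (Real.pi * (z + a)) ≠ 0 := by
      have := sin_pi_mul_sub_ne_zero hz (-a)
      rwa [ofReal_neg, sub_neg_eq_add] at this
    have e1 : sin (Real.pi * (a + z)) = sin (Real.pi * (z + a)) := by rw [add_comm]
    have e2 : sin (Real.pi * (a + 1 - z)) = sin (Real.pi * (z - a)) := by
      rw [show (Real.pi : ℂ) * (a + 1 - z) = Real.pi - Real.pi * (z - a) by ring, sin_pi_sub]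
    have i1 := inv_Gamma_one_sub (e1 ▸ t2)
    have i2 := inv_Gamma_one_sub (e2 ▸ t1)
    rw [show (1 : ℂ) - (a + z) = 1 - a - z by ring, e1] at i1
    rw [show (1 : ℂ) - (a + 1 - z) = z - a by ring, e2] at i2
    have e3 : sin (2 * Real.pi * z) = sin (Real.pi * (z - a)) * cos (Real.pi * (z + a)) +
        cos (Real.pi * (z - a)) * sin (Real.pi * (z + a)) := by
      rw [← sin_add]; congr 1; ring
    rw [gammaPhi, i1, i2, cotKernel, cot_eq_cos_div_sin, cot_eq_cos_div_sin, e3]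
    field_simp
    ring
  have hS : ∀ y : ℝ, y ≠ 0 → cotKernel a (I * y) * gammaPhi a b c (I * y) +
      cotKernel a (-(I * y)) * gammaPhi a b c (-(I * y)) =
      -(1 / Real.pi) * ((cdhWeight a b c y : ℂ) * ((y : ℂ) ^ 2 - (a * b + b * c + c * a))) := by
    intro y hy
    have hG : ∀ d : ℂ, d.im = 0 ∨ 0 < d.re → d - I * y ≠ 0 ∧ d + I * y ≠ 0 := by
      intro d hd
      constructor <;> intro h0 <;> rcases hd with hd | hd
      · have := congrArg im h0
        simp [hd, hy] at this
      · have := congrArg re h0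
        simp at this
        linarith
      · have := congrArg im h0
        simp [hd, hy] at this
      · have := congrArg re h0
        simp at this
        linarith
    have hg : ∀ d : ℂ, d.im = 0 ∨ 0 < d.re → Gamma (d + 1 - I * y) = (d - I * y) * Gamma (d - I * y) ∧
        Gamma (d + 1 + I * y) = (d + I * y) * Gamma (d + I * y) := fun d hd => by
      rw [← Gamma_add_one _ (hG d hd).1, ← Gamma_add_one _ (hG d hd).2]
      constructor <;> congr 1 <;> ring
    rw [hprod (I * y) (by simpa using hy), hprod (-(I * y)) (by simpa using hy), cdhWeight_eq a h]
    have ga := hg a (Or.inl (ofReal_im a))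
    have gb := hg b (Or.inr hb)
    have gc := hg c (Or.inr hc)
    simp only [sub_neg_eq_add, ← sub_eq_add_neg]
    rw [ga.1, ga.2, gb.1, gb.2, gc.1, gc.2, mul_neg, sin_neg]
    have hI : (y : ℂ) ^ 2 = -(I * y) ^ 2 := by rw [mul_pow, I_sq]; ring
    rw [hI]
    field_simp
    ring
  have hint : Integrable fun y : ℝ =>
      (cdhWeight a b c y : ℂ) * ((y : ℂ) ^ 2 - (a * b + b * c + c * a)) := by
    have i0 := integrable_pow_mul_cdhWeight a hb hc 0
    have i1 := integrable_pow_mul_cdhWeight a hb hc 1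
    simp only [pow_zero, one_mul, pow_one] at i0 i1
    have i2 := (i1.ofReal (𝕜 := ℂ)).sub ((i0.ofReal (𝕜 := ℂ)).const_mul (1 + (a * b + b * c + c * a)))
    refine i2.congr (Eventually.of_forall fun y => ?_)
    simp
    ring
  have hlim := (intervalIntegral_tendsto_integral hint tendsto_neg_atTop_atBot tendsto_id).const_mul
    (-(1 / Real.pi) : ℂ)
  have hEq := tendsto_nhds_unique (hlim.congr fun Y => ?_) hT
  · rw [neg_mul, one_div, neg_mul, neg_inj, inv_mul_eq_iff_eq_mul₀ hpi] at hEq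
    rw [hEq]
    ring
  · rw [← intervalIntegral.integral_const_mul]
    refine intervalIntegral.integral_congr_ae ?_
    filter_upwards [Measure.ae_ne volume 0] with y hy _ using (hS y hy).symm

/-! ### The mass of the absolutely continuous part -/

/-- The parameters for which the orthogonality measure is positive with an absolutely continuous
part: `b` and `c` are nonreal and conjugate with positive real part, or `b, c` and `a + b, a + c` are all real
and positive. -/
def Admissible (a : ℝ) (b c : ℂ) : Prop :=
  (c = (starRingEnd ℂ) b ∧ b.im ≠ 0 ∧ 0 < b.re) ∨
    ((b.im = 0 ∧ c.im = 0) ∧ 0 < b.re ∧ 0 < c.re ∧ 0 < a + b.re ∧ 0 < a + c.re)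

theorem Admissible.isPair {a : ℝ} {b c : ℂ} (h : Admissible a b c) : IsPair b c :=
  h.imp (fun h => h.1) fun h => h.1

theorem Admissible.re_pos_left {a : ℝ} {b c : ℂ} (h : Admissible a b c) : 0 < b.re := by
  rcases h with h | h
  · exact h.2.2
  · exact h.2.1

theorem Admissible.re_pos_right {a : ℝ} {b c : ℂ} (h : Admissible a b c) : 0 < c.re := by
  rcases h with h | h
  · rw [h.1, Complex.conj_re]; exact h.2.2
  · exact h.2.2.1

theorem Admissible.add_one {a : ℝ} {b c : ℂ} (h : Admissible a b c) : Admissible (a + 1) b c :=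
  h.imp id fun ⟨h1, h2, h3, h4, h5⟩ => ⟨h1, h2, h3, by linarith, by linarith⟩

/-- The normalisation `Γ(a+b) Γ(a+c) Γ(b+c)`. -/
noncomputable def cdhNorm (a : ℝ) (b c : ℂ) : ℝ :=
  (Complex.Gamma (a + b) * Complex.Gamma (a + c) * Complex.Gamma (b + c)).re

open Complex in
theorem Gamma_eq_norm_of_im_eq_zero {z : ℂ} (hz : z.im = 0) (hr : 0 < z.re) :
    Gamma z = ((‖Gamma z‖ : ℝ) : ℂ) := by
  have : z = (z.re : ℂ) := by apply Complex.ext <;> simp [hz]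
  rw [this, Gamma_ofReal, norm_real, Real.norm_of_nonneg (Real.Gamma_pos_of_pos hr).le]

theorem Admissible.add_im_eq_zero {a : ℝ} {b c : ℂ} (h : Admissible a b c) : (b + c).im = 0 := by
  rcases h with h | h
  · rw [h.1]; simp
  · simp [h.1.1, h.1.2]

open Complex in
theorem Admissible.gamma_mul {a : ℝ} {b c : ℂ} (h : Admissible a b c) :
    Gamma (a + b) * Gamma (a + c) = ((‖Gamma (a + b)‖ * ‖Gamma (a + c)‖ : ℝ) : ℂ) ∧
      Gamma (a + b) ≠ 0 ∧ Gamma (a + c) ≠ 0 := by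
  rcases h with ⟨h1, h2, h3⟩ | ⟨⟨h1, h2⟩, h3, h4, h5, h6⟩
  · have e : (a : ℂ) + c = (starRingEnd ℂ) (a + b) := by rw [h1]; simp
    have hne : Gamma (a + b) ≠ 0 := Gamma_ne_zero fun m h0 => h2 (by
      have := congrArg im h0
      simpa using this)
    rw [e, Gamma_conj, norm_conj, mul_conj']
    exact ⟨by push_cast; ring, hne, (map_ne_zero _).2 hne⟩
  · have e1 := Gamma_eq_norm_of_im_eq_zero (z := a + b) (by simp [h1]) (by simpa using h5)
    have e2 := Gamma_eq_norm_of_im_eq_zero (z := a + c) (by simp [h2]) (by simpa using h6)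
    refine ⟨?_, Gamma_ne_zero_of_re_pos (by simpa using h5), Gamma_ne_zero_of_re_pos
      (by simpa using h6)⟩
    rw [ofReal_mul, ← e1, ← e2]

open Complex in
theorem Admissible.gamma_add_pos {a : ℝ} {b c : ℂ} (h : Admissible a b c) :
    Gamma (b + c) = ((‖Gamma (b + c)‖ : ℝ) : ℂ) ∧ 0 < ‖Gamma (b + c)‖ := by
  have hr : 0 < (b + c).re := by
    rw [add_re]; exact add_pos h.re_pos_left h.re_pos_right
  exact ⟨Gamma_eq_norm_of_im_eq_zero h.add_im_eq_zero hr,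
    norm_pos_iff.2 (Gamma_ne_zero_of_re_pos hr)⟩

open Complex in
theorem Admissible.cdhNorm_eq {a : ℝ} {b c : ℂ} (h : Admissible a b c) :
    cdhNorm a b c = ‖Gamma (a + b)‖ * ‖Gamma (a + c)‖ * ‖Gamma (b + c)‖ := by
  rw [cdhNorm, h.gamma_mul.1, h.gamma_add_pos.1, ← ofReal_mul, ofReal_re, norm_real, norm_norm]

open Complex in
theorem Admissible.cdhNorm_pos {a : ℝ} {b c : ℂ} (h : Admissible a b c) : 0 < cdhNorm a b c := by
  rw [h.cdhNorm_eq]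
  exact mul_pos (mul_pos (norm_pos_iff.2 h.gamma_mul.2.1) (norm_pos_iff.2 h.gamma_mul.2.2))
    h.gamma_add_pos.2

open Complex in
theorem Admissible.ofReal_cdhNorm {a : ℝ} {b c : ℂ} (h : Admissible a b c) :
    (cdhNorm a b c : ℂ) = Gamma (a + b) * Gamma (a + c) * Gamma (b + c) := by
  rw [h.cdhNorm_eq, h.gamma_mul.1, h.gamma_add_pos.1]
  push_cast
  simp

open Complex in
theorem Admissible.add_ne_zero {a : ℝ} {b c : ℂ} (h : Admissible a b c) :
    (a : ℂ) + b ≠ 0 ∧ (a : ℂ) + c ≠ 0 := by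
  constructor <;> intro h0
  · exact h.gamma_mul.2.1 (by rw [h0, Gamma_zero])
  · exact h.gamma_mul.2.2 (by rw [h0, Gamma_zero])

open Complex in
theorem Admissible.cdhNorm_add_one {a : ℝ} {b c : ℂ} (h : Admissible a b c) :
    (cdhNorm (a + 1) b c : ℂ) = (a + b) * (a + c) * cdhNorm a b c := by
  rw [h.add_one.ofReal_cdhNorm, h.ofReal_cdhNorm]
  push_cast
  rw [show (a : ℂ) + 1 + b = a + b + 1 by ring, show (a : ℂ) + 1 + c = a + c + 1 by ring,
    Gamma_add_one _ h.add_ne_zero.1, Gamma_add_one _ h.add_ne_zero.2]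
  ring

open Complex in
theorem cdhWeight_add_one (a : ℝ) (b c : ℂ) (y : ℝ) :
    cdhWeight (a + 1) b c y = (a ^ 2 + y ^ 2) * cdhWeight a b c y := by
  rcases eq_or_ne y 0 with rfl | hy
  · simp [cdhWeight]
  have hne : (a : ℂ) + I * y ≠ 0 := fun h0 => hy (by
    have := congrArg im h0
    simpa using this)
  rw [cdhWeight, cdhWeight]
  push_cast
  rw [show (a : ℂ) + 1 + I * y = a + I * y + 1 by ring, Gamma_add_one _ hne, mul_assoc (a + I * y),
    mul_assoc (a + I * y), norm_mul, mul_pow, ← normSq_eq_norm_sq, normSq_apply]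
  simp
  ring

/-- The mass of the absolutely continuous part, written in the variable `y = √x / 2`. The factor is
`4π` in place of `2π` because the even weight is integrated over the whole line. -/
noncomputable def contMass (a : ℝ) (b c : ℂ) : ℝ :=
  (∫ y : ℝ, cdhWeight a b c y) / (4 * Real.pi * cdhNorm a b c)

theorem integrable_cdhWeight (a : ℝ) {b c : ℂ} (hb : 0 < b.re) (hc : 0 < c.re) :
    Integrable (cdhWeight a b c) := by
  simpa using integrable_pow_mul_cdhWeight a hb hc 0

open Complex in
/-- The first-moment identity as a statement about masses. -/
theorem contMass_add_one_sub {a : ℝ} {b c : ℂ} (h : Admissible a b c)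
    {z₀ : ℝ} (h0 : 0 ≤ z₀) (h1 : z₀ ≤ 1) {m : ℤ} (hm : z₀ = a + m) :
    (contMass (a + 1) b c - contMass a b c : ℂ) =
      gammaPhi a b c z₀ / ((a + b) * (a + c) * cdhNorm a b c) := by
  have hb := h.re_pos_left
  have hc := h.re_pos_right
  have hI := integral_cdhWeight_mul h.isPair hb hc h0 h1 hm
  have e : ∫ y : ℝ, (cdhWeight a b c y : ℂ) * ((y : ℂ) ^ 2 - (a * b + b * c + c * a)) =
      ((∫ y : ℝ, cdhWeight (a + 1) b c y : ℝ) : ℂ) -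
        (a + b) * (a + c) * ((∫ y : ℝ, cdhWeight a b c y : ℝ) : ℂ) := by
    rw [← integral_complex_ofReal, ← integral_complex_ofReal, ← integral_const_mul, ← integral_sub]
    · refine integral_congr_ae (Filter.Eventually.of_forall fun y => ?_)
      simp only [cdhWeight_add_one]
      push_cast
      ring
    · exact (integrable_cdhWeight (a + 1) hb hc).ofReal
    · exact (integrable_cdhWeight a hb hc).ofReal.const_mul _
  rw [e] at hI
  have hN : (cdhNorm a b c : ℂ) ≠ 0 := ofReal_ne_zero.2 h.cdhNorm_pos.ne'
  have hpi : (Real.pi : ℂ) ≠ 0 := ofReal_ne_zero.2 Real.pi_ne_zero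
  have h2 := h.add_ne_zero
  have h21 := h2.1
  have h22 := h2.2
  rw [contMass, contMass]
  push_cast
  rw [h.cdhNorm_add_one]
  rw [div_sub_div _ _ (by simp [*]) (by simp [*]), div_eq_div_iff (by simp [*]) (by simp [*])]
  linear_combination ((a + b) * (a + c) * (4 * Real.pi * cdhNorm a b c) * (cdhNorm a b c) : ℂ) * hI

open Complex in
/-- For `a ≥ 0` the factor `1 / Γ(z - a)` vanishes at the fractional part of `a`. -/
theorem gammaPhi_eq_zero {a : ℝ} (ha : 0 ≤ a) (b c : ℂ) : gammaPhi a b c ((Int.fract a : ℝ) : ℂ) = 0 := by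
  have : ((Int.fract a : ℝ) : ℂ) - a = -((⌊a⌋₊ : ℕ) : ℂ) := by
    have e : ((⌊a⌋₊ : ℕ) : ℝ) = ⌊a⌋ := natCast_floor_eq_intCast_floor ha
    rw [← ofReal_sub, Int.fract, show a - ⌊a⌋ - a = -(⌊a⌋ : ℝ) by ring, ← e]
    push_cast
    rfl
  rw [gammaPhi, this, Gamma_neg_nat_eq_zero]
  simp

theorem contMass_add_one {a : ℝ} {b c : ℂ} (h : Admissible a b c) (ha : 0 ≤ a) :
    contMass (a + 1) b c = contMass a b c := by
  have := contMass_add_one_sub h (Int.fract_nonneg a) (Int.fract_lt_one a).le (m := -⌊a⌋)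
    (by rw [Int.fract]; push_cast; ring)
  rw [gammaPhi_eq_zero ha, zero_div, sub_eq_zero] at this
  exact_mod_cast this

theorem contMass_add_nat {a : ℝ} {b c : ℂ} (h : Admissible a b c) (ha : 0 ≤ a) (n : ℕ) :
    contMass (a + n) b c = contMass a b c ∧ Admissible (a + n) b c := by
  induction n with
  | zero => simpa using h
  | succ n ih =>
    push_cast
    rw [← add_assoc]
    exact ⟨(contMass_add_one ih.2 (by positivity)).trans ih.1, ih.2.add_one⟩

open Complex in
theorem Admissible.of_nonneg {a a' : ℝ} {b c : ℂ} (h : Admissible a b c) (ha : 0 ≤ a') :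
    Admissible a' b c :=
  h.imp id fun ⟨h1, h2, h3, _, _⟩ => ⟨h1, h2, h3, by linarith, by linarith⟩

open Complex in
theorem norm_Gamma_ofReal {r : ℝ} (hr : 0 < r) : ‖Gamma (r : ℂ)‖ = Real.Gamma r := by
  rw [Gamma_ofReal, norm_real, Real.norm_of_nonneg (Real.Gamma_pos_of_pos hr).le]

open Complex Filter Topology in
/-- Monotonicity of `‖Γ(a + iy)‖ / Γ(a)`, integrated. The factor tends to `1` when `a` and `a'` are
shifted to infinity by the same integer. -/
theorem contMass_mul_le {a a' : ℝ} {b c : ℂ} (h : Admissible a b c) (ha : 0 < a) (haa : a ≤ a') :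
    contMass a b c ≤ contMass a' b c *
      ((‖Gamma (a' + b)‖ * ‖Gamma a‖ / (‖Gamma (a + b)‖ * ‖Gamma a'‖)) *
       (‖Gamma (a' + c)‖ * ‖Gamma a‖ / (‖Gamma (a + c)‖ * ‖Gamma a'‖))) := by
  have ha' : 0 < a' := ha.trans_le haa
  have h' := h.of_nonneg ha'.le
  have hb := h.re_pos_left
  have hc := h.re_pos_right
  rw [norm_Gamma_ofReal ha, norm_Gamma_ofReal ha']
  have g := Real.Gamma_pos_of_pos ha
  have g' := Real.Gamma_pos_of_pos ha'
  have key : (∫ y : ℝ, cdhWeight a b c y) * Real.Gamma a' ^ 2 ≤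
      (∫ y : ℝ, cdhWeight a' b c y) * Real.Gamma a ^ 2 := by
    rw [← integral_mul_const, ← integral_mul_const]
    refine integral_mono ((integrable_cdhWeight a hb hc).mul_const _)
      ((integrable_cdhWeight a' hb hc).mul_const _) fun y => ?_
    have hm := norm_Gamma_mul_Gamma_le ha haa y
    have hm2 := pow_le_pow_left₀ (by positivity) hm 2
    have hs := two_mul_sinh_nonneg y
    simp only [cdhWeight, norm_mul, mul_pow] at hm2 ⊢
    calc _ = (‖Gamma (a + I * y)‖ ^ 2 * Real.Gamma a' ^ 2) * (‖Gamma (b + I * y)‖ ^ 2 *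
          ‖Gamma (c + I * y)‖ ^ 2 * (2 * y * Real.sinh (Real.pi * (2 * y)) / Real.pi)) := by ring
      _ ≤ (‖Gamma (a' + I * y)‖ ^ 2 * Real.Gamma a ^ 2) * (‖Gamma (b + I * y)‖ ^ 2 *
          ‖Gamma (c + I * y)‖ ^ 2 * (2 * y * Real.sinh (Real.pi * (2 * y)) / Real.pi)) := by gcongr
      _ = _ := by ring
  have n1 := norm_pos_iff.2 h.gamma_mul.2.1
  have n2 := norm_pos_iff.2 h.gamma_mul.2.2
  have n1' := norm_pos_iff.2 h'.gamma_mul.2.1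
  have n2' := norm_pos_iff.2 h'.gamma_mul.2.2
  have n3 := h.gamma_add_pos.2
  rw [contMass, contMass, h.cdhNorm_eq, h'.cdhNorm_eq]
  rw [div_mul_div_comm, div_mul_div_comm, div_le_div_iff₀ (by positivity) (by positivity)]
  have hpos : 0 < 4 * Real.pi * ‖Gamma (a + b)‖ * ‖Gamma (a + c)‖ * ‖Gamma (b + c)‖ *
    ‖Gamma (a' + b)‖ * ‖Gamma (a' + c)‖ := by positivity
  nlinarith [mul_le_mul_of_nonneg_left key hpos.le]

open Complex Filter Topology in
theorem contMass_mono {a a' : ℝ} {b c : ℂ} (h : Admissible a b c) (ha : 0 < a) (haa : a ≤ a') :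
    contMass a b c ≤ contMass a' b c := by
  have ha' : 0 < a' := ha.trans_le haa
  have h' := h.of_nonneg ha'.le
  have hb := h.re_pos_left
  have hc := h.re_pos_right
  have hr : ∀ d : ℂ, 0 < d.re → Tendsto (fun n : ℕ =>
      ‖Gamma (((a' : ℂ) + d) + n + 1)‖ * ‖Gamma (a + n + 1)‖ /
        (‖Gamma (((a : ℂ) + d) + n + 1)‖ * ‖Gamma (a' + n + 1)‖)) atTop (𝓝 1) := fun d hd =>
    tendsto_norm_Gamma_ratio (by simp; positivity) (by simpa) (by simp; positivity) (by simpa)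
      (by simp; ring)
  have := ((hr b hb).mul (hr c hc)).const_mul (contMass a' b c)
  rw [mul_one, mul_one] at this
  refine ge_of_tendsto this (Eventually.of_forall fun n => ?_)
  have e1 := contMass_add_nat h ha.le (n + 1)
  have e2 := contMass_add_nat h' ha'.le (n + 1)
  have hle := contMass_mul_le e1.2 (by positivity) (add_le_add_left haa ((n + 1 : ℕ) : ℝ))
  rw [e1.1, e2.1] at hle
  refine hle.trans_eq ?_
  push_cast
  have e : ∀ x d : ℂ, x + (n + 1) + d = x + d + n + 1 := fun x d => by ring
  rw [e, e, e, e, ← add_assoc, ← add_assoc]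

/-- A periodic function of `a` that is monotone is constant. -/
theorem contMass_const {a a' : ℝ} {b c : ℂ} (h : Admissible a b c) (ha : 0 < a) (ha' : 0 < a') :
    contMass a b c = contMass a' b c := by
  have main : ∀ x y : ℝ, 0 < x → 0 < y → contMass x b c ≤ contMass y b c := by
    intro x y hx hy
    have hX := h.of_nonneg hx.le
    have hY := h.of_nonneg hy.le
    obtain ⟨n, hn⟩ := exists_nat_ge (x - y)
    rw [← (contMass_add_nat hY hy.le n).1]
    exact contMass_mono hX hx (by linarith)
  exact le_antisymm (main _ _ ha ha') (main _ _ ha' ha)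

theorem contMass_swap (a : ℝ) (b c : ℂ) : contMass a b c = contMass a c b := by
  unfold contMass cdhNorm cdhWeight
  congr 1
  · congr 1; ext y; congr 3; ring
  · congr 2
    rw [add_comm b c]; ring

theorem contMass_rotate (a b : ℝ) (c : ℂ) : contMass a b c = contMass b a c := by
  unfold contMass cdhNorm cdhWeight
  congr 1
  · congr 1; ext y; congr 3; ring
  · congr 2
    rw [add_comm (a : ℂ) b]; ring

open Complex in
theorem norm_Gamma_half_sq (y : ℝ) :
    ‖Gamma ((1 / 2 : ℝ) + I * y)‖ ^ 2 = Real.pi / Real.cosh (Real.pi * y) := by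
  have h := Gamma_mul_Gamma_one_sub ((1 / 2 : ℝ) + I * y)
  have e1 : (1 : ℂ) - (((1 / 2 : ℝ) : ℂ) + I * y) = ((1 / 2 : ℝ) : ℂ) - I * y := by push_cast; ring
  have e2 : (Real.pi : ℂ) * (((1 / 2 : ℝ) : ℂ) + I * y) =
      ((Real.pi * y : ℝ) : ℂ) * I + Real.pi / 2 := by push_cast; ring
  rw [e1, e2, sin_add_pi_div_two, cos_mul_I, ← ofReal_cosh] at h
  have := congrArg norm h
  rw [norm_mul, norm_Gamma_conj_line, norm_div, norm_real, norm_real,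
    Real.norm_of_nonneg Real.pi_pos.le, Real.norm_of_nonneg (Real.cosh_pos _).le] at this
  rw [sq, this]

open Complex in
/-- The reference weight, by the reflection formula. -/
theorem cdhWeight_base {y : ℝ} (hy : y ≠ 0) :
    cdhWeight 0 ((1 / 2 : ℝ) : ℂ) ((1 / 2 : ℝ) : ℂ) y =
      4 * Real.pi ^ 2 * (Real.cosh (Real.pi * y))⁻¹ := by
  have h0 := inv_norm_Gamma_I_mul_sq y
  have hs : Real.sinh (Real.pi * y) ≠ 0 := by
    rw [Ne, Real.sinh_eq_zero]; exact mul_ne_zero Real.pi_pos.ne' hy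
  have hc := (Real.cosh_pos (Real.pi * y)).ne'
  rw [inv_eq_iff_eq_inv] at h0
  rw [cdhWeight, norm_mul, norm_mul, mul_pow, mul_pow, norm_Gamma_half_sq, ofReal_zero, zero_add, h0,
    show Real.pi * (2 * y) = 2 * (Real.pi * y) by ring, Real.sinh_two_mul]
  have := Real.pi_ne_zero
  field_simp
  ring

open Filter Topology in
theorem contMass_base : contMass 0 ((1 / 2 : ℝ) : ℂ) ((1 / 2 : ℝ) : ℂ) = 1 := by
  have hhalf : (0 : ℝ) < ((1 / 2 : ℝ) : ℂ).re := by rw [Complex.ofReal_re]; norm_num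
  have hI := integrable_cdhWeight 0 hhalf hhalf
  have hae : (cdhWeight 0 ((1 / 2 : ℝ) : ℂ) ((1 / 2 : ℝ) : ℂ)) =ᵐ[volume]
      fun y => 4 * Real.pi ^ 2 * (Real.cosh (Real.pi * y))⁻¹ := by
    filter_upwards [Measure.ae_ne volume 0] with y hy using cdhWeight_base hy
  have hI2 : Integrable fun y => 4 * Real.pi ^ 2 * (Real.cosh (Real.pi * y))⁻¹ := hI.congr hae
  have hI3 : Integrable fun y => (Real.cosh (Real.pi * y))⁻¹ := by
    refine (hI2.const_mul (4 * Real.pi ^ 2)⁻¹).congr (Eventually.of_forall fun y => ?_)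
    have := Real.pi_ne_zero
    simp only
    field_simp
  have hint : ∫ y : ℝ, (Real.cosh (Real.pi * y))⁻¹ = 1 := by
    have hd : ∀ y : ℝ, HasDerivAt (fun y => 2 / Real.pi * Real.arctan (Real.exp (Real.pi * y)))
        (Real.cosh (Real.pi * y))⁻¹ y := by
      intro y
      have h1 := ((((hasDerivAt_id y).const_mul Real.pi).exp).arctan).const_mul (2 / Real.pi)
      refine h1.congr_deriv ?_
      simp only [id]
      rw [Real.cosh_eq, Real.exp_neg]
      have := Real.exp_pos (Real.pi * y)
      have := Real.pi_ne_zero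
      field_simp
      ring
    have hpt : Tendsto (fun y : ℝ => Real.pi * y) atTop atTop :=
      tendsto_id.const_mul_atTop Real.pi_pos
    have hpb : Tendsto (fun y : ℝ => Real.pi * y) atBot atBot :=
      tendsto_id.const_mul_atBot Real.pi_pos
    have ht : Tendsto (fun y => 2 / Real.pi * Real.arctan (Real.exp (Real.pi * y))) atTop
        (𝓝 (2 / Real.pi * (Real.pi / 2))) :=
      ((tendsto_nhds_of_tendsto_nhdsWithin Real.tendsto_arctan_atTop).comp
        (Real.tendsto_exp_atTop.comp hpt)).const_mul _
    have hb : Tendsto (fun y => 2 / Real.pi * Real.arctan (Real.exp (Real.pi * y))) atBot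
        (𝓝 (2 / Real.pi * Real.arctan 0)) :=
      ((Real.continuous_arctan.tendsto 0).comp (Real.tendsto_exp_atBot.comp hpb)).const_mul _
    rw [integral_of_hasDerivAt_of_tendsto hd hI3 hb ht]
    have := Real.pi_ne_zero
    simp
  rw [contMass, integral_congr_ae hae, integral_const_mul, hint, cdhNorm]
  have e : ((0 : ℝ) : ℂ) + ((1 / 2 : ℝ) : ℂ) = ((1 / 2 : ℝ) : ℂ) := by simp
  have e2 : ((1 / 2 : ℝ) : ℂ) + ((1 / 2 : ℝ) : ℂ) = 1 := by push_cast; norm_num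
  rw [e, e2, Complex.Gamma_one, Complex.Gamma_ofReal, Real.Gamma_one_half_eq,
    ← Complex.ofReal_mul, mul_one, mul_one, Complex.ofReal_re, Real.mul_self_sqrt Real.pi_pos.le]
  have := Real.pi_ne_zero
  field_simp

theorem admissible_ofReal {a b c : ℝ} (ha : 0 ≤ a) (hb : 0 < b) (hc : 0 < c) :
    Admissible a (b : ℂ) (c : ℂ) :=
  Or.inr ⟨⟨Complex.ofReal_im _, Complex.ofReal_im _⟩, by simpa, by simpa,
    by simp; linarith, by simp; linarith⟩

theorem contMass_ofReal {a b c : ℝ} (ha : 0 ≤ a) (hb : 0 < b) (hc : 0 < c) :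
    contMass a (b : ℂ) (c : ℂ) = 1 := by
  have hh : (0 : ℝ) < 1 / 2 := by norm_num
  -- each parameter can be moved to its reference value, as the mass is symmetric in them
  have step : ∀ x y z : ℝ, 0 < x → 0 < y → 0 < z →
      contMass x (y : ℂ) (z : ℂ) = contMass 1 ((1 / 2 : ℝ) : ℂ) ((1 / 2 : ℝ) : ℂ) := by
    intro x y z hx hy hz
    rw [contMass_const (a' := 1) (admissible_ofReal hx.le hy hz) hx one_pos, contMass_rotate,
      contMass_const (a' := 1 / 2) (admissible_ofReal hy.le one_pos hz) hy hh,
      contMass_rotate, contMass_swap, contMass_rotate,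
      contMass_const (a' := 1 / 2) (admissible_ofReal hz.le one_pos hh) hz hh, contMass_rotate]
  have base : contMass 1 ((1 / 2 : ℝ) : ℂ) ((1 / 2 : ℝ) : ℂ) = 1 := by
    have := contMass_add_one (admissible_ofReal le_rfl hh hh) le_rfl
    rw [zero_add] at this
    rw [this, contMass_base]
  rw [← contMass_add_one (admissible_ofReal ha hb hc) ha, step _ _ _ (by linarith) hb hc, base]

open Complex Filter Topology in
theorem norm_Gamma_le {σ : ℝ} (hσ : 0 < σ) (y : ℝ) : ‖Gamma (σ + I * y)‖ ≤ Real.Gamma σ := by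
  have h := tendsto_norm_Gamma_ratio (z₁ := σ + I * y) (z₂ := 1) (z₃ := σ) (z₄ := 1)
    (by simpa) (by simp) (by simpa) (by simp) (by simp)
  have h2 := h.const_mul (Real.Gamma σ)
  rw [mul_one] at h2
  refine ge_of_tendsto h2 (Eventually.of_forall fun n => ?_)
  have hn : σ ≤ σ + n + 1 := by linarith [(Nat.cast_nonneg n : (0 : ℝ) ≤ n)]
  have hn' : 0 < σ + n + 1 := hσ.trans_le hn
  have h1 : 0 < ‖Gamma ((1 : ℂ) + n + 1)‖ := norm_pos_iff.2 (Gamma_ne_zero_of_re_pos (by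
    simp; positivity))
  have := norm_Gamma_mul_Gamma_le hσ hn y
  rw [mul_div_mul_right _ _ h1.ne', mul_div_assoc', le_div_iff₀ (norm_pos_iff.2
    (Gamma_ne_zero_of_re_pos (by simpa using hn')))]
  have e1 : (σ : ℂ) + n + 1 = ((σ + n + 1 : ℝ) : ℂ) := by push_cast; ring
  have e2 : (σ : ℂ) + I * y + n + 1 = ((σ + n + 1 : ℝ) : ℂ) + I * y := by push_cast; ring
  rw [e1, e2, norm_Gamma_ofReal hn']
  linarith

open Complex Filter Topology in
/-- The total mass is `1` for `a > 0` and conjugate `b, c`. As `a → ∞` through `a + ℕ` the measure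
escapes to infinity, where the weights of `b, c` and of `β = Re b` taken twice are asymptotic. -/
theorem contMass_conj {a β γ : ℝ} (ha : 0 < a) (hβ : 0 < β) (hγ : γ ≠ 0) :
    contMass a (β + I * γ) (β - I * γ) = 1 := by
  have hA : ∀ a, Admissible a (β + I * γ) (β - I * γ) := fun a =>
    Or.inl ⟨by simp [sub_eq_add_neg], by simpa, by simpa⟩
  have hR : ∀ n : ℕ, Admissible (a + n + 1) (β : ℂ) (β : ℂ) := fun n =>
    admissible_ofReal (by positivity) hβ hβ
  set b : ℂ := β + I * γ with hbdef
  set c : ℂ := β - I * γ with hcdef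
  have hbre : 0 < b.re := by simpa [b]
  have hcre : 0 < c.re := by simpa [c]
  have hβre : 0 < (β : ℂ).re := by simpa
  have hne : ∀ w : ℝ, ‖Gamma (β + I * w)‖ ≠ 0 := fun w =>
    norm_ne_zero_iff.2 (Gamma_ne_zero_of_re_pos (by simpa))
  set q : ℝ → ℝ := fun y => ‖Gamma (β + I * (y + γ : ℝ)) * Gamma (β + I * (y - γ : ℝ))‖ ^ 2 /
      ‖Gamma (β + I * y)‖ ^ 4 with hq
  have hWq : ∀ n : ℕ, ∀ y, cdhWeight (a + n + 1) b c y = q y * cdhWeight (a + n + 1) β β y := by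
    intro n y
    have := hne y
    simp only [cdhWeight, hq, hbdef, hcdef, norm_mul, mul_pow]
    rw [show (β : ℂ) + I * γ + I * y = β + I * (y + γ : ℝ) by push_cast; ring,
      show (β : ℂ) - I * γ + I * y = β + I * (y - γ : ℝ) by push_cast; ring]
    field_simp
  have hqlim : Tendsto q atTop (𝓝 1) := tendsto_norm_Gamma_second_difference hβ γ
  have hqeven : ∀ y, q (-y) = q y := by
    intro y
    have e : ∀ w : ℝ, ‖Gamma (β + I * (-w : ℝ))‖ = ‖Gamma (β + I * w)‖ := fun w => by
      rw [← norm_Gamma_conj_line β w]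
      push_cast
      rw [mul_neg, sub_eq_add_neg]
    simp only [hq, norm_mul]
    rw [show -y + γ = -(y - γ) by ring, show -y - γ = -(y + γ) by ring, e, e, e, mul_comm]
  have hqabs : ∀ y, q |y| = q y := fun y => by
    rcases abs_cases y with h | h
    · rw [h.1]
    · rw [h.1, hqeven]
  have hqcont : Continuous q := by
    have hG : Continuous fun y : ℝ => Gamma (β + I * y) := by
      refine continuous_iff_continuousAt.2 fun y => ?_
      refine ContinuousAt.comp (f := fun y : ℝ => (β : ℂ) + I * (y : ℂ)) ?_ (by fun_prop)
      refine (differentiableAt_Gamma _ fun m h => ?_).continuousAt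
      have := congrArg re h
      simp at this
      linarith [(Nat.cast_nonneg m : (0 : ℝ) ≤ m)]
    have h1 : Continuous fun y : ℝ => Gamma (β + I * (y + γ : ℝ)) :=
      hG.comp (continuous_id.add continuous_const)
    have h2 : Continuous fun y : ℝ => Gamma (β + I * (y - γ : ℝ)) :=
      hG.comp (continuous_id.sub continuous_const)
    exact ((h1.mul h2).norm.pow 2).div (hG.norm.pow 4) fun y => pow_ne_zero _ (hne y)
  -- the masses of the reference measures
  set J : ℕ → ℝ := fun n => ∫ y : ℝ, cdhWeight (a + n + 1) β β y with hJ
  have hJval : ∀ n, J n = 4 * Real.pi * cdhNorm (a + n + 1) β β := fun n => by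
    have := contMass_ofReal (a := a + n + 1) (by positivity) hβ hβ
    rw [contMass, div_eq_one_iff_eq (by have := (hR n).cdhNorm_pos; positivity)] at this
    exact this
  have hJpos : ∀ n, 0 < J n := fun n => by
    rw [hJval]; have := (hR n).cdhNorm_pos; positivity
  have hesc : ∀ Y : ℝ, 0 ≤ Y → Tendsto (fun n : ℕ =>
      (∫ y in Set.Icc (-Y) Y, cdhWeight (a + n + 1) β β y) / J n) atTop (𝓝 0) := by
    intro Y hY
    set w : ℝ → ℝ := fun y => ‖Gamma (β + I * y) * Gamma (β + I * y)‖ ^ 2 *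
      (2 * y * Real.sinh (Real.pi * (2 * y)) / Real.pi) with hw
    have hw0 : ∀ y, 0 ≤ w y := fun y => mul_nonneg (by positivity) (two_mul_sinh_nonneg y)
    have hwcont : Continuous w := by
      have hG : Continuous fun y : ℝ => Gamma (β + I * y) := by
        refine continuous_iff_continuousAt.2 fun y => ?_
        refine ContinuousAt.comp (f := fun y : ℝ => (β : ℂ) + I * (y : ℂ)) ?_ (by fun_prop)
        refine (differentiableAt_Gamma _ fun m h => ?_).continuousAt
        have := congrArg re h
        simp at this
        linarith [(Nat.cast_nonneg m : (0 : ℝ) ≤ m)]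
      exact ((hG.mul hG).norm.pow 2).mul ((continuous_const.mul continuous_id).mul
        (Real.continuous_sinh.comp (by fun_prop)) |>.div_const _)
    have hwi : IntegrableOn w (Set.Icc (-Y) Y) := hwcont.continuousOn.integrableOn_Icc
    set K : ℝ := ∫ y in Set.Icc (-Y) Y, w y
    have hratio := (tendsto_norm_Gamma_ratio_zero (z₁ := a) (z₂ := (a : ℂ) + β) (by simpa)
      (by simpa)).pow 2
    have hlim := hratio.mul_const (K / (4 * Real.pi * ‖Gamma ((β : ℂ) + β)‖))
    rw [zero_pow two_ne_zero, zero_mul] at hlim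
    refine squeeze_zero (fun n => div_nonneg (integral_nonneg fun y => cdhWeight_nonneg _ _ _ _)
      (hJpos n).le) (fun n => ?_) hlim
    have hle : ∫ y in Set.Icc (-Y) Y, cdhWeight (a + n + 1) β β y ≤
        ‖Gamma ((a : ℂ) + n + 1)‖ ^ 2 * K := by
      rw [← integral_const_mul]
      refine integral_mono (integrable_cdhWeight _ hβre hβre).integrableOn (hwi.const_mul _)
        fun y => ?_
      have hpos : 0 < a + n + 1 := by positivity
      have h1 := norm_Gamma_le hpos y
      have e1 : (a : ℂ) + n + 1 = ((a + n + 1 : ℝ) : ℂ) := by push_cast; ring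
      rw [e1, norm_Gamma_ofReal hpos]
      have h2 : cdhWeight (a + n + 1) β β y = ‖Gamma (((a + n + 1 : ℝ) : ℂ) + I * y)‖ ^ 2 * w y := by
        simp only [cdhWeight, hw, norm_mul, mul_pow]
        ring
      rw [h2]
      have := hw0 y
      simp only
      gcongr
    have hn1 := norm_pos_iff.2 (hR n).gamma_mul.2.1
    have hn2 := (hR n).gamma_add_pos.2
    rw [hJval, (hR n).cdhNorm_eq]
    have e2 : ((a + n + 1 : ℝ) : ℂ) + β = (a : ℂ) + β + n + 1 := by push_cast; ring
    rw [e2] at hn1 ⊢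
    rw [div_le_iff₀ (by positivity)]
    refine hle.trans_eq ?_
    set x := ‖Gamma ((β : ℂ) + β)‖
    field_simp
  -- comparison with the reference weight
  have hcmp : Tendsto (fun n : ℕ => (∫ y : ℝ, cdhWeight (a + n + 1) b c y) / J n) atTop (𝓝 1) := by
    rw [Metric.tendsto_atTop]
    intro e he
    obtain ⟨Y, hY⟩ := eventually_atTop.1 (Metric.tendsto_nhds.1 hqlim (e / 2) (by positivity))
    set Z := max Y 0
    obtain ⟨C, hC⟩ := (isCompact_Icc (a := -Z) (b := Z)).bddAbove_image
      ((hqcont.sub continuous_const).norm (E := ℝ)).continuousOn (f := fun y => ‖q y - 1‖)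
    have hCbd : ∀ y, ‖q y - 1‖ ≤ e / 2 + (Set.Icc (-Z) Z).indicator (fun _ => |C|) y := by
      intro y
      by_cases hy : y ∈ Set.Icc (-Z) Z
      · rw [Set.indicator_of_mem hy]
        have := (hC ⟨y, hy, rfl⟩).trans (le_abs_self C)
        linarith
      · rw [Set.indicator_of_notMem hy, add_zero, ← hqabs]
        have : Z ≤ |y| := by
          by_contra! hlt
          exact hy (abs_le.1 hlt.le)
        exact (hY |y| ((le_max_left _ _).trans this)).le
    obtain ⟨n₀, hn₀⟩ := eventually_atTop.1 ((((hesc Z (le_max_right _ _)).const_mul |C|).eventually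
      (gt_mem_nhds (by rw [mul_zero]; positivity : |C| * 0 < e / 2))))
    refine ⟨n₀, fun n hn => ?_⟩
    have i1 := integrable_cdhWeight (a + n + 1) hbre hcre
    have i2 := integrable_cdhWeight (a + n + 1) hβre hβre
    have hJn := hJpos n
    rw [Real.dist_eq, div_sub_one hJn.ne', abs_div, abs_of_pos hJn, div_lt_iff₀ hJn]
    simp only [hJ]
    rw [← integral_sub i1 i2]
    have i3 : Integrable ((Set.Icc (-Z) Z).indicator (cdhWeight (a + n + 1) β β)) :=
      i2.indicator measurableSet_Icc
    calc |∫ y, (cdhWeight (a + n + 1) b c y - cdhWeight (a + n + 1) β β y)|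
        ≤ ∫ y, (e / 2 * cdhWeight (a + n + 1) β β y +
            |C| * (Set.Icc (-Z) Z).indicator (cdhWeight (a + n + 1) β β) y) := by
          refine norm_integral_le_of_norm_le (f := fun y => cdhWeight (a + n + 1) b c y -
            cdhWeight (a + n + 1) β β y) (g := fun y => e / 2 * cdhWeight (a + n + 1) β β y +
            |C| * (Set.Icc (-Z) Z).indicator (cdhWeight (a + n + 1) β β) y)
            ((i2.const_mul _).add (i3.const_mul _)) (Eventually.of_forall fun y => ?_)
          rw [hWq, show q y * cdhWeight (a + n + 1) β β y - cdhWeight (a + n + 1) β β y =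
            (q y - 1) * cdhWeight (a + n + 1) β β y by ring, norm_mul,
            Real.norm_of_nonneg (cdhWeight_nonneg _ _ _ _)]
          refine (mul_le_mul_of_nonneg_right (hCbd y) (cdhWeight_nonneg _ _ _ _)).trans_eq ?_
          by_cases hy : y ∈ Set.Icc (-Z) Z
          · rw [Set.indicator_of_mem hy, Set.indicator_of_mem hy]; ring
          · rw [Set.indicator_of_notMem hy, Set.indicator_of_notMem hy]; ring
      _ = e / 2 * J n + |C| * ∫ y in Set.Icc (-Z) Z, cdhWeight (a + n + 1) β β y := by
          rw [integral_add (i2.const_mul _) (i3.const_mul _), integral_const_mul,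
            integral_const_mul, integral_indicator measurableSet_Icc]
      _ < e * J n := by
          have := hn₀ n hn
          rw [mul_div_assoc', div_lt_iff₀ hJn] at this
          linarith
  have hnorm := tendsto_norm_Gamma_ratio (z₁ := (a : ℂ) + β) (z₂ := (a : ℂ) + β)
    (z₃ := (a : ℂ) + b) (z₄ := (a : ℂ) + c) (by simp; positivity) (by simp; positivity)
    (by simp [b]; positivity) (by simp [c]; positivity) (by simp [b, c])
  have hfin := hcmp.mul hnorm
  rw [one_mul] at hfin
  refine tendsto_nhds_unique (tendsto_const_nhds.congr fun n => ?_) hfin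
  have hm := contMass_add_nat (hA a) ha.le (n + 1)
  rw [← hm.1]
  push_cast
  rw [← add_assoc, contMass, (hA _).cdhNorm_eq, hJval, (hR n).cdhNorm_eq]
  have e1 : ∀ d : ℂ, ((a + n + 1 : ℝ) : ℂ) + d = (a : ℂ) + d + n + 1 := fun d => by
    push_cast; ring
  have hbc : b + c = (β : ℂ) + β := by simp only [b, c]; ring
  rw [e1, e1, e1, hbc]
  have p1 := norm_pos_iff.2 (hR n).gamma_mul.2.1
  have p2 := (hR n).gamma_add_pos.2
  have p3 := norm_pos_iff.2 (hA (a + n + 1)).gamma_mul.2.1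
  have p4 := norm_pos_iff.2 (hA (a + n + 1)).gamma_mul.2.2
  rw [e1] at p1 p3 p4
  field_simp

/-- The absolutely continuous part carries the full mass when `a ≥ 0`. -/
theorem contMass_eq_one {a : ℝ} {b c : ℂ} (h : Admissible a b c) (ha : 0 ≤ a) :
    contMass a b c = 1 := by
  rcases h with ⟨h1, h2, h3⟩ | ⟨⟨h1, h2⟩, h3, h4, _, _⟩
  · have h : Admissible a b c := Or.inl ⟨h1, h2, h3⟩
    rw [← contMass_add_one h ha]
    have := contMass_conj (a := a + 1) (by linarith) h3 h2
    have eb : b = (b.re : ℂ) + Complex.I * (b.im : ℝ) := by rw [mul_comm, Complex.re_add_im]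
    have ec : c = (b.re : ℂ) - Complex.I * (b.im : ℝ) := by
      rw [h1]; apply Complex.ext <;> simp
    rwa [← eb, ← ec] at this
  · have eb : b = (b.re : ℂ) := by apply Complex.ext <;> simp [h1]
    have ec : c = (c.re : ℂ) := by apply Complex.ext <;> simp [h2]
    rw [eb, ec]
    exact contMass_ofReal ha h3 h4

/-! ### Sums over the atoms -/

/-- Up to the factor `-2 (a + j)`, the mass of the `j`-th atom, in a form free of the cancelling
poles of `Γ`. -/
noncomputable def atomFactor (a : ℝ) (b c : ℂ) (j : ℕ) : ℂ :=
  poch (a + b) j * poch (a + c) j * Complex.Gamma (b - a - j) * Complex.Gamma (c - a - j) /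
    (j.factorial * Complex.Gamma (b + c) * Complex.Gamma (1 - 2 * a - j))

theorem poch_zero (z : ℂ) : poch z 0 = 1 := by simp [poch_eq_prod]

theorem poch_succ (z : ℂ) (n : ℕ) : poch z (n + 1) = poch z n * (z + n) := by
  rw [poch_eq_prod, poch_eq_prod, Finset.prod_range_succ]

theorem poch_succ_left (z : ℂ) (n : ℕ) : poch z (n + 1) = z * poch (z + 1) n := by
  rw [poch_eq_prod, poch_eq_prod, Finset.prod_range_succ', mul_comm]
  simp only [Nat.cast_zero, add_zero]
  congr 1
  refine Finset.prod_congr rfl fun j _ => ?_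
  push_cast
  ring

theorem poch_one (n : ℕ) : poch 1 n = n.factorial := by
  induction n with
  | zero => simp [poch_zero]
  | succ n ih => rw [poch_succ, ih, Nat.factorial_succ]; push_cast; ring

/-- Reflection of the Pochhammer symbol. -/
theorem poch_sub_nat (z : ℂ) (n : ℕ) : poch (z - n) n = (-1) ^ n * poch (1 - z) n := by
  rw [poch_eq_prod, poch_eq_prod, ← Finset.prod_range_reflect, ← Finset.card_range n,
    ← Finset.prod_const, Finset.card_range, ← Finset.prod_mul_distrib]
  refine Finset.prod_congr rfl fun j hj => ?_
  have hj' : j + 1 ≤ n := Finset.mem_range.1 hj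
  have : ((n - 1 - j : ℕ) : ℂ) = n - 1 - j := by
    rw [Nat.sub_sub, Nat.cast_sub (by omega)]; push_cast; ring
  rw [this]
  ring

open Complex in
theorem Gamma_eq_poch_mul {z : ℂ} {n : ℕ} (hz : 0 < (z - n).re) :
    Gamma z = (-1) ^ n * poch (1 - z) n * Gamma (z - n) := by
  have h := Gamma_add_nat_div_Gamma_eq (n := n) (z - n) fun k hk => by
    rw [hk] at hz
    simp at hz
    linarith [(Nat.cast_nonneg k : (0 : ℝ) ≤ k)]
  rw [← poch, poch_sub_nat, sub_add_cancel, div_eq_iff (Gamma_ne_zero_of_re_pos hz)] at h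
  exact h

open Complex in
theorem Gamma_add_nat_eq_poch_mul {z : ℂ} (hz : Gamma z ≠ 0) (n : ℕ) :
    Gamma (z + n) = poch z n * Gamma z := by
  have h := Gamma_add_nat_div_Gamma_eq (n := n) z fun k hk => hz (by rw [hk, Gamma_neg_nat_eq_zero])
  rw [← poch, div_eq_iff hz] at h
  exact h

/-- The range of indices in which `atomFactor` has no vanishing or singular factor. -/
def AtomIndex (a : ℝ) (b c : ℂ) (j : ℕ) : Prop :=
  0 < (b - a - j).re ∧ 0 < (c - a - j).re ∧ (j : ℝ) < -a

theorem AtomIndex.mono {a : ℝ} {b c : ℂ} {i j : ℕ} (h : AtomIndex a b c j) (hij : i ≤ j) :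
    AtomIndex a b c i := by
  obtain ⟨h1, h2, h3⟩ := h
  have : (i : ℝ) ≤ j := by exact_mod_cast hij
  simp only [Complex.sub_re, Complex.ofReal_re, Complex.natCast_re] at h1 h2
  refine ⟨?_, ?_, by linarith⟩ <;>
    simp only [Complex.sub_re, Complex.ofReal_re, Complex.natCast_re] <;> linarith

open Complex in
/-- The poles and zeros in the definition of `cdhMass` cancel by the reflection of `Γ(b - a)`, `Γ(c - a)`
and `Γ(1 - 2a)`. -/
theorem cdhMass_eq {a : ℝ} {b c : ℂ} {j : ℕ} (h : AtomIndex a b c j) :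
    cdhMass a b c j = (-2 * (a + j) * atomFactor a b c j).re := by
  obtain ⟨h1, h2, h3⟩ := h
  have ha : a < 0 := by linarith [(Nat.cast_nonneg j : (0 : ℝ) ≤ j)]
  have haC : (a : ℂ) ≠ 0 := by exact_mod_cast ha.ne
  have g1 := Gamma_eq_poch_mul h1
  have g2 := Gamma_eq_poch_mul h2
  have g3 := Gamma_eq_poch_mul (z := 1 - 2 * a) (n := j) (by simp; linarith)
  have g4 : Gamma (1 - 2 * a) = -2 * a * Gamma (-2 * a) := by
    rw [← Gamma_add_one _ (by simpa using haC)]; congr 1; ring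
  have n1 : Gamma (b - a) ≠ 0 := Gamma_ne_zero_of_re_pos (by
    simp at h1 ⊢; linarith [(Nat.cast_nonneg j : (0 : ℝ) ≤ j)])
  have n2 : Gamma (c - a) ≠ 0 := Gamma_ne_zero_of_re_pos (by
    simp at h2 ⊢; linarith [(Nat.cast_nonneg j : (0 : ℝ) ≤ j)])
  have n3 : Gamma (1 - 2 * a) ≠ 0 := Gamma_ne_zero_of_re_pos (by simp; linarith)
  have n4 : Gamma (-2 * a) ≠ 0 := Gamma_ne_zero_of_re_pos (by simp; linarith)
  have n5 : Gamma (1 - 2 * a - j) ≠ 0 := Gamma_ne_zero_of_re_pos (by simp; linarith)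
  rw [show (1 : ℂ) - (b - a) = a - b + 1 by ring] at g1
  rw [show (1 : ℂ) - (c - a) = a - c + 1 by ring] at g2
  rw [show (1 : ℂ) - (1 - 2 * a) = 2 * a by ring] at g3
  have p1 : poch (a - b + 1) j ≠ 0 := fun h0 => n1 (by rw [g1, h0]; simp)
  have p2 : poch (a - c + 1) j ≠ 0 := fun h0 => n2 (by rw [g2, h0]; simp)
  have p3 : poch (2 * a) j ≠ 0 := fun h0 => n3 (by rw [g3, h0]; simp)
  have hf : (j.factorial : ℂ) ≠ 0 := by exact_mod_cast j.factorial_ne_zero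
  have g5 : (-1) ^ j * poch (2 * a) j * Gamma (1 - 2 * a - j) = -2 * a * Gamma (-2 * a) := by
    rw [← g3, g4]
  rw [cdhMass, poch_one, g1, g2, atomFactor]
  congr 1
  by_cases hbc : Gamma (b + c) = 0
  · simp [hbc]
  have hs : ((-1 : ℂ) ^ j) * (-1) ^ j = 1 := by rw [← mul_pow]; simp
  have e1 : ∀ x y z w P Q R S G1 G2 : ℂ, P ≠ 0 → Q ≠ 0 →
      x * y * z * w * ((-1) ^ j * P * G1) * ((-1) ^ j * Q * G2) / (R * P * Q * a * S * Gamma (b + c)) *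
        (-1) ^ j = ((-1) ^ j * x) * y * z * w * G1 * G2 / (R * a * S * Gamma (b + c)) := by
    intro x y z w P Q R S G1 G2 hP hQ
    have : x * y * z * w * ((-1) ^ j * P * G1) * ((-1) ^ j * Q * G2) =
        (x * y * z * w * G1 * G2) * (P * Q) := by linear_combination (x * y * z * w * P * G1 * Q * G2) * hs
    rw [this, show R * P * Q * a * S * Gamma (b + c) = (R * a * S * Gamma (b + c)) * (P * Q) by ring,
      mul_div_mul_right _ _ (mul_ne_zero hP hQ)]
    ring
  rw [e1 _ _ _ _ _ _ _ _ _ _ p1 p2, mul_div_assoc', div_eq_div_iff (by simp [-neg_mul, *]) (by simp [-neg_mul, *])]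
  linear_combination (poch (a + b) j * poch (a + c) j * (a + j) * Gamma (b - a - j) *
    Gamma (c - a - j) * j.factorial * Gamma (b + c)) * g5

open Complex in
/-- Multiplication by `a² + x/4` removes the first atom and shifts `a` to `a + 1`. -/
theorem atomFactor_shift {a : ℝ} {b c : ℂ} {j : ℕ} (h : AtomIndex a b c (j + 1)) :
    ((a : ℂ) ^ 2 - (a + (j + 1 : ℕ)) ^ 2) * atomFactor a b c (j + 1) =
      (a + b) * (a + c) * atomFactor (a + 1) b c j := by
  have h3 := h.2.2
  push_cast at h3
  have hne : (-2 * a - (j + 1) : ℂ) ≠ 0 := by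
    have : (-2 * a - (j + 1) : ℝ) ≠ 0 := by
      have := (Nat.cast_nonneg j : (0 : ℝ) ≤ j); linarith
    exact_mod_cast this
  have g := Gamma_add_one _ hne
  have n5 : Gamma (-2 * a - (j + 1)) ≠ 0 := Gamma_ne_zero_of_re_pos (by
    simp
    have := (Nat.cast_nonneg j : (0 : ℝ) ≤ j); linarith)
  rw [atomFactor, atomFactor, poch_succ_left, poch_succ_left, Nat.factorial_succ]
  push_cast
  rw [show (1 : ℂ) - 2 * a - (j + 1) = -2 * a - (j + 1) + 1 by ring, g,
    show (1 : ℂ) - 2 * (a + 1) - j = -2 * a - (j + 1) by ring,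
    show (a : ℂ) + 1 + b = a + b + 1 by ring, show (a : ℂ) + 1 + c = a + c + 1 by ring,
    show b - (a + 1) - j = b - a - (j + 1) by ring, show c - (a + 1) - j = c - a - (j + 1) by ring]
  by_cases hbc : Gamma (b + c) = 0
  · simp [hbc]
  have hj : (j + 1 : ℂ) ≠ 0 := by exact_mod_cast j.succ_ne_zero
  have hf : (j.factorial : ℂ) ≠ 0 := by exact_mod_cast j.factorial_ne_zero
  rw [mul_div_assoc', mul_div_assoc', div_eq_div_iff (by simp [-neg_mul, *]) (by simp [-neg_mul, *])]
  ring

open Complex in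
theorem atomFactor_succ {a : ℝ} {b c : ℂ} {j : ℕ} (h : AtomIndex a b c (j + 1)) :
    atomFactor a b c (j + 1) * ((j + 1 : ℕ) * (b - a - (j + 1 : ℕ)) * (c - a - (j + 1 : ℕ))) =
      atomFactor a b c j * ((a + b + j) * (a + c + j) * (-2 * a - j)) := by
  obtain ⟨h1, h2, h3⟩ := h
  push_cast at h1 h2 h3
  have ne : ∀ z : ℂ, 0 < z.re → z ≠ 0 := fun z hz h0 => by simp [h0] at hz
  have hne : (-2 * a - j : ℂ) ≠ 0 := by
    have : (-2 * a - j : ℝ) ≠ 0 := by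
      have := (Nat.cast_nonneg j : (0 : ℝ) ≤ j); linarith
    exact_mod_cast this
  have g := Gamma_add_one _ hne
  have g1 := Gamma_add_one _ (ne _ h1)
  have g2 := Gamma_add_one _ (ne _ h2)
  have n5 : Gamma (-2 * a - j) ≠ 0 := Gamma_ne_zero_of_re_pos (by
    simp
    have := (Nat.cast_nonneg j : (0 : ℝ) ≤ j); linarith)
  rw [atomFactor, atomFactor, poch_succ, poch_succ, Nat.factorial_succ]
  push_cast
  rw [show (1 : ℂ) - 2 * a - j = -2 * a - j + 1 by ring, g,
    show (1 : ℂ) - 2 * a - (j + 1) = -2 * a - j by ring,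
    show b - a - j = b - a - (j + 1) + 1 by ring, g1,
    show c - a - j = c - a - (j + 1) + 1 by ring, g2]
  by_cases hbc : Gamma (b + c) = 0
  · simp [hbc]
  have hj : (j + 1 : ℂ) ≠ 0 := by exact_mod_cast j.succ_ne_zero
  have hf : (j.factorial : ℂ) ≠ 0 := by exact_mod_cast j.factorial_ne_zero
  rw [div_mul_eq_mul_div, div_mul_eq_mul_div, div_eq_div_iff (by simp [-neg_mul, *]) (by simp [-neg_mul, *])]
  ring

/-- The first-moment identity for the atoms, a telescoping sum by `atomFactor_succ`. -/
theorem sum_atomFactor {a : ℝ} {b c : ℂ} (n : ℕ) (h : AtomIndex a b c n) :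
    ∑ j ∈ Finset.range (n + 1), -2 * ((a : ℂ) + j) * atomFactor a b c j *
      (((a : ℂ) ^ 2 - (a + j) ^ 2) - (a + b) * (a + c)) =
      -(atomFactor a b c n * ((a + b + n) * (a + c + n) * (-2 * a - n))) := by
  induction n with
  | zero => simp; ring
  | succ n ih =>
    rw [Finset.sum_range_succ, ih (h.mono n.le_succ), ← atomFactor_succ h]
    push_cast
    ring

/-- The complex value of the sum of the masses of the first `n` atoms, weighted by `g`. -/
noncomputable def atomSum (a : ℝ) (b c : ℂ) (n : ℕ) (g : ℝ → ℝ) : ℂ :=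
  ∑ j ∈ Finset.range n, -2 * ((a : ℂ) + j) * atomFactor a b c j * (g (-4 * (a + j) ^ 2) : ℂ)

theorem atomSum_mul_add_one {a : ℝ} {b c : ℂ} (n : ℕ) (h : AtomIndex a b c n) (g : ℝ → ℝ) :
    atomSum a b c (n + 1) (fun x => (a ^ 2 + x / 4) * g x) =
      (a + b) * (a + c) * atomSum (a + 1) b c n g := by
  rw [atomSum, atomSum, Finset.sum_range_succ', Finset.mul_sum]
  have e0 : -2 * ((a : ℂ) + (0 : ℕ)) * atomFactor a b c 0 *
      (((a ^ 2 + -4 * (a + (0 : ℕ)) ^ 2 / 4) * g (-4 * (a + (0 : ℕ)) ^ 2) : ℝ) : ℂ) = 0 := by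
    push_cast; ring
  rw [e0, add_zero]
  refine Finset.sum_congr rfl fun j hj => ?_
  have hs := atomFactor_shift (h.mono (Finset.mem_range.1 hj))
  have e : -4 * (a + (j + 1 : ℕ)) ^ 2 = -4 * (a + 1 + j) ^ 2 := by push_cast; ring
  simp only [e]
  push_cast at hs ⊢
  linear_combination (-2 * ((a : ℂ) + (j + 1)) * (g (-4 * (a + 1 + j) ^ 2) : ℂ)) * hs

theorem atomSum_one_sub {a : ℝ} {b c : ℂ} (n : ℕ) (h : AtomIndex a b c n) :
    (a + b) * (a + c) * (atomSum (a + 1) b c n (fun _ => 1) - atomSum a b c (n + 1) fun _ => 1) =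
      -(atomFactor a b c n * ((a + b + n) * (a + c + n) * (-2 * a - n))) := by
  rw [mul_sub, ← atomSum_mul_add_one n h, ← sum_atomFactor n h, atomSum, atomSum, Finset.mul_sum,
    ← Finset.sum_sub_distrib]
  refine Finset.sum_congr rfl fun j _ => ?_
  push_cast
  ring

theorem Admissible.atomIndex {a : ℝ} {b c : ℂ} (h : Admissible a b c) {j : ℕ} (hj : j < ⌈-a⌉₊) :
    AtomIndex a b c j := by
  have hj' : (j : ℝ) < -a := Nat.lt_ceil.1 hj
  have := h.re_pos_left
  have := h.re_pos_right
  refine ⟨?_, ?_, hj'⟩ <;>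
    simp only [Complex.sub_re, Complex.ofReal_re, Complex.natCast_re] <;> linarith

theorem ceil_neg_succ {a : ℝ} (ha : a < 0) : ⌈-a⌉₊ = ⌈-(a + 1)⌉₊ + 1 := by
  have h := Nat.ceil_pos.2 (neg_pos.2 ha)
  obtain ⟨n, hn⟩ := Nat.exists_eq_succ_of_ne_zero h.ne'
  have : ⌈-(a + 1)⌉₊ = ⌈-a⌉₊ - 1 := by
    rw [← Nat.ceil_sub_one]
    congr 1
    ring
  omega

open Complex in
/-- The boundary term of the telescoping sum is the residue from the absolutely continuous part. -/
theorem atomFactor_boundary {a : ℝ} {b c : ℂ} (h : Admissible a b c) {n : ℕ}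
    (hn : n < ⌈-a⌉₊) :
    atomFactor a b c n * ((a + b + n) * (a + c + n) * (-2 * a - n)) =
      gammaPhi a b c ((a + n + 1 : ℝ) : ℂ) / cdhNorm a b c := by
  have h3 := (h.atomIndex hn).2.2
  have hne : (-2 * a - n : ℂ) ≠ 0 := by
    have : (-2 * a - n : ℝ) ≠ 0 := by
      have := (Nat.cast_nonneg n : (0 : ℝ) ≤ n); linarith
    exact_mod_cast this
  have g := Gamma_add_one _ hne
  have n5 : Gamma (-2 * a - n) ≠ 0 := Gamma_ne_zero_of_re_pos (by
    simp
    have := (Nat.cast_nonneg n : (0 : ℝ) ≤ n); linarith)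
  have g1 := Gamma_add_nat_eq_poch_mul h.gamma_mul.2.1 (n + 1)
  have g2 := Gamma_add_nat_eq_poch_mul h.gamma_mul.2.2 (n + 1)
  rw [poch_succ] at g1 g2
  have hN : (cdhNorm a b c : ℂ) ≠ 0 := ofReal_ne_zero.2 h.cdhNorm_pos.ne'
  have hbc : Gamma (b + c) ≠ 0 := norm_pos_iff.1 h.gamma_add_pos.2
  have hf : (n.factorial : ℂ) ≠ 0 := by exact_mod_cast n.factorial_ne_zero
  have n1 := h.gamma_mul.2.1
  have n2 := h.gamma_mul.2.2
  push_cast at g1 g2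
  rw [h.ofReal_cdhNorm, gammaPhi, atomFactor]
  push_cast
  rw [show b + (a + n + 1) = a + b + (n + 1) by ring, g1,
    show c + (a + n + 1) = a + c + (n + 1) by ring, g2,
    show b + 1 - (a + n + 1) = b - a - n by ring, show c + 1 - (a + n + 1) = c - a - n by ring,
    show (1 : ℂ) - a - (a + n + 1) = -2 * a - n by ring, show (a : ℂ) + n + 1 - a = n + 1 by ring,
    Gamma_nat_eq_factorial, show (1 : ℂ) - 2 * a - n = -2 * a - n + 1 by ring, g]
  rw [← mul_inv, ← div_eq_mul_inv, div_div, div_mul_eq_mul_div,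
    div_eq_div_iff (by simp [-neg_mul, *]) (by simp [-neg_mul, *])]
  ring

/-- Absolutely continuous part and atoms together carry mass `1`: when `a` passes to `a + 1`, the mass
gained by the former is the mass lost by the latter. -/
theorem contMass_add_atomSum {a : ℝ} {b c : ℂ} (h : Admissible a b c) :
    (contMass a b c : ℂ) + atomSum a b c ⌈-a⌉₊ (fun _ => 1) = 1 := by
  obtain ⟨N, hN⟩ : ∃ N, ⌈-a⌉₊ = N := ⟨_, rfl⟩
  induction N generalizing a with
  | zero =>
    have ha : 0 ≤ a := by
      have := Nat.ceil_eq_zero.1 hN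
      linarith
    rw [contMass_eq_one h ha, hN]
    simp [atomSum]
  | succ n ih =>
    have ha : a < 0 := by
      by_contra! h0
      have := Nat.ceil_eq_zero.2 (neg_nonpos.2 h0)
      omega
    have hc := ceil_neg_succ ha
    have hn : n < ⌈-a⌉₊ := by omega
    have hn' : ⌈-(a + 1)⌉₊ = n := by omega
    have hI := ih h.add_one hn'
    have h3 := (h.atomIndex hn).2.2
    have hup : -a ≤ (n + 1 : ℕ) := Nat.ceil_le.1 hN.le
    have h1 := contMass_add_one_sub h (z₀ := a + n + 1) (by push_cast at hup; linarith)
      (by linarith) (m := n + 1) (by push_cast; ring)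
    have h2 := atomSum_one_sub n (h.atomIndex hn)
    rw [atomFactor_boundary h hn] at h2
    have hab := h.add_ne_zero
    have hN' : (cdhNorm a b c : ℂ) ≠ 0 := Complex.ofReal_ne_zero.2 h.cdhNorm_pos.ne'
    rw [hN, ← hI, hn']
    have hmul : ((a : ℂ) + b) * (a + c) ≠ 0 := mul_ne_zero hab.1 hab.2
    refine mul_left_cancel₀ hmul ?_
    rw [mul_comm ((a + b : ℂ) * (a + c)) (cdhNorm a b c : ℂ), ← div_div, eq_div_iff hmul] at h1
    linear_combination (-1 : ℂ) * h1 - h2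

/-- The normalised Newton-type polynomial `∏_{k<n} ((p + k)² + x/4) = [p + i√x/2]_n [p - i√x/2]_n`. -/
noncomputable def phi (p : ℝ) (n : ℕ) (x : ℝ) : ℝ :=
  ∏ k ∈ Finset.range n, ((p + k) ^ 2 + x / 4)

theorem phi_succ_left (p : ℝ) (n : ℕ) (x : ℝ) :
    phi p (n + 1) x = (p ^ 2 + x / 4) * phi (p + 1) n x := by
  rw [phi, phi, Finset.prod_range_succ', mul_comm]
  simp only [Nat.cast_zero, add_zero]
  congr 1
  refine Finset.prod_congr rfl fun k _ => ?_
  push_cast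
  ring

theorem phi_succ (p : ℝ) (n : ℕ) (x : ℝ) :
    phi p (n + 1) x = phi p n x * ((p + n) ^ 2 + x / 4) := by
  rw [phi, phi, Finset.prod_range_succ]

theorem phi_zero (p : ℝ) : phi p 0 = fun _ => 1 := by
  ext x; simp [phi]

/-- The integral of `g` against the absolutely continuous part, in the variable `y = √x / 2`. -/
noncomputable def contInt (a : ℝ) (b c : ℂ) (g : ℝ → ℝ) : ℝ :=
  (∫ y : ℝ, cdhWeight a b c y * g (4 * y ^ 2)) / (4 * Real.pi * cdhNorm a b c)

/-- Multiplication by `a² + x/4` shifts `a` to `a + 1`. -/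
theorem contInt_mul {a : ℝ} {b c : ℂ} (h : Admissible a b c) (g : ℝ → ℝ) :
    (contInt a b c (fun x => (a ^ 2 + x / 4) * g x) : ℂ) =
      (a + b) * (a + c) * contInt (a + 1) b c g := by
  have hN : (cdhNorm a b c : ℂ) ≠ 0 := Complex.ofReal_ne_zero.2 h.cdhNorm_pos.ne'
  have hpi : (Real.pi : ℂ) ≠ 0 := Complex.ofReal_ne_zero.2 Real.pi_ne_zero
  have h2 := h.add_ne_zero
  have h21 := h2.1
  have h22 := h2.2
  have e : ∫ y : ℝ, cdhWeight a b c y * ((a ^ 2 + 4 * y ^ 2 / 4) * g (4 * y ^ 2)) =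
      ∫ y : ℝ, cdhWeight (a + 1) b c y * g (4 * y ^ 2) := by
    congr 1
    ext y
    rw [cdhWeight_add_one]
    ring
  rw [contInt, contInt, e]
  push_cast
  rw [h.cdhNorm_add_one]
  field_simp

/-- The moments of the absolutely continuous part and the atoms together, by induction from the total
mass. -/
theorem contInt_add_atomSum {a : ℝ} {b c : ℂ} (h : Admissible a b c) (n : ℕ) :
    (contInt a b c (phi a n) : ℂ) + atomSum a b c ⌈-a⌉₊ (phi a n) =
      poch (a + b) n * poch (a + c) n := by
  induction n generalizing a with
  | zero =>
    rw [poch_zero, poch_zero, mul_one, phi_zero, ← contMass_add_atomSum h, contMass, contInt]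
    simp
  | succ n ih =>
    have hI := ih h.add_one
    have e : phi a (n + 1) = fun x => (a ^ 2 + x / 4) * phi (a + 1) n x :=
      funext fun x => phi_succ_left a n x
    rw [e, contInt_mul h, poch_succ_left, poch_succ_left]
    have e2 : atomSum a b c ⌈-a⌉₊ (fun x => (a ^ 2 + x / 4) * phi (a + 1) n x) =
        (a + b) * (a + c) * atomSum (a + 1) b c ⌈-(a + 1)⌉₊ (phi (a + 1) n) := by
      by_cases ha : a < 0
      · rw [ceil_neg_succ ha, atomSum_mul_add_one _ (h.atomIndex (by rw [ceil_neg_succ ha]; omega))]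
      · rw [Nat.ceil_eq_zero.2 (by linarith), Nat.ceil_eq_zero.2 (by linarith)]
        simp [atomSum]
    rw [e2]
    push_cast at hI
    rw [show (a : ℂ) + b + 1 = a + 1 + b by ring, show (a : ℂ) + c + 1 = a + 1 + c by ring]
    linear_combination ((a + b : ℂ) * (a + c)) * hI

/-- The moments in the purely atomic case `a + b = -k`. Here the telescoping sum over all `k + 1` atoms
has no boundary term. -/
theorem atomSum_of_terminating {a b c : ℝ} {k : ℕ} (hab : a + b = -k) (hb : 0 < b) (hbc : 0 < b + c)
    (hac : a + c + k ≤ 0) (n : ℕ) :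
    atomSum a (b : ℂ) (c : ℂ) (k + 1) (phi a n) = poch (a + b) n * poch (a + c) n := by
  have hidx : ∀ (a : ℝ) (k : ℕ), a + b = -k → AtomIndex a (b : ℂ) (c : ℂ) k := by
    intro a k hab
    have := (Nat.cast_nonneg k : (0 : ℝ) ≤ k)
    refine ⟨?_, ?_, by linarith⟩ <;>
      simp only [Complex.sub_re, Complex.ofReal_re, Complex.natCast_re] <;> linarith
  have hz : ∀ (a : ℝ) (k : ℕ), a + b = -k → (a : ℂ) + b = -k := fun a k h => by
    rw [← Complex.ofReal_add, h]; simp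
  have base : ∀ a : ℝ, a + b = 0 → atomSum a (b : ℂ) (c : ℂ) 1 (fun _ => 1) = 1 := by
    intro a h0
    have hb' : b = -a := by linarith
    have g : Complex.Gamma (1 - 2 * a) = -2 * a * Complex.Gamma (-2 * a) := by
      rw [← Complex.Gamma_add_one _ (by simp; linarith)]; congr 1; ring
    have n1 : Complex.Gamma (-2 * a) ≠ 0 := Complex.Gamma_ne_zero_of_re_pos (by simp; linarith)
    have n2 : Complex.Gamma (c - a) ≠ 0 := Complex.Gamma_ne_zero_of_re_pos (by simp; linarith)
    have ha : (a : ℂ) ≠ 0 := by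
      have : a ≠ 0 := by linarith
      exact_mod_cast this
    simp only [atomSum, Finset.sum_range_one, atomFactor, poch_zero]
    rw [hb']
    push_cast
    rw [show -(a : ℂ) - a - 0 = -2 * a by ring, show -(a : ℂ) + c = c - a by ring, sub_zero, sub_zero,
      g]
    simp only [Nat.factorial_zero, Nat.cast_one, add_zero, mul_one, one_mul]
    field_simp
    exact div_self (by simpa using n1)
  have mass : atomSum a (b : ℂ) (c : ℂ) (k + 1) (fun _ => 1) = 1 := by
    clear n
    induction k generalizing a with
    | zero => exact base a (by simpa using hab)
    | succ k ih =>
      push_cast at hab hac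
      have hI := ih (a := a + 1) (by linarith) (by linarith)
      have h2 := atomSum_one_sub (k + 1) (hidx a (k + 1) (by push_cast; linarith))
      have e : (a : ℂ) + b + (k + 1 : ℕ) = 0 := by rw [hz a (k + 1) (by push_cast; linarith)]; ring
      rw [e, hI] at h2
      have hne : ((a : ℂ) + b) * (a + c) ≠ 0 := by
        have h1 : a + b ≠ 0 := by linarith [(Nat.cast_nonneg k : (0 : ℝ) ≤ k)]
        have h2 : a + c ≠ 0 := by linarith [(Nat.cast_nonneg k : (0 : ℝ) ≤ k)]
        exact_mod_cast mul_ne_zero h1 h2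
      have h3 : ((a : ℂ) + b) * (a + c) *
          (1 - atomSum a (b : ℂ) (c : ℂ) (k + 1 + 1) fun _ => 1) = 0 := by rw [h2]; ring
      exact (sub_eq_zero.1 ((mul_eq_zero.1 h3).resolve_left hne)).symm
  induction n generalizing a k with
  | zero => rw [poch_zero, poch_zero, mul_one, phi_zero]; exact mass
  | succ n ih =>
    have e : phi a (n + 1) = fun x => (a ^ 2 + x / 4) * phi (a + 1) n x :=
      funext fun x => phi_succ_left a n x
    rw [e, atomSum_mul_add_one _ (hidx a k hab), poch_succ_left, poch_succ_left]
    cases k with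
    | zero => rw [hz a 0 (by simpa using hab)]; simp
    | succ k =>
      push_cast at hab hac
      have hm : atomSum (a + 1) (b : ℂ) (c : ℂ) (k + 1) (fun _ => 1) = 1 := by
        have h2 := atomSum_one_sub (k + 1) (hidx a (k + 1) (by push_cast; linarith))
        have e : (a : ℂ) + b + (k + 1 : ℕ) = 0 := by rw [hz a (k + 1) (by push_cast; linarith)]; ring
        rw [e, mass] at h2
        have hne : ((a : ℂ) + b) * (a + c) ≠ 0 := by
          have h1 : a + b ≠ 0 := by linarith [(Nat.cast_nonneg k : (0 : ℝ) ≤ k)]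
          have h2 : a + c ≠ 0 := by linarith [(Nat.cast_nonneg k : (0 : ℝ) ≤ k)]
          exact_mod_cast mul_ne_zero h1 h2
        have h3 : ((a : ℂ) + b) * (a + c) *
            (atomSum (a + 1) (b : ℂ) (c : ℂ) (k + 1) (fun _ => 1) - 1) = 0 := by rw [h2]; ring
        exact sub_eq_zero.1 ((mul_eq_zero.1 h3).resolve_left hne)
      have hI := ih (a := a + 1) (k := k) (by linarith) (by linarith) hm
      rw [hI]
      push_cast
      rw [show (a : ℂ) + b + 1 = a + 1 + b by ring, show (a : ℂ) + c + 1 = a + 1 + c by ring]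
      ring

/-! ### Moments of the continuous dual Hahn measures -/

open Complex in
theorem cdhWeight_neg (a : ℝ) {b c : ℂ} (h : IsPair b c) (y : ℝ) :
    cdhWeight a b c (-y) = cdhWeight a b c y := by
  have : (cdhWeight a b c (-y) : ℂ) = cdhWeight a b c y := by
    rw [cdhWeight_eq a h, cdhWeight_eq a h]
    push_cast
    rw [show I * -(y : ℂ) = -(I * y) by ring, show 2 * (Real.pi : ℂ) * -(I * y) =
      -(2 * Real.pi * (I * y)) by ring, sin_neg, sub_neg_eq_add, sub_neg_eq_add, sub_neg_eq_add,
      ← sub_eq_add_neg, ← sub_eq_add_neg, ← sub_eq_add_neg]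
    ring
  exact_mod_cast this

/-- The density in terms of the weight in the variable `√x / 2`. -/
theorem cdhDensity_eq (a : ℝ) (b c : ℂ) {x : ℝ} (hx : 0 < x) :
    cdhDensity a b c x = cdhWeight a b c (√x / 2) / (8 * Real.pi * cdhNorm a b c * √x) := by
  rw [cdhDensity, if_pos hx, cdhWeight, show 2 * (√x / 2) = √x by ring,
    ← inv_norm_Gamma_I_mul_sq, ← cdhNorm]
  ring

theorem cdhDensity_of_nonpos (a : ℝ) (b c : ℂ) {x : ℝ} (hx : x ≤ 0) : cdhDensity a b c x = 0 := by
  rw [cdhDensity, if_neg (not_lt.2 hx)]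

theorem cdhDensity_nonneg {a : ℝ} {b c : ℂ} (hN : 0 < cdhNorm a b c) (x : ℝ) :
    0 ≤ cdhDensity a b c x := by
  rcases le_or_gt x 0 with hx | hx
  · rw [cdhDensity_of_nonpos a b c hx]
  · rw [cdhDensity_eq a b c hx]
    have := cdhWeight_nonneg a b c (√x / 2)
    have := Real.pi_pos
    positivity

theorem measurable_cdhDensity (a : ℝ) (b c : ℂ) : Measurable (cdhDensity a b c) := by
  have e : cdhDensity a b c = Set.indicator (Set.Ioi 0) fun x =>
      cdhWeight a b c (√x / 2) / (8 * Real.pi * cdhNorm a b c * √x) := by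
    ext x
    by_cases hx : 0 < x
    · rw [Set.indicator_of_mem (Set.mem_Ioi.2 hx), cdhDensity_eq a b c hx]
    · rw [Set.indicator_of_notMem (by simpa using hx), cdhDensity_of_nonpos a b c (not_lt.1 hx)]
  rw [e]
  refine Measurable.indicator ?_ measurableSet_Ioi
  have hs : Measurable fun x : ℝ => √x := Real.continuous_sqrt.measurable
  exact ((measurable_cdhWeight a b c).comp (hs.div_const 2)).div (hs.const_mul _)

theorem image_four_mul_sq : (fun y : ℝ => 4 * y ^ 2) '' Set.Ioi 0 = Set.Ioi 0 := by
  ext x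
  constructor
  · rintro ⟨y, hy, rfl⟩
    have : (0 : ℝ) < y := hy
    exact Set.mem_Ioi.2 (by positivity)
  · intro hx
    have hx' : (0 : ℝ) < x := hx
    refine ⟨√x / 2, Set.mem_Ioi.2 (by positivity), ?_⟩
    have := Real.sq_sqrt hx'.le
    simp only
    linarith

theorem injOn_four_mul_sq : Set.InjOn (fun y : ℝ => 4 * y ^ 2) (Set.Ioi 0) := by
  intro x hx y hy h
  have hx' : (0 : ℝ) < x := hx
  have hy' : (0 : ℝ) < y := hy
  simp only at h
  nlinarith [mul_self_eq_mul_self_iff.1 (show x * x = y * y by nlinarith)]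

theorem hasDerivWithinAt_four_mul_sq (y : ℝ) :
    HasDerivWithinAt (fun y : ℝ => 4 * y ^ 2) (8 * y) (Set.Ioi 0) y := by
  have h := ((hasDerivAt_pow 2 y).const_mul 4).hasDerivWithinAt (s := Set.Ioi 0)
  rwa [show (4 : ℝ) * ((2 : ℕ) * y ^ (2 - 1)) = 8 * y by norm_num; ring] at h

/-- The density under the substitution `x = 4y²`. -/
theorem deriv_smul_cdhDensity {a : ℝ} {b c : ℂ} (hN : 0 < cdhNorm a b c) (g : ℝ → ℝ) {y : ℝ}
    (hy : 0 < y) : |8 * y| • (cdhDensity a b c (4 * y ^ 2) * g (4 * y ^ 2)) =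
      (2 * Real.pi * cdhNorm a b c)⁻¹ * (cdhWeight a b c y * g (4 * y ^ 2)) := by
  have h2 : √(4 * y ^ 2) = 2 * y := by
    rw [show 4 * y ^ 2 = (2 * y) ^ 2 by ring, Real.sqrt_sq (by positivity)]
  rw [cdhDensity_eq a b c (by positivity), h2, abs_of_pos (by positivity), smul_eq_mul,
    show 2 * y / 2 = y by ring]
  have := Real.pi_pos
  field_simp

theorem integral_cdhDensity_mul {a : ℝ} {b c : ℂ} (h : IsPair b c) (hN : 0 < cdhNorm a b c)
    (g : ℝ → ℝ) : ∫ x, cdhDensity a b c x * g x = contInt a b c g := by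
  rw [← setIntegral_eq_integral_of_forall_compl_eq_zero (s := Set.Ioi 0) fun x hx => by
      rw [cdhDensity_of_nonpos a b c (not_lt.1 hx), zero_mul], ← image_four_mul_sq,
    integral_image_eq_integral_abs_deriv_smul measurableSet_Ioi
      (fun y _ => hasDerivWithinAt_four_mul_sq y) injOn_four_mul_sq,
    setIntegral_congr_fun measurableSet_Ioi (fun y hy => deriv_smul_cdhDensity hN g hy),
    integral_const_mul, contInt]
  have e : ∫ y, cdhWeight a b c y * g (4 * y ^ 2) =
      2 * ∫ y in Set.Ioi 0, cdhWeight a b c y * g (4 * y ^ 2) := by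
    rw [← integral_comp_abs]
    congr 1
    ext y
    rcases abs_choice y with h1 | h1 <;> rw [h1]
    rw [cdhWeight_neg a h, neg_sq]
  rw [e]
  have := Real.pi_pos
  field_simp
  ring

theorem integrable_pow_mul_cdhDensity {a : ℝ} {b c : ℂ} (hb : 0 < b.re) (hc : 0 < c.re)
    (hN : 0 < cdhNorm a b c) (k : ℕ) : Integrable fun x => cdhDensity a b c x * x ^ k := by
  rw [← integrableOn_iff_integrable_of_support_subset (s := Set.Ioi 0) fun x hx => by
      by_contra h0
      exact hx (by simp only [cdhDensity_of_nonpos a b c (not_lt.1 h0), zero_mul]), ← image_four_mul_sq,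
    integrableOn_image_iff_integrableOn_abs_deriv_smul measurableSet_Ioi
      (fun y _ => hasDerivWithinAt_four_mul_sq y) injOn_four_mul_sq,
    integrableOn_congr_fun (fun y hy => deriv_smul_cdhDensity hN (fun x => x ^ k)
      (Set.mem_Ioi.1 hy)) measurableSet_Ioi]
  refine (Integrable.const_mul ?_ _).integrableOn
  refine Integrable.mono' ((integrable_pow_mul_cdhWeight a hb hc k).const_mul (4 ^ k)) ?_ ?_
  · exact ((measurable_cdhWeight a b c).mul (by fun_prop)).aestronglyMeasurable
  · refine Filter.Eventually.of_forall fun y => ?_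
    have h0 := cdhWeight_nonneg a b c y
    rw [Real.norm_of_nonneg (by positivity)]
    have : (4 * y ^ 2) ^ k ≤ 4 ^ k * (1 + y ^ 2) ^ k := by
      rw [← mul_pow]
      gcongr
      linarith
    calc _ ≤ cdhWeight a b c y * (4 ^ k * (1 + y ^ 2) ^ k) := by gcongr
      _ = _ := by ring

/-- The moments of a measure on `ℝ` all exist and, in the basis `phi p`, are the numbers `M n`. -/
def HasMoments (μ : Measure ℝ) (p : ℝ) (M : ℕ → ℝ) : Prop :=
  (∀ k : ℕ, Integrable (fun x => x ^ k) μ) ∧ ∀ n, ∫ x, phi p n x ∂μ = M n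

theorem integrable_eval {μ : Measure ℝ} (h : ∀ k : ℕ, Integrable (fun x => x ^ k) μ)
    (P : Polynomial ℝ) : Integrable (fun x => P.eval x) μ := by
  simp only [Polynomial.eval_eq_sum_range]
  exact integrable_finsetSum _ fun i _ => (h i).const_mul _

theorem exists_eval_eq_phi (p : ℝ) (n : ℕ) : ∃ P : Polynomial ℝ, ∀ x, P.eval x = phi p n x :=
  ⟨∏ k ∈ Finset.range n, (Polynomial.C ((p + k) ^ 2) + Polynomial.X * Polynomial.C (1 / 4)),
    fun x => by
      rw [Polynomial.eval_prod, phi]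
      refine Finset.prod_congr rfl fun k _ => ?_
      simp
      ring⟩

theorem integrable_phi_mul_phi {μ : Measure ℝ} (h : ∀ k : ℕ, Integrable (fun x => x ^ k) μ)
    (p q : ℝ) (n k : ℕ) : Integrable (fun x => phi p n x * phi q k x) μ := by
  obtain ⟨P, hP⟩ := exists_eval_eq_phi p n
  obtain ⟨Q, hQ⟩ := exists_eval_eq_phi q k
  have := integrable_eval h (P * Q)
  simpa only [Polynomial.eval_mul, hP, hQ] using this

theorem integrable_phi {μ : Measure ℝ} (h : ∀ k : ℕ, Integrable (fun x => x ^ k) μ)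
    (p : ℝ) (n : ℕ) : Integrable (phi p n) μ := by
  obtain ⟨P, hP⟩ := exists_eval_eq_phi p n
  have := integrable_eval h P
  simpa only [hP] using this

/-- The absolutely continuous part of the continuous dual Hahn measure. -/
noncomputable def contMeasure (a : ℝ) (b c : ℂ) : Measure ℝ :=
  volume.withDensity fun x => ENNReal.ofReal (cdhDensity a b c x)

/-- The atomic part with `n` atoms. -/
noncomputable def atomMeasure (a : ℝ) (b c : ℂ) (n : ℕ) : Measure ℝ :=
  ∑ j ∈ Finset.range n, ENNReal.ofReal (cdhMass a b c j) • Measure.dirac (-4 * (a + j) ^ 2)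

theorem integrable_contMeasure {a : ℝ} {b c : ℂ} (hN : 0 < cdhNorm a b c) {g : ℝ → ℝ}
    (hg : Integrable fun x => cdhDensity a b c x * g x) : Integrable g (contMeasure a b c) := by
  rw [contMeasure, integrable_withDensity_iff (measurable_cdhDensity a b c).ennreal_ofReal
    (Filter.Eventually.of_forall fun _ => ENNReal.ofReal_lt_top)]
  refine hg.congr (Filter.Eventually.of_forall fun x => ?_)
  simp only
  rw [ENNReal.toReal_ofReal (cdhDensity_nonneg hN x), mul_comm]

theorem integral_contMeasure {a : ℝ} {b c : ℂ} (h : IsPair b c) (hN : 0 < cdhNorm a b c)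
    (g : ℝ → ℝ) : ∫ x, g x ∂(contMeasure a b c) = contInt a b c g := by
  rw [contMeasure, integral_withDensity_eq_integral_toReal_smul
    (measurable_cdhDensity a b c).ennreal_ofReal
    (Filter.Eventually.of_forall fun _ => ENNReal.ofReal_lt_top), ← integral_cdhDensity_mul h hN]
  congr 1
  ext x
  rw [ENNReal.toReal_ofReal (cdhDensity_nonneg hN x), smul_eq_mul]

theorem integrable_atomMeasure (a : ℝ) (b c : ℂ) (n : ℕ) (g : ℝ → ℝ) :
    Integrable g (atomMeasure a b c n) := by
  rw [atomMeasure, integrable_finsetSum_measure]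
  exact fun j _ => (integrable_dirac (by simp)).smul_measure ENNReal.ofReal_ne_top

/-- The masses of the first `n` atoms are nonnegative, and the complex numbers of which `cdhMass` takes
the real part are real. -/
def NonnegMasses (a : ℝ) (b c : ℂ) (n : ℕ) : Prop :=
  ∀ j < n, 0 ≤ cdhMass a b c j ∧ (cdhMass a b c j : ℂ) = -2 * (a + j) * atomFactor a b c j

theorem NonnegMasses.integral_atomMeasure {a : ℝ} {b c : ℂ} {n : ℕ} (h : NonnegMasses a b c n)
    (g : ℝ → ℝ) : ((∫ x, g x ∂(atomMeasure a b c n) : ℝ) : ℂ) = atomSum a b c n g := by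
  rw [atomMeasure, integral_finsetSum_measure fun j _ =>
    (integrable_dirac (by simp)).smul_measure ENNReal.ofReal_ne_top, atomSum]
  push_cast
  refine Finset.sum_congr rfl fun j hj => ?_
  obtain ⟨h1, h2⟩ := h j (Finset.mem_range.1 hj)
  rw [integral_smul_measure, integral_dirac, ENNReal.toReal_ofReal h1, smul_eq_mul, ← h2]
  push_cast
  ring

theorem cdhMass_nonneg_of_atomFactor {a : ℝ} {b c : ℂ} {j : ℕ} (h : AtomIndex a b c j) {r : ℝ}
    (hr : 0 ≤ r) (he : atomFactor a b c j = r) :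
    0 ≤ cdhMass a b c j ∧ (cdhMass a b c j : ℂ) = -2 * (a + j) * atomFactor a b c j := by
  have e : -2 * ((a : ℂ) + j) * atomFactor a b c j = ((-2 * (a + j) * r : ℝ) : ℂ) := by
    rw [he]; push_cast; ring
  have h3 := h.2.2
  rw [cdhMass_eq h, e, Complex.ofReal_re]
  exact ⟨mul_nonneg (by linarith) hr, rfl⟩

theorem Admissible.add_nat {a : ℝ} {b c : ℂ} (h : Admissible a b c) (j : ℕ) :
    Admissible (a + j) b c :=
  h.imp id fun ⟨h1, h2, h3, h4, h5⟩ => ⟨h1, h2, h3, by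
    linarith [(Nat.cast_nonneg j : (0 : ℝ) ≤ j)], by linarith [(Nat.cast_nonneg j : (0 : ℝ) ≤ j)]⟩

open Complex in
/-- The atom factors in terms of absolute values; in particular they are nonnegative reals. -/
theorem Admissible.atomFactor_eq {a : ℝ} {b c : ℂ} (h : Admissible a b c) {j : ℕ}
    (hj : j < ⌈-a⌉₊) : atomFactor a b c j =
      ((‖Gamma (b + a + j)‖ * ‖Gamma (c + a + j)‖ / (‖Gamma (a + b)‖ * ‖Gamma (a + c)‖) *
        ‖Gamma (b - a - j)‖ * ‖Gamma (c - a - j)‖ /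
        (j.factorial * ‖Gamma (b + c)‖ * Real.Gamma (1 - 2 * a - j)) : ℝ) : ℂ) := by
  have h3 := (h.atomIndex hj).2.2
  have hm := (h.of_nonneg (a' := -a - j) (by linarith)).gamma_mul.1
  have hp := (h.add_nat j).gamma_mul.1
  have h0 := h.gamma_mul
  have g1 := Gamma_add_nat_eq_poch_mul h.gamma_mul.2.1 j
  have g2 := Gamma_add_nat_eq_poch_mul h.gamma_mul.2.2 j
  push_cast at hm hp
  rw [show -(a : ℂ) - j + b = b - a - j by ring, show -(a : ℂ) - j + c = c - a - j by ring] at hm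
  rw [show (a : ℂ) + j + b = b + a + j by ring, show (a : ℂ) + j + c = c + a + j by ring] at hp
  rw [show (a : ℂ) + b + j = b + a + j by ring] at g1
  rw [show (a : ℂ) + c + j = c + a + j by ring] at g2
  have e : poch (a + b) j * poch (a + c) j =
      ((‖Gamma (b + a + j)‖ * ‖Gamma (c + a + j)‖ / (‖Gamma (a + b)‖ * ‖Gamma (a + c)‖) : ℝ) : ℂ) := by
    have h01 := h0.1
    push_cast at h01 ⊢
    rw [← hp, ← h01, g1, g2]
    have n1 := h0.2.1
    have n2 := h0.2.2
    field_simp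
  rw [atomFactor, e, mul_assoc _ (Gamma (b - a - j)), hm, h.gamma_add_pos.1, norm_real, norm_norm]
  push_cast [← Gamma_ofReal]
  ring

theorem Admissible.nonnegMasses {a : ℝ} {b c : ℂ} (h : Admissible a b c) :
    NonnegMasses a b c ⌈-a⌉₊ := fun j hj =>
  cdhMass_nonneg_of_atomFactor (h.atomIndex hj) (by
    have h3 := (h.atomIndex hj).2.2
    have := Real.Gamma_pos_of_pos (s := 1 - 2 * a - j) (by
      linarith [(Nat.cast_nonneg j : (0 : ℝ) ≤ j)])
    positivity) (h.atomFactor_eq hj)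

theorem sum_range_floor_eq_sum_range_ceil {M : Type*} [AddCommMonoid M] {a : ℝ} (ha : a < 0)
    (f : ℕ → M) (hf : ∀ j : ℕ, a + j = 0 → f j = 0) :
    ∑ j ∈ Finset.range (⌊-a⌋₊ + 1), f j = ∑ j ∈ Finset.range ⌈-a⌉₊, f j := by
  have h1 := Nat.ceil_le_floor_add_one (-a)
  have h2 := Nat.floor_le_ceil (-a)
  rcases h1.eq_or_lt with h3 | h3
  · rw [h3]
  · have h4 : ⌈-a⌉₊ = ⌊-a⌋₊ := by omega
    have h5 : a + (⌊-a⌋₊ : ℝ) = 0 := by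
      have := Nat.floor_le (neg_pos.2 ha).le
      have := Nat.le_ceil (-a)
      rw [h4] at this
      linarith
    rw [Finset.sum_range_succ, hf _ h5, h4, add_zero]

/-- The atom `j = -a`, present in the definition of `cdh` when `a` is a negative integer, has mass `0`,
so the atoms can be counted by `⌈-a⌉`. -/
theorem cdh_of_admissible {a : ℝ} {b c : ℂ} (h : Admissible a b c) {pts : ℕ → ℝ}
    (hpts : ∀ j, pts j = -4 * (a + j) ^ 2) :
    cdh a b c pts = contMeasure a b c + atomMeasure a b c ⌈-a⌉₊ := by
  by_cases ha : 0 ≤ a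
  · have hP : CaseP a b c := ⟨ha, h.imp (fun h => ⟨h.1, h.2⟩) fun h => ⟨h.1, h.2.1, h.2.2.1⟩⟩
    rw [cdh, if_pos hP, Nat.ceil_eq_zero.2 (by linarith), atomMeasure]
    simp [contMeasure]
  · have hP : ¬ CaseP a b c := fun h => ha h.1
    rw [not_le] at ha
    have hN : CaseN1 a b c :=
      ⟨ha, h.imp (fun h => ⟨h.1, h.2⟩) fun h => ⟨h.1, h.2.2.2⟩⟩
    rw [cdh, if_neg hP, if_pos hN, contMeasure, atomMeasure]
    simp only [hpts]
    rw [sum_range_floor_eq_sum_range_ceil ha]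
    intro j hj
    have : (a : ℂ) + j = 0 := by exact_mod_cast hj
    rw [cdhMass, this]
    simp

theorem integrable_pow_cdh {a : ℝ} {b c : ℂ} (h : Admissible a b c) {pts : ℕ → ℝ}
    (hpts : ∀ j, pts j = -4 * (a + j) ^ 2) (k : ℕ) : Integrable (fun x => x ^ k) (cdh a b c pts) := by
  rw [cdh_of_admissible h hpts]
  exact (integrable_contMeasure h.cdhNorm_pos
    (integrable_pow_mul_cdhDensity h.re_pos_left h.re_pos_right h.cdhNorm_pos k)).add_measure
    (integrable_atomMeasure a b c _ _)

theorem hasMoments_cdh {a : ℝ} {b c : ℂ} (h : Admissible a b c) {pts : ℕ → ℝ}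
    (hpts : ∀ j, pts j = -4 * (a + j) ^ 2) {M : ℕ → ℝ}
    (hM : ∀ n, poch (a + b) n * poch (a + c) n = M n) : HasMoments (cdh a b c pts) a M := by
  refine ⟨integrable_pow_cdh h hpts, fun n => ?_⟩
  have hi := integrable_phi (integrable_pow_cdh h hpts) a n
  rw [cdh_of_admissible h hpts] at hi ⊢
  rw [integral_add_measure hi.left_of_add_measure hi.right_of_add_measure,
    integral_contMeasure h.isPair h.cdhNorm_pos]
  have := contInt_add_atomSum h n
  rw [hM, ← h.nonnegMasses.integral_atomMeasure] at this
  exact_mod_cast this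

/-- Parameters of a purely atomic measure with `k + 1` atoms and nonnegative masses. -/
def Terminating (a b c : ℝ) (k : ℕ) : Prop :=
  a + b = -k ∧ 0 < b ∧ 0 < b + c ∧ a + c + k ≤ 0

theorem Terminating.nonnegMasses {a b c : ℝ} {k : ℕ} (h : Terminating a b c k) :
    NonnegMasses a b c (k + 1) := by
  obtain ⟨hab, hb, hbc, hac⟩ := h
  intro j hj
  have hjk : (j : ℝ) ≤ k := by exact_mod_cast Nat.lt_succ_iff.1 hj
  have hj0 := (Nat.cast_nonneg j : (0 : ℝ) ≤ j)
  have hI : AtomIndex a (b : ℂ) (c : ℂ) j := by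
    refine ⟨?_, ?_, by linarith⟩ <;>
      simp only [Complex.sub_re, Complex.ofReal_re, Complex.natCast_re] <;> linarith
  have g1 := Real.Gamma_pos_of_pos (s := b - a - j) (by linarith)
  have g2 := Real.Gamma_pos_of_pos (s := c - a - j) (by linarith)
  have g3 := Real.Gamma_pos_of_pos (s := b + c) hbc
  have g4 := Real.Gamma_pos_of_pos (s := 1 - 2 * a - j) (by linarith)
  have hp : 0 ≤ ∏ i ∈ Finset.range j, (a + b + i) * (a + c + i) := by
    refine Finset.prod_nonneg fun i hi => ?_
    have : (i : ℝ) + 1 ≤ j := by exact_mod_cast Finset.mem_range.1 hi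
    exact mul_nonneg_of_nonpos_of_nonpos (by linarith) (by linarith)
  refine cdhMass_nonneg_of_atomFactor hI (r := (∏ i ∈ Finset.range j, (a + b + i) * (a + c + i)) *
    Real.Gamma (b - a - j) * Real.Gamma (c - a - j) /
      (j.factorial * Real.Gamma (b + c) * Real.Gamma (1 - 2 * a - j))) (by positivity) ?_
  rw [atomFactor, poch_eq_prod, poch_eq_prod, ← Finset.prod_mul_distrib]
  push_cast [← Complex.Gamma_ofReal]
  rfl

theorem Terminating.cdh_eq {a b c : ℝ} {k : ℕ} (h : Terminating a b c k) {pts : ℕ → ℝ}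
    (hpts : ∀ j, pts j = -4 * (a + j) ^ 2) : cdh a b c pts = atomMeasure a b c (k + 1) := by
  obtain ⟨hab, hb, hbc, hac⟩ := h
  have hk := (Nat.cast_nonneg k : (0 : ℝ) ≤ k)
  have ha : a < 0 := by linarith
  have hP : ¬ CaseP a b c := fun h => by linarith [h.1]
  have hN : ¬ CaseN1 a b c := by
    rintro ⟨_, h | h⟩
    · exact h.2.1 (Complex.ofReal_im b)
    · have := h.2.1
      rw [Complex.ofReal_re] at this
      linarith
  have h2 : CaseN2 a b c := ⟨ha, ⟨Complex.ofReal_im b, Complex.ofReal_im c⟩, by simpa, by simpa, by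
    rw [Complex.ofReal_re]; linarith, k, by rw [Complex.ofReal_re]; exact hab⟩
  rw [cdh, if_neg hP, if_neg hN, if_pos h2, Complex.ofReal_re, hab, neg_neg, Nat.floor_natCast,
    atomMeasure]
  simp only [hpts]

theorem Terminating.hasMoments_cdh {a b c : ℝ} {k : ℕ} (h : Terminating a b c k) {pts : ℕ → ℝ}
    (hpts : ∀ j, pts j = -4 * (a + j) ^ 2) {M : ℕ → ℝ}
    (hM : ∀ n, poch (a + b) n * poch (a + c) n = M n) : HasMoments (cdh a b c pts) a M := by
  rw [h.cdh_eq hpts]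
  refine ⟨fun k => integrable_atomMeasure _ _ _ _ _, fun n => ?_⟩
  have := atomSum_of_terminating h.1 h.2.1 h.2.2.1 h.2.2.2 n
  rw [hM, ← h.nonnegMasses.integral_atomMeasure] at this
  exact_mod_cast this

theorem contMeasure_compl_Ioi (a : ℝ) (b c : ℂ) : contMeasure a b c (Set.Ioi 0)ᶜ = 0 := by
  rw [contMeasure, withDensity_apply _ measurableSet_Ioi.compl]
  rw [setLIntegral_congr_fun (g := 0) measurableSet_Ioi.compl fun x hx => by
    simp [cdhDensity_of_nonpos a b c (not_lt.1 hx)]]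
  simp

theorem atomMeasure_eq_zero {a : ℝ} {b c : ℂ} {n : ℕ} {S : Set ℝ}
    (hS : ∀ j < n, -4 * (a + j) ^ 2 ∈ S) : atomMeasure a b c n Sᶜ = 0 := by
  rw [atomMeasure, Measure.finsetSum_apply]
  refine Finset.sum_eq_zero fun j hj => ?_
  rw [Measure.smul_apply, Measure.dirac_apply, Set.indicator_of_notMem (by
    simpa using hS j (Finset.mem_range.1 hj)), smul_zero]

/-- The moments are symmetric in the parameters `a` and `c`: by induction on `k`, the integral of
`phi a n * phi c k` is `[a+b]_n [a+c]_{n+k} [c+b]_k`. -/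
theorem HasMoments.swap {μ : Measure ℝ} {a b c : ℝ}
    (h : HasMoments μ a fun n => pochR (a + b) n * pochR (a + c) n) :
    HasMoments μ c fun n => pochR (c + b) n * pochR (a + c) n := by
  refine ⟨h.1, ?_⟩
  have key : ∀ k n, ∫ x, phi a n x * phi c k x ∂μ =
      pochR (a + b) n * pochR (a + c) (n + k) * pochR (c + b) k := by
    have hs : ∀ (x : ℝ) (n : ℕ), pochR x (n + 1) = pochR x n * (x + n) := fun x n => by
      rw [pochR_eq_prod, pochR_eq_prod, Finset.prod_range_succ]
    intro k
    induction k with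
    | zero =>
      intro n
      have := h.2 n
      simpa [phi_zero, pochR_eq_prod] using this
    | succ k ih =>
      intro n
      have e : ∀ x, phi a n x * phi c (k + 1) x = phi a (n + 1) x * phi c k x +
          ((c + k) ^ 2 - (a + n) ^ 2) * (phi a n x * phi c k x) := fun x => by
        rw [phi_succ, phi_succ]; ring
      simp only [e]
      rw [integral_add (integrable_phi_mul_phi h.1 _ _ _ _)
        ((integrable_phi_mul_phi h.1 _ _ _ _).const_mul _), integral_const_mul, ih, ih, hs, hs,
        show n + 1 + k = (n + k) + 1 by ring, show n + (k + 1) = (n + k) + 1 by ring, hs]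
      push_cast
      ring
  intro n
  have := key n 0
  simp only [phi_zero, one_mul, zero_add] at this
  rw [this]
  simp [pochR_eq_prod]
  ring

/-! ### Measures determined by their moments -/

/-- The symmetric law of `±√y`, without the factor `1/2`. -/
noncomputable def symmSqrt (μ : Measure ℝ) : Measure ℝ :=
  μ.map (fun y => √y) + μ.map (fun y => -√y)

theorem measurable_neg_sqrt : Measurable fun y : ℝ => -√y :=
  Real.continuous_sqrt.measurable.neg

/-- The exponential moments of the symmetrised law, as a series in the moments of `μ`; an identity in
`[0, ∞]`, so that both sides may be infinite. -/
theorem lintegral_exp_symmSqrt {μ : Measure ℝ} (h0 : μ (Set.Iio 0) = 0) (ξ : ℝ) :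
    ∫⁻ z, ENNReal.ofReal (Real.exp (ξ * z)) ∂(symmSqrt μ) =
      ∑' n : ℕ, ENNReal.ofReal (2 * ξ ^ (2 * n) / (2 * n).factorial) *
        ∫⁻ y, ENNReal.ofReal (y ^ n) ∂μ := by
  have hs : Measurable fun y : ℝ => √y := Real.continuous_sqrt.measurable
  have hm : Measurable fun z : ℝ => ENNReal.ofReal (Real.exp (ξ * z)) :=
    (Real.continuous_exp.comp (continuous_const.mul continuous_id)).measurable.ennreal_ofReal
  have hae : ∀ᵐ y ∂μ, 0 ≤ y := by
    rw [ae_iff]; simpa [Set.Iio] using h0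
  rw [symmSqrt, lintegral_add_measure, lintegral_map hm hs, lintegral_map hm measurable_neg_sqrt,
    ← lintegral_add_left (f := fun y => ENNReal.ofReal (Real.exp (ξ * √y))) (hm.comp hs)]
  have e : ∀ᵐ y ∂μ, ENNReal.ofReal (Real.exp (ξ * √y)) + ENNReal.ofReal (Real.exp (ξ * -√y)) =
      ∑' n : ℕ, ENNReal.ofReal (2 * ξ ^ (2 * n) / (2 * n).factorial) * ENNReal.ofReal (y ^ n) := by
    filter_upwards [hae] with y hy
    have h1 := (Real.hasSum_cosh (ξ * √y)).mul_left 2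
    have h2 : ∀ n : ℕ, 2 * ((ξ * √y) ^ (2 * n) / (2 * n).factorial) =
        2 * ξ ^ (2 * n) / (2 * n).factorial * y ^ n := fun n => by
      rw [mul_pow, pow_mul (√y), Real.sq_sqrt hy]; ring
    simp only [h2] at h1
    rw [← ENNReal.ofReal_add (Real.exp_pos _).le (Real.exp_pos _).le]
    have hnn : ∀ n : ℕ, 0 ≤ 2 * ξ ^ (2 * n) / (2 * n).factorial := fun n => by
      have : 0 ≤ ξ ^ (2 * n) := (even_two_mul n).pow_nonneg ξ
      positivity
    have h3 : Real.exp (ξ * √y) + Real.exp (ξ * -√y) = 2 * Real.cosh (ξ * √y) := by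
      rw [Real.cosh_eq, mul_neg]; ring
    rw [h3, ← h1.tsum_eq, ENNReal.ofReal_tsum_of_nonneg (fun n => mul_nonneg (hnn n) (pow_nonneg hy n))
      h1.summable]
    exact tsum_congr fun n => ENNReal.ofReal_mul (hnn n)
  rw [lintegral_congr_ae e, lintegral_tsum fun n => by fun_prop]
  exact tsum_congr fun n => lintegral_const_mul _ (by fun_prop)

instance isFiniteMeasure_symmSqrt (μ : Measure ℝ) [IsFiniteMeasure μ] :
    IsFiniteMeasure (symmSqrt μ) := by
  rw [symmSqrt]; infer_instance

theorem map_sq_symmSqrt {μ : Measure ℝ} (h0 : μ (Set.Iio 0) = 0) :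
    (symmSqrt μ).map (fun z => z ^ 2) = μ + μ := by
  have hs : Measurable fun y : ℝ => √y := Real.continuous_sqrt.measurable
  have hq : Measurable fun z : ℝ => z ^ 2 := by fun_prop
  have hae : ∀ᵐ y ∂μ, 0 ≤ y := by
    rw [ae_iff]; simpa [Set.Iio] using h0
  rw [symmSqrt, Measure.map_add _ _ hq, Measure.map_map hq hs, Measure.map_map hq measurable_neg_sqrt]
  congr 1
  · rw [Measure.map_congr (g := id), Measure.map_id]
    filter_upwards [hae] with y hy
    simp [Real.sq_sqrt hy]
  · rw [Measure.map_congr (g := id), Measure.map_id]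
    filter_upwards [hae] with y hy
    simp [Real.sq_sqrt hy]

open ProbabilityTheory in
/-- A finite measure on `[0, ∞)` is determined by its moments `m_n` if `m_n ≤ A Bⁿ (n!)²`: the
symmetrised law of the square root then has exponential moments. -/
theorem ext_of_moments {μ ν : Measure ℝ} [IsFiniteMeasure μ] [IsFiniteMeasure ν]
    (hμ : μ (Set.Iio 0) = 0) (hν : ν (Set.Iio 0) = 0)
    (h : ∀ n : ℕ, ∫⁻ y, ENNReal.ofReal (y ^ n) ∂μ = ∫⁻ y, ENNReal.ofReal (y ^ n) ∂ν) {A B : ℝ}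
    (hA : 0 ≤ A) (hB : 0 < B)
    (hg : ∀ n : ℕ, ∫⁻ y, ENNReal.ofReal (y ^ n) ∂ν ≤ ENNReal.ofReal (A * B ^ n * n.factorial ^ 2)) :
    μ = ν := by
  have hexp : ∀ ξ, ∫⁻ z, ENNReal.ofReal (Real.exp (ξ * z)) ∂(symmSqrt μ) =
      ∫⁻ z, ENNReal.ofReal (Real.exp (ξ * z)) ∂(symmSqrt ν) := fun ξ => by
    rw [lintegral_exp_symmSqrt hμ, lintegral_exp_symmSqrt hν]
    simp only [h]
  have hmgf : mgf id (symmSqrt μ) = mgf id (symmSqrt ν) := by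
    ext ξ
    have hm : Measurable fun z : ℝ => Real.exp (ξ * z) :=
      (Real.continuous_exp.comp (continuous_const.mul continuous_id)).measurable
    simp only [mgf, id]
    rw [integral_eq_lintegral_of_nonneg_ae
      (Filter.Eventually.of_forall fun _ => (Real.exp_pos _).le) hm.aestronglyMeasurable,
      integral_eq_lintegral_of_nonneg_ae
      (Filter.Eventually.of_forall fun _ => (Real.exp_pos _).le) hm.aestronglyMeasurable]
    exact congrArg _ (hexp ξ)
  have huniv : ∀ ρ : Measure ℝ, symmSqrt ρ = 0 ↔ ρ = 0 := fun ρ => by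
    rw [← Measure.measure_univ_eq_zero, ← Measure.measure_univ_eq_zero (μ := ρ), symmSqrt,
      Measure.add_apply, Measure.map_apply Real.continuous_sqrt.measurable MeasurableSet.univ,
      Measure.map_apply measurable_neg_sqrt MeasurableSet.univ]
    simp
  have h00 : μ = 0 ↔ ν = 0 := by
    have := h 0
    simp only [pow_zero, ENNReal.ofReal_one, lintegral_one] at this
    rw [← Measure.measure_univ_eq_zero, this, Measure.measure_univ_eq_zero]
  have hset : (0 : ℝ) ∈ interior (integrableExpSet id (symmSqrt μ)) := by
    rw [mem_interior]
    refine ⟨Metric.ball 0 (√B)⁻¹, fun ξ hξ => ?_, Metric.isOpen_ball,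
      Metric.mem_ball_self (by positivity)⟩
    have hξ2 : ξ ^ 2 * B < 1 := by
      rw [Metric.mem_ball, dist_zero_right, Real.norm_eq_abs] at hξ
      have h1 : |ξ| * √B < 1 := by
        have hpos : 0 < √B := Real.sqrt_pos.2 hB
        have := mul_lt_mul_of_pos_right hξ hpos
        rwa [inv_mul_cancel₀ hpos.ne'] at this
      have h2 : (|ξ| * √B) ^ 2 < 1 := by
        have : 0 ≤ |ξ| * √B := by positivity
        nlinarith
      rwa [mul_pow, sq_abs, Real.sq_sqrt hB.le] at h2
    have hm : Measurable fun z : ℝ => Real.exp (ξ * z) :=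
      (Real.continuous_exp.comp (continuous_const.mul continuous_id)).measurable
    refine ⟨hm.aestronglyMeasurable, ?_⟩
    rw [hasFiniteIntegral_iff_ofReal (Filter.Eventually.of_forall fun _ => (Real.exp_pos _).le)]
    simp only [id]
    rw [hexp, lintegral_exp_symmSqrt hν]
    have hnn : 0 ≤ ξ ^ 2 * B := by positivity
    have hsum : Summable fun n : ℕ => 2 * A * (ξ ^ 2 * B) ^ n :=
      (summable_geometric_of_lt_one hnn hξ2).mul_left _
    calc _ ≤ ∑' n : ℕ, ENNReal.ofReal (2 * A * (ξ ^ 2 * B) ^ n) := by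
          refine ENNReal.tsum_le_tsum fun n => ?_
          have hx : 0 ≤ ξ ^ (2 * n) := (even_two_mul n).pow_nonneg ξ
          refine (mul_le_mul_right (hg n) _).trans ?_
          rw [← ENNReal.ofReal_mul (by positivity)]
          refine ENNReal.ofReal_le_ofReal ?_
          have hf : ((n.factorial ^ 2 : ℕ) : ℝ) ≤ (2 * n).factorial := by
            have := Nat.factorial_mul_factorial_dvd_factorial_add n n
            rw [← two_mul, ← sq] at this
            exact_mod_cast Nat.le_of_dvd (Nat.factorial_pos _) this
          push_cast at hf
          rw [div_mul_eq_mul_div, div_le_iff₀ (by positivity), pow_mul] at *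
          calc _ = (2 * A * (ξ ^ 2 * B) ^ n) * (n.factorial : ℝ) ^ 2 := by rw [mul_pow]; ring
            _ ≤ _ := by gcongr
      _ = ENNReal.ofReal (∑' n : ℕ, 2 * A * (ξ ^ 2 * B) ^ n) :=
          (ENNReal.ofReal_tsum_of_nonneg (fun n => by positivity) hsum).symm
      _ < ⊤ := ENNReal.ofReal_lt_top
  have hC := eqOn_complexMGF_of_mgf' hmgf (by rw [huniv, huniv, h00])
  have hsym : symmSqrt μ = symmSqrt ν := by
    refine Measure.ext_of_charFun ?_
    ext t
    rw [← complexMGF_id_mul_I, ← complexMGF_id_mul_I]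
    exact hC (by simpa using hset)
  have h2 : μ + μ = ν + ν := by rw [← map_sq_symmSqrt hμ, hsym, map_sq_symmSqrt hν]
  ext S hS
  have := congrArg (fun ρ : Measure ℝ => ρ S) h2
  simp only [Measure.add_apply, ← two_mul] at this
  exact (ENNReal.mul_right_inj two_ne_zero ENNReal.ofNat_ne_top).1 this

theorem exists_abs_phi_le (p R : ℝ) (hR : 0 ≤ R) : ∃ C : ℝ, 0 < C ∧ ∀ (n : ℕ) (x : ℝ), |x| ≤ R →
    |phi p n x| ≤ C ^ n * n.factorial ^ 2 := by
  refine ⟨(|p| + 1) ^ 2 + R, by positivity, fun n x hx => ?_⟩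
  rw [phi, Finset.abs_prod, ← Finset.prod_range_add_one_eq_factorial]
  push_cast
  rw [← Finset.prod_pow]
  calc _ ≤ ∏ k ∈ Finset.range n, ((|p| + 1) ^ 2 + R) * ((k : ℝ) + 1) ^ 2 := by
        refine Finset.prod_le_prod (fun k _ => abs_nonneg _) fun k _ => ?_
        have hk := (Nat.cast_nonneg k : (0 : ℝ) ≤ k)
        have h1 : |p + k| ≤ (|p| + 1) * (k + 1) := by
          refine (abs_add_le _ _).trans ?_
          rw [abs_of_nonneg hk]
          nlinarith [abs_nonneg p]
        have h2 : |(p + k) ^ 2 + x / 4| ≤ |p + k| ^ 2 + |x| := by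
          refine (abs_add_le _ _).trans ?_
          rw [abs_pow, abs_div, abs_of_pos (four_pos (α := ℝ))]
          linarith [abs_nonneg x]
        have h3 : |p + k| ^ 2 ≤ ((|p| + 1) * (k + 1)) ^ 2 := by gcongr
        have h4 : 1 ≤ ((k : ℝ) + 1) ^ 2 := by nlinarith
        nlinarith
    _ = _ := by simp [Finset.prod_mul_distrib]

theorem abs_pochR_le (x : ℝ) (n : ℕ) : |pochR x n| ≤ (|x| + 1) ^ n * n.factorial := by
  rw [pochR_eq_prod, Finset.abs_prod, ← Finset.prod_range_add_one_eq_factorial]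
  push_cast
  calc _ ≤ ∏ k ∈ Finset.range n, (|x| + 1) * ((k : ℝ) + 1) := by
        refine Finset.prod_le_prod (fun k _ => abs_nonneg _) fun k _ => ?_
        have hk := (Nat.cast_nonneg k : (0 : ℝ) ≤ k)
        refine (abs_add_le _ _).trans ?_
        rw [abs_of_nonneg hk]
        nlinarith [abs_nonneg x]
    _ = _ := by simp [Finset.prod_mul_distrib]

/-- Powers of `x + K` in the basis `phi p`. -/
theorem exists_pow_eq_sum_phi (p K : ℝ) (n : ℕ) : ∃ c : ℕ → ℝ, ∀ x,
    (x + K) ^ n = ∑ k ∈ Finset.range (n + 1), c k * phi p k x := by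
  induction n with
  | zero => exact ⟨fun _ => 1, fun x => by simp [phi]⟩
  | succ n ih =>
    obtain ⟨c, hc⟩ := ih
    refine ⟨fun k => (if k = 0 then 0 else 4 * c (k - 1)) +
      (if k = n + 1 then 0 else (K - 4 * (p + k) ^ 2) * c k), fun x => ?_⟩
    rw [pow_succ, hc, Finset.sum_mul]
    simp only [add_mul, Finset.sum_add_distrib]
    rw [Finset.sum_range_succ' _ (n + 1)]
    conv_rhs => rw [Finset.sum_range_succ _ (n + 1)]
    simp only [Nat.add_eq_zero_iff, one_ne_zero, and_false, if_false, Nat.add_sub_cancel, if_true,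
      zero_mul, add_zero]
    rw [← Finset.sum_add_distrib]
    refine Finset.sum_congr rfl fun k hk => ?_
    rw [if_neg (Finset.mem_range.1 hk).ne, phi_succ]
    ring

/-- The numbers `M n` grow at most like `Bⁿ (n!)²`, as the moments in the basis `phi p` do. -/
def MomentGrowth (M : ℕ → ℝ) : Prop :=
  ∃ A B : ℝ, 0 ≤ A ∧ 0 ≤ B ∧ ∀ n : ℕ, |M n| ≤ A * B ^ n * n.factorial ^ 2

theorem HasMoments.isFiniteMeasure {μ : Measure ℝ} {p : ℝ} {M : ℕ → ℝ} (h : HasMoments μ p M) :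
    IsFiniteMeasure μ := by
  have := h.1 0
  simp only [pow_zero] at this
  rw [integrable_const_iff] at this
  exact this.resolve_left one_ne_zero

theorem HasMoments.integral_sum {μ : Measure ℝ} {p : ℝ} {M : ℕ → ℝ} (h : HasMoments μ p M)
    (c : ℕ → ℝ) (n : ℕ) : ∫ x, ∑ k ∈ Finset.range n, c k * phi p k x ∂μ =
      ∑ k ∈ Finset.range n, c k * M k := by
  rw [integral_finsetSum _ fun k _ => (integrable_phi h.1 p k).const_mul _]
  simp only [integral_const_mul, h.2]

theorem HasMoments.integrable_pow_add {μ : Measure ℝ} {p : ℝ} {M : ℕ → ℝ} (h : HasMoments μ p M)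
    (K : ℝ) (n : ℕ) : Integrable (fun x => (x + K) ^ n) μ := by
  refine (integrable_eval h.1 ((Polynomial.X + Polynomial.C K) ^ n)).congr
    (Filter.Eventually.of_forall fun x => ?_)
  simp

/-- The growth of the moments in the basis `phi p` passes to powers. Beyond `K + 1` the power `(x + K)ⁿ`
is at most `8ⁿ phi p n x`; below, both are bounded explicitly. -/
theorem HasMoments.exists_integral_pow_le {ν : Measure ℝ} {p : ℝ} {M : ℕ → ℝ}
    (h : HasMoments ν p M) (hM : MomentGrowth M) {K : ℝ} (hK : 0 ≤ K) (hν : ∀ᵐ x ∂ν, -K ≤ x) :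
    ∃ A B : ℝ, 0 ≤ A ∧ 0 < B ∧ ∀ n : ℕ, ∫ x, (x + K) ^ n ∂ν ≤ A * B ^ n * n.factorial ^ 2 := by
  obtain ⟨A, B, hA, hB, hAB⟩ := hM
  obtain ⟨C, hC, hCb⟩ := exists_abs_phi_le p (K + 1) (by linarith)
  have := h.isFiniteMeasure
  set D : ℝ := 8 * B + 8 * C + (2 * K + 1) with hD
  set m : ℝ := ν.real Set.univ
  have hm : 0 ≤ m := measureReal_nonneg
  refine ⟨A + 2 * m, D, by positivity, by positivity, fun n => ?_⟩
  have hle : ∫ x, (x + K) ^ n ∂ν ≤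
      ∫ x, (8 ^ n * phi p n x + ((2 * K + 1) ^ n + 8 ^ n * (C ^ n * n.factorial ^ 2))) ∂ν := by
    refine integral_mono_ae (h.integrable_pow_add K n)
      (((integrable_phi h.1 p n).const_mul _).add (integrable_const _)) ?_
    filter_upwards [hν] with x hx
    by_cases hx1 : x ≤ K + 1
    · have h1 := (abs_le.1 (hCb n x (abs_le.2 ⟨by linarith, hx1⟩))).1
      have h2 : (x + K) ^ n ≤ (2 * K + 1) ^ n := pow_le_pow_left₀ (by linarith) (by linarith) n
      have h3 : (0 : ℝ) ≤ 8 ^ n * (phi p n x + C ^ n * n.factorial ^ 2) :=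
        mul_nonneg (by positivity) (by linarith)
      linarith
    · have h1 : (x + K) ^ n ≤ 8 ^ n * phi p n x := by
        rw [phi, ← Finset.card_range n, ← Finset.prod_const, ← Finset.prod_const,
          Finset.card_range, ← Finset.prod_mul_distrib]
        refine Finset.prod_le_prod (fun k _ => by linarith) fun k _ => ?_
        nlinarith [sq_nonneg (p + k)]
      have : (0 : ℝ) ≤ (2 * K + 1) ^ n + 8 ^ n * (C ^ n * n.factorial ^ 2) := by positivity
      linarith
  refine hle.trans ?_
  rw [integral_add ((integrable_phi h.1 p n).const_mul _) (integrable_const _), integral_const_mul,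
    h.2, integral_const, smul_eq_mul]
  have hf : (1 : ℝ) ≤ (n.factorial : ℝ) ^ 2 := by
    have : (1 : ℝ) ≤ n.factorial := by exact_mod_cast n.factorial_pos
    nlinarith
  have h1 : 8 ^ n * M n ≤ A * D ^ n * n.factorial ^ 2 := by
    calc 8 ^ n * M n ≤ 8 ^ n * (A * B ^ n * n.factorial ^ 2) := by
          gcongr; exact (le_abs_self _).trans (hAB n)
      _ = A * (8 * B) ^ n * n.factorial ^ 2 := by rw [mul_pow]; ring
      _ ≤ _ := by gcongr; linarith
  have h2 : (2 * K + 1) ^ n ≤ D ^ n * n.factorial ^ 2 := by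
    calc (2 * K + 1) ^ n ≤ D ^ n * 1 := by rw [mul_one]; gcongr; linarith
      _ ≤ _ := by gcongr
  have h3 : 8 ^ n * (C ^ n * n.factorial ^ 2) ≤ D ^ n * n.factorial ^ 2 := by
    rw [← mul_assoc, ← mul_pow]; gcongr; linarith
  calc _ ≤ A * D ^ n * n.factorial ^ 2 + m * (D ^ n * n.factorial ^ 2 + D ^ n * n.factorial ^ 2) := by
        gcongr
    _ = _ := by ring

theorem HasMoments.lintegral_pow_add {μ : Measure ℝ} {p : ℝ} {M : ℕ → ℝ} (h : HasMoments μ p M)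
    {K : ℝ} (hμ : ∀ᵐ x ∂μ, -K ≤ x) {c : ℕ → ℝ} {n : ℕ}
    (hc : ∀ x, (x + K) ^ n = ∑ k ∈ Finset.range (n + 1), c k * phi p k x) :
    ∫⁻ x, ENNReal.ofReal ((x + K) ^ n) ∂μ =
      ENNReal.ofReal (∑ k ∈ Finset.range (n + 1), c k * M k) := by
  rw [← ofReal_integral_eq_lintegral_ofReal (h.integrable_pow_add K n) (by
    filter_upwards [hμ] with x hx
    exact pow_nonneg (by linarith) n)]
  simp only [hc, h.integral_sum]

/-- A kernel that maps `phi p` to `phi q` sends measures with moments `M` in the basis `phi q` to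
measures with the same moments in the basis `phi p`. -/
theorem bind_eq_of_hasMoments {μ ν : Measure ℝ} {κ : ℝ → Measure ℝ} (hκ : Measurable κ) {S : Set ℝ}
    {p q K : ℝ} (hK : 0 ≤ K) {M : ℕ → ℝ} (hM : MomentGrowth M) (hS : ∀ᵐ r ∂μ, r ∈ S)
    (hμ : HasMoments μ q M) (hν : HasMoments ν p M) (hνK : ∀ᵐ x ∂ν, -K ≤ x)
    (hκm : ∀ r ∈ S, HasMoments (κ r) p fun n => phi q n r) (hκK : ∀ r ∈ S, ∀ᵐ x ∂(κ r), -K ≤ x) :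
    μ.bind κ = ν := by
  have hfin := hν.isFiniteMeasure
  have hsh : Measurable fun x : ℝ => x + K := by fun_prop
  have hmom : ∀ n : ℕ, ∫⁻ x, ENNReal.ofReal ((x + K) ^ n) ∂(μ.bind κ) =
      ∫⁻ x, ENNReal.ofReal ((x + K) ^ n) ∂ν := by
    intro n
    obtain ⟨c, hc⟩ := exists_pow_eq_sum_phi p K n
    -- integrating the nonnegative combinations of the `phi p k` that give powers avoids all questions
    -- of integrability against `μ.bind κ`
    rw [Measure.lintegral_bind hκ.aemeasurable (by fun_prop), hν.lintegral_pow_add hνK hc]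
    have e : ∀ᵐ r ∂μ, ∫⁻ x, ENNReal.ofReal ((x + K) ^ n) ∂(κ r) =
        ENNReal.ofReal (∑ k ∈ Finset.range (n + 1), c k * phi q k r) := by
      filter_upwards [hS] with r hr
      exact (hκm r hr).lintegral_pow_add (hκK r hr) hc
    have hpos : ∀ᵐ r ∂μ, 0 ≤ ∑ k ∈ Finset.range (n + 1), c k * phi q k r := by
      filter_upwards [hS] with r hr
      rw [← (hκm r hr).integral_sum]
      refine integral_nonneg_of_ae ?_
      filter_upwards [hκK r hr] with x hx
      rw [← hc]
      exact pow_nonneg (by linarith) n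
    rw [lintegral_congr_ae e, ← ofReal_integral_eq_lintegral_ofReal (integrable_finsetSum _ fun k _ =>
      (integrable_phi hμ.1 q k).const_mul _) hpos, hμ.integral_sum]
  have hbfin : IsFiniteMeasure (μ.bind κ) := ⟨by
    have := hmom 0
    simp only [pow_zero, ENNReal.ofReal_one, lintegral_one] at this
    rw [this]
    exact measure_lt_top _ _⟩
  have hbK : ∀ᵐ x ∂(μ.bind κ), -K ≤ x := by
    have hms : MeasurableSet {x : ℝ | ¬ -K ≤ x} := (measurableSet_le measurable_const measurable_id).compl
    rw [ae_iff, Measure.bind_apply hms hκ.aemeasurable]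
    refine (lintegral_eq_zero_iff ((Measure.measurable_coe hms).comp hκ)).2 ?_
    filter_upwards [hS] with r hr
    exact ae_iff.1 (hκK r hr)
  obtain ⟨A, B, hA, hB, hAB⟩ := hν.exists_integral_pow_le hM hK hνK
  have hneg : ∀ ρ : Measure ℝ, (∀ᵐ x ∂ρ, -K ≤ x) → ρ.map (fun x => x + K) (Set.Iio 0) = 0 := by
    intro ρ hρ
    rw [Measure.map_apply hsh measurableSet_Iio]
    rw [ae_iff] at hρ
    convert hρ using 2
    ext x
    simp [lt_neg_iff_add_neg]
  have hmap : (μ.bind κ).map (fun x => x + K) = ν.map fun x => x + K := by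
    refine ext_of_moments (hneg _ hbK) (hneg _ hνK) (fun n => ?_) hA hB fun n => ?_
    · rw [lintegral_map (by fun_prop) hsh, lintegral_map (by fun_prop) hsh, hmom]
    · rw [lintegral_map (by fun_prop) hsh, ← ofReal_integral_eq_lintegral_ofReal
        (hν.integrable_pow_add K n) (by
        filter_upwards [hνK] with x hx
        exact pow_nonneg (by linarith) n)]
      exact ENNReal.ofReal_le_ofReal (hAB n)
  have hback := congrArg (fun ρ : Measure ℝ => ρ.map fun x => x - K) hmap
  have hsh' : Measurable fun x : ℝ => x - K := by fun_prop
  have hid : (fun x : ℝ => x - K) ∘ (fun x => x + K) = id := by ext x; simp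
  simpa only [Measure.map_map hsh' hsh, hid, Measure.map_id] using hback

/-! ### The transition measures -/

theorem index_eq_of_sq_eq {p : ℝ} {i j : ℕ} (hi : p + i ≤ 0) (hj : p + j ≤ 0)
    (h : (p + i) ^ 2 = (p + j) ^ 2) : i = j := by
  rcases sq_eq_sq_iff_eq_or_eq_neg.1 h with h | h
  · exact_mod_cast (by linarith : (i : ℝ) = j)
  · exact_mod_cast (by linarith : (i : ℝ) = j)

theorem xU_eq (u s : ℝ) (j : ℕ) : xU u s j = -4 * (u - s / 2 + j) ^ 2 := by rw [xU]; ring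

theorem xV_eq (v s : ℝ) (j : ℕ) : xV v s j = -4 * (v + s / 2 + j) ^ 2 := by rw [xV]; ring

theorem xU_nonpos (u s : ℝ) (j : ℕ) : xU u s j ≤ 0 := by
  rw [xU]; nlinarith [sq_nonneg (u + j - s / 2)]

theorem xV_nonpos (v s : ℝ) (j : ℕ) : xV v s j ≤ 0 := by
  rw [xV]; nlinarith [sq_nonneg (v + j + s / 2)]

theorem add_nonpos_of_le_floor {x : ℝ} (hx : x < 0) {j : ℕ} {y : ℝ} (hy : y = -x)
    (hj : j ≤ ⌊y⌋₊) : x + j ≤ 0 := by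
  have := (Nat.le_floor_iff (by linarith)).1 hj
  linarith

theorem le_floor_of_add_nonpos {x y : ℝ} (hy : y = -x) {j : ℕ} (hj : x + j ≤ 0) : j ≤ ⌊y⌋₊ :=
  Nat.le_floor (by linarith)

/-- The parameters `b` (and, conjugated, `c`) of the transition measure from `m > 0`. -/
noncomputable def pairB (s t m : ℝ) : ℂ := ((t - s) / 2 : ℝ) + Complex.I * (√m / 2 : ℝ)

/-- The conjugate of `pairB`. -/
noncomputable def pairC (s t m : ℝ) : ℂ := ((t - s) / 2 : ℝ) - Complex.I * (√m / 2 : ℝ)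

theorem transition_of_pos (u v s t : ℝ) {m : ℝ} (hm : 0 < m) :
    transition u v s t m = cdh (u - t / 2) (pairB s t m) (pairC s t m) (xU u t) := by
  have h1 : ∀ j, m ≠ xU u s j := fun j => (lt_of_le_of_lt (xU_nonpos u s j) hm).ne'
  have h2 : ∀ j, m ≠ xV v s j := fun j => (lt_of_le_of_lt (xV_nonpos v s j) hm).ne'
  simp [transition, hm, h1, h2, pairB, pairC]

theorem transition_xU {u v s : ℝ} (t : ℝ) (huv : 0 < u + v) (hu : u - s / 2 < 0) {j : ℕ}
    (hj : u - s / 2 + j ≤ 0) : transition u v s t (xU u s j) =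
      cdh (u - t / 2) (-u + t / 2 - j : ℝ) (u + t / 2 - s + j : ℝ) (xU u t) := by
  have hv : ¬ v + s / 2 < 0 := by linarith
  rw [transition, if_neg (not_lt.2 (xU_nonpos u s j)), if_pos hu, if_neg hv, zero_add, add_zero,
    Finset.sum_eq_single j]
  · rw [if_pos rfl]
  · intro i hi hij
    rw [if_neg fun h => hij ?_]
    rw [xU_eq, xU_eq] at h
    exact (index_eq_of_sq_eq hj (add_nonpos_of_le_floor hu (by ring)
      (Nat.lt_succ_iff.1 (Finset.mem_range.1 hi))) (by linarith)).symm
  · intro h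
    exact absurd (Finset.mem_range.2 (Nat.lt_succ_iff.2 (le_floor_of_add_nonpos (by ring) hj))) h

theorem transition_xV {u v s : ℝ} (t : ℝ) (huv : 0 < u + v) (hv : v + s / 2 < 0) {j : ℕ}
    (hj : v + s / 2 + j ≤ 0) : transition u v s t (xV v s j) =
      cdh (v + j + t / 2) (t / 2 - s - v - j : ℝ) (u - t / 2 : ℝ) (fun i => xV v t (j + i)) := by
  have hu : ¬ u - s / 2 < 0 := by linarith
  rw [transition, if_neg (not_lt.2 (xV_nonpos v s j)), if_neg hu, if_pos hv, zero_add, zero_add,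
    Finset.sum_eq_single j]
  · rw [if_pos rfl]
  · intro i hi hij
    rw [if_neg fun h => hij ?_]
    rw [xV_eq, xV_eq] at h
    exact (index_eq_of_sq_eq hj (add_nonpos_of_le_floor hv (by ring)
      (Nat.lt_succ_iff.1 (Finset.mem_range.1 hi))) (by linarith)).symm
  · intro h
    exact absurd (Finset.mem_range.2 (Nat.lt_succ_iff.2 (le_floor_of_add_nonpos (by ring) hj))) h

theorem supp_cases {u v s m : ℝ} (h : m ∈ supp u v s) : 0 < m ∨
    (u - s / 2 < 0 ∧ ∃ j : ℕ, u - s / 2 + j ≤ 0 ∧ m = xU u s j) ∨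
    (v + s / 2 < 0 ∧ ∃ j : ℕ, v + s / 2 + j ≤ 0 ∧ m = xV v s j) := by
  rcases h with (h | ⟨hu, j, hj, rfl⟩) | ⟨hv, j, hj, rfl⟩
  · exact Or.inl h
  · exact Or.inr (Or.inl ⟨hu, j, add_nonpos_of_le_floor hu (by ring) hj, rfl⟩)
  · exact Or.inr (Or.inr ⟨hv, j, add_nonpos_of_le_floor hv (by ring) hj, rfl⟩)

theorem xU_mem_supp {u v s : ℝ} {j : ℕ} (hj : u - s / 2 + j < 0) : xU u s j ∈ supp u v s :=
  Or.inl (Or.inr ⟨by linarith [(Nat.cast_nonneg j : (0 : ℝ) ≤ j)], j,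
    le_floor_of_add_nonpos (by ring) hj.le, rfl⟩)

theorem xV_mem_supp {u v s : ℝ} {j : ℕ} (hj : v + s / 2 + j < 0) : xV v s j ∈ supp u v s :=
  Or.inr ⟨by linarith [(Nat.cast_nonneg j : (0 : ℝ) ≤ j)], j,
    le_floor_of_add_nonpos (by ring) hj.le, rfl⟩

theorem transition_of_notMem {u v s t m : ℝ} (h : m ∉ supp u v s) : transition u v s t m = 0 := by
  simp only [supp, Set.mem_union, not_or, atomsU, atomsV, Set.mem_ofPred_eq, not_and, not_exists,
    Set.mem_Ioi] at h
  obtain ⟨⟨h1, h2⟩, h3⟩ := h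
  rw [transition, if_neg h1, zero_add]
  have e2 : (if u - s / 2 < 0 then ∑ j ∈ Finset.range (⌊-u + s / 2⌋₊ + 1), if m = xU u s j then
      cdh (u - t / 2) (-u + t / 2 - j : ℝ) (u + t / 2 - s + j : ℝ) (xU u t) else 0 else 0) = 0 := by
    split_ifs with hu
    · exact Finset.sum_eq_zero fun j hj =>
        if_neg (h2 hu j (Nat.lt_succ_iff.1 (Finset.mem_range.1 hj)))
    · rfl
  have e3 : (if v + s / 2 < 0 then ∑ j ∈ Finset.range (⌊-v - s / 2⌋₊ + 1), if m = xV v s j then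
      cdh (v + j + t / 2) (t / 2 - s - v - j : ℝ) (u - t / 2 : ℝ) (fun i => xV v t (j + i))
      else 0 else 0) = 0 := by
    split_ifs with hv
    · exact Finset.sum_eq_zero fun j hj =>
        if_neg (h3 hv j (Nat.lt_succ_iff.1 (Finset.mem_range.1 hj)))
    · rfl
  rw [e2, e3, add_zero]

theorem admissible_pair (a : ℝ) {s t m : ℝ} (hst : s < t) (hm : 0 < m) :
    Admissible a (pairB s t m) (pairC s t m) := by
  refine Or.inl ⟨?_, ?_, ?_⟩
  · rw [pairB, pairC, map_add, map_mul, Complex.conj_ofReal, Complex.conj_ofReal, Complex.conj_I]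
    ring
  · have : 0 < √m := Real.sqrt_pos.2 hm
    simp only [pairB, Complex.add_im, Complex.ofReal_im, Complex.mul_im, Complex.I_re, Complex.I_im,
      Complex.ofReal_re]
    positivity
  · simp only [pairB, Complex.add_re, Complex.ofReal_re, Complex.mul_re, Complex.I_re, Complex.I_im,
      Complex.ofReal_im]
    linarith

theorem poch_mul_poch_eq_phi {z₁ z₂ : ℂ} {p x : ℝ}
    (h : ∀ k : ℕ, (z₁ + k) * (z₂ + k) = (((p + k) ^ 2 + x / 4 : ℝ) : ℂ)) (n : ℕ) :
    poch z₁ n * poch z₂ n = (phi p n x : ℂ) := by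
  rw [poch_eq_prod, poch_eq_prod, ← Finset.prod_mul_distrib, phi, Complex.ofReal_prod]
  exact Finset.prod_congr rfl fun k _ => h k

theorem ofReal_pochR (x : ℝ) (n : ℕ) : (pochR x n : ℂ) = poch x n := by
  rw [pochR_eq_prod, poch_eq_prod]
  push_cast
  rfl

/-- The bound on the time window ensures that `u - t/2` is positive at the times when the atoms
`x^v_j` occur. -/
theorem sub_half_pos_of_lt_timeBound {u v s t : ℝ} (huv : 0 < u + v) (hs : 0 ≤ s)
    (ht : t < timeBound u) (hv : v + s / 2 < 0) : 0 < u - t / 2 := by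
  rw [timeBound] at ht
  split_ifs at ht with h
  · rcases h with h | h <;> linarith
  · linarith

theorem admissible_of_xV {u v s t : ℝ} (huv : 0 < u + v) (hs : 0 ≤ s) (hst : s < t)
    (ht : t < timeBound u) (hv : v + s / 2 < 0) {j : ℕ} (hj : v + s / 2 + j ≤ 0) :
    Admissible (v + j + t / 2) (t / 2 - s - v - j : ℝ) (u - t / 2 : ℝ) := by
  have := sub_half_pos_of_lt_timeBound huv hs ht hv
  have := (Nat.cast_nonneg j : (0 : ℝ) ≤ j)
  exact Or.inr ⟨⟨Complex.ofReal_im _, Complex.ofReal_im _⟩, by rw [Complex.ofReal_re]; linarith,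
    by rw [Complex.ofReal_re]; linarith, by rw [Complex.ofReal_re]; linarith,
    by rw [Complex.ofReal_re]; linarith⟩

theorem terminating_of_xU {u s t : ℝ} (hst : s < t) {j : ℕ} (hj : u - s / 2 + j ≤ 0) :
    Terminating (u - t / 2) (-u + t / 2 - j) (u + t / 2 - s + j) j :=
  ⟨by ring, by linarith, by linarith, by linarith⟩

/-- The transition measures map `phi (u - t/2) n` to `phi (u - s/2) n`. From `x^v_j(s)` the parameter
`u - t/2` is the third one, and the symmetry of the moments is needed. -/
theorem hasMoments_transition {u v s t : ℝ} (huv : 0 < u + v) (hs : 0 ≤ s) (hst : s < t)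
    (ht : t < timeBound u) {m : ℝ} (hm : m ∈ supp u v s) :
    HasMoments (transition u v s t m) (u - t / 2) fun n => phi (u - s / 2) n m := by
  rcases supp_cases hm with hm | ⟨hu, j, hj, rfl⟩ | ⟨hv, j, hj, rfl⟩
  · rw [transition_of_pos u v s t hm]
    refine hasMoments_cdh (admissible_pair _ hst hm) (fun j => by rw [xU_eq])
      (poch_mul_poch_eq_phi fun k => ?_)
    have hsq : ((√m : ℝ) : ℂ) ^ 2 = m := by exact_mod_cast Real.sq_sqrt hm.le
    rw [pairB, pairC]
    push_cast
    linear_combination (-(√m : ℂ) ^ 2 / 4) * Complex.I_sq + (1 / 4 : ℂ) * hsq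
  · rw [transition_xU t huv hu hj]
    refine (terminating_of_xU hst hj).hasMoments_cdh (fun j => by rw [xU_eq])
      (poch_mul_poch_eq_phi fun k => ?_)
    rw [xU]
    push_cast
    ring
  · rw [transition_xV t huv hv hj]
    have h := hasMoments_cdh (admissible_of_xV huv hs hst ht hv hj)
      (pts := fun i => xV v t (j + i)) (fun i => by rw [xV]; push_cast; ring)
      (M := fun n => pochR (v + j + t / 2 + (t / 2 - s - v - j)) n *
        pochR (v + j + t / 2 + (u - t / 2)) n) fun n => by
          push_cast [ofReal_pochR]; rfl
    refine ⟨h.1, fun n => ?_⟩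
    refine (h.swap.2 n).trans ?_
    simp only [pochR_eq_prod, ← Finset.prod_mul_distrib, phi]
    refine Finset.prod_congr rfl fun k _ => ?_
    rw [xV]
    ring

theorem transition_compl_supp {u v s t : ℝ} (huv : 0 < u + v) (hs : 0 ≤ s) (hst : s < t)
    (ht : t < timeBound u) {m : ℝ} (hm : m ∈ supp u v s) :
    transition u v s t m (supp u v t)ᶜ = 0 := by
  have hcont : ∀ (a : ℝ) (b c : ℂ), contMeasure a b c (supp u v t)ᶜ = 0 := fun a b c =>
    measure_mono_null (Set.compl_subset_compl.2 fun x hx => Or.inl (Or.inl hx))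
      (contMeasure_compl_Ioi a b c)
  rcases supp_cases hm with hm | ⟨hu, j, hj, rfl⟩ | ⟨hv, j, hj, rfl⟩
  · rw [transition_of_pos u v s t hm, cdh_of_admissible (admissible_pair _ hst hm)
      (fun j => by rw [xU_eq]), Measure.add_apply, hcont, zero_add]
    refine atomMeasure_eq_zero fun i hi => ?_
    have := Nat.lt_ceil.1 hi
    rw [← xU_eq]
    exact xU_mem_supp (by linarith)
  · rw [transition_xU t huv hu hj, (terminating_of_xU hst hj).cdh_eq (fun j => by rw [xU_eq])]
    refine atomMeasure_eq_zero fun i hi => ?_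
    have : (i : ℝ) ≤ j := by exact_mod_cast Nat.lt_succ_iff.1 hi
    rw [← xU_eq]
    exact xU_mem_supp (by linarith)
  · rw [transition_xV t huv hv hj, cdh_of_admissible (admissible_of_xV huv hs hst ht hv hj)
      (fun i => by rw [xV]; push_cast; ring), Measure.add_apply, hcont, zero_add]
    refine atomMeasure_eq_zero fun i hi => ?_
    have := Nat.lt_ceil.1 hi
    have e : -4 * (v + j + t / 2 + i) ^ 2 = xV v t (j + i) := by rw [xV]; push_cast; ring
    rw [e]
    exact xV_mem_supp (by push_cast; linarith)

theorem isProbabilityMeasure_transition {u v s t : ℝ} (huv : 0 < u + v) (hs : 0 ≤ s) (hst : s < t)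
    (ht : t < timeBound u) {m : ℝ} (hm : m ∈ supp u v s) :
    IsProbabilityMeasure (transition u v s t m) := by
  have h := hasMoments_transition huv hs hst ht hm
  have hf := h.isFiniteMeasure
  have h0 := h.2 0
  simp only [phi_zero] at h0
  rw [integral_const, smul_eq_mul, mul_one] at h0
  refine ⟨?_⟩
  rwa [measureReal_def, ENNReal.toReal_eq_one_iff] at h0

/-- A lower bound for the supports. -/
theorem neg_le_of_mem_supp {u v t x : ℝ} (hx : x ∈ supp u v t) :
    -(4 * (u - t / 2) ^ 2 + 4 * (v + t / 2) ^ 2) ≤ x := by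
  rcases supp_cases hx with hx | ⟨hu, j, hj, rfl⟩ | ⟨hv, j, hj, rfl⟩
  · nlinarith [sq_nonneg (u - t / 2), sq_nonneg (v + t / 2)]
  · rw [xU_eq]
    have := (Nat.cast_nonneg j : (0 : ℝ) ≤ j)
    nlinarith [sq_nonneg (v + t / 2)]
  · rw [xV_eq]
    have := (Nat.cast_nonneg j : (0 : ℝ) ≤ j)
    nlinarith [sq_nonneg (u - t / 2)]

theorem ae_neg_le {u v t : ℝ} {ρ : Measure ℝ} (h : ρ (supp u v t)ᶜ = 0) :
    ∀ᵐ x ∂ρ, -(4 * (u - t / 2) ^ 2 + 4 * (v + t / 2) ^ 2) ≤ x := by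
  have : ∀ᵐ x ∂ρ, x ∈ supp u v t := h
  filter_upwards [this] with x hx using neg_le_of_mem_supp hx

theorem measurable_Gamma_comp {α : Type*} [MeasurableSpace α] {f : α → ℂ} (hf : Measurable f) :
    Measurable fun x => Complex.Gamma (f x) := measurable_Gamma.comp hf

theorem measurable_poch_comp {α : Type*} [MeasurableSpace α] {f : α → ℂ} (hf : Measurable f) (n : ℕ) :
    Measurable fun x => poch (f x) n := by
  simp only [poch_eq_prod]
  fun_prop

theorem measurable_contMeasure (a : ℝ) {B C : ℝ → ℂ} (hB : Measurable B) (hC : Measurable C) :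
    Measurable fun m => contMeasure a (B m) (C m) := by
  refine Measure.measurable_of_measurable_coe _ fun S hS => ?_
  simp only [contMeasure, withDensity_apply _ hS]
  have hs : Measurable fun q : ℝ × ℝ => √q.2 := Real.continuous_sqrt.measurable.comp measurable_snd
  have hj : Measurable fun q : ℝ × ℝ => ENNReal.ofReal (cdhDensity a (B q.1) (C q.1) q.2) := by
    refine Measurable.ennreal_ofReal ?_
    unfold cdhDensity
    refine Measurable.ite (measurableSet_lt measurable_const measurable_snd) ?_ measurable_const
    have hB' : Measurable fun q : ℝ × ℝ => B q.1 := hB.comp measurable_fst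
    have hC' : Measurable fun q : ℝ × ℝ => C q.1 := hC.comp measurable_fst
    have hI : Measurable fun q : ℝ × ℝ => Complex.I * ((√q.2 / 2 : ℝ) : ℂ) :=
      (Complex.measurable_ofReal.comp (hs.div_const 2)).const_mul _
    have hI2 : Measurable fun q : ℝ × ℝ => Complex.I * ((√q.2 : ℝ) : ℂ) :=
      (Complex.measurable_ofReal.comp hs).const_mul _
    have ha : Measurable fun _ : ℝ × ℝ => (a : ℂ) := measurable_const
    refine Measurable.const_mul (Measurable.div ?_ ?_) _
    · exact (((measurable_Gamma_comp (ha.add hI)).mul (measurable_Gamma_comp (hB'.add hI))).mul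
        (measurable_Gamma_comp (hC'.add hI))).norm.pow_const 2
    · exact ((Complex.measurable_re.comp (((measurable_Gamma_comp (ha.add hB')).mul
        (measurable_Gamma_comp (ha.add hC'))).mul (measurable_Gamma_comp (hB'.add hC')))).mul
        hs).mul ((measurable_Gamma_comp hI2).norm.pow_const 2)
  exact hj.lintegral_prod_right'

theorem measurable_cdhMass (a : ℝ) {B C : ℝ → ℂ} (hB : Measurable B) (hC : Measurable C) (j : ℕ) :
    Measurable fun m => cdhMass a (B m) (C m) j := by
  have hab := measurable_poch_comp (hB.const_add (a : ℂ)) j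
  have hac := measurable_poch_comp (hC.const_add (a : ℂ)) j
  have hab' := measurable_poch_comp ((hB.const_sub (a : ℂ)).add_const 1) j
  have hac' := measurable_poch_comp ((hC.const_sub (a : ℂ)).add_const 1) j
  have g1 := measurable_Gamma_comp (hB.sub_const (a : ℂ))
  have g2 := measurable_Gamma_comp (hC.sub_const (a : ℂ))
  have g3 := measurable_Gamma_comp (hB.add hC)
  unfold cdhMass
  refine Complex.measurable_re.comp (Measurable.mul_const (Measurable.div ?_ ?_) _)
  · exact (((((hab.const_mul _).mul hac).mul_const _).mul g1).mul g2)
  · exact (((((hab'.const_mul _).mul hac').mul_const _).mul_const _).mul g3)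

theorem measurable_atomMeasure (a : ℝ) {B C : ℝ → ℂ} (hB : Measurable B) (hC : Measurable C)
    (n : ℕ) : Measurable fun m => atomMeasure a (B m) (C m) n := by
  refine Measure.measurable_of_measurable_coe _ fun S hS => ?_
  simp only [atomMeasure, Measure.finsetSum_apply, Measure.smul_apply, smul_eq_mul]
  exact Finset.measurable_fun_sum _ fun j _ =>
    (measurable_cdhMass a hB hC j).ennreal_ofReal.mul_const _

theorem measurable_transition (u v : ℝ) {s t : ℝ} (hst : s < t) :
    Measurable (transition u v s t) := by
  have hs : Measurable fun m : ℝ => √m := Real.continuous_sqrt.measurable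
  have hI : Measurable fun m : ℝ => Complex.I * ((√m / 2 : ℝ) : ℂ) :=
    (Complex.measurable_ofReal.comp (hs.div_const 2)).const_mul _
  have hB : Measurable (pairB s t) := hI.const_add _
  have hC : Measurable (pairC s t) := hI.const_sub _
  unfold transition
  refine Measurable.add (Measurable.add ?_ ?_) ?_
  · have e : (fun m : ℝ => if 0 < m then
        cdh (u - t / 2) (((t - s) / 2 : ℝ) + Complex.I * (√m / 2 : ℝ))
          (((t - s) / 2 : ℝ) - Complex.I * (√m / 2 : ℝ)) (xU u t) else 0) =
        fun m => if 0 < m then contMeasure (u - t / 2) (pairB s t m) (pairC s t m) +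
          atomMeasure (u - t / 2) (pairB s t m) (pairC s t m) ⌈-(u - t / 2)⌉₊ else 0 := by
      ext1 m
      split_ifs with hm
      · exact cdh_of_admissible (admissible_pair _ hst hm) fun j => by rw [xU_eq]
      · rfl
    rw [e]
    exact Measurable.ite measurableSet_Ioi ((measurable_contMeasure _ hB hC).add
      (measurable_atomMeasure _ hB hC _)) measurable_const
  · split_ifs
    · exact Finset.measurable_fun_sum _ fun j _ =>
        Measurable.ite (measurableSet_singleton _) measurable_const measurable_const
    · exact measurable_const
  · split_ifs
    · exact Finset.measurable_fun_sum _ fun j _ =>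
        Measurable.ite (measurableSet_singleton _) measurable_const measurable_const
    · exact measurable_const

theorem momentGrowth_phi (p x : ℝ) : MomentGrowth fun n => phi p n x := by
  obtain ⟨C, hC, h⟩ := exists_abs_phi_le p |x| (abs_nonneg x)
  exact ⟨1, C, zero_le_one, hC.le, fun n => by rw [one_mul]; exact h n x le_rfl⟩

/-- The Chapman-Kolmogorov equation. -/
theorem lintegral_transition {u v s t w : ℝ} (huv : 0 < u + v) (hs : 0 ≤ s) (hst : s < t)
    (htw : t < w) (hw : w < timeBound u) (m : ℝ) {V : Set ℝ} (hV : MeasurableSet V) :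
    ∫⁻ r, transition u v t w r V ∂(transition u v s t m) = transition u v s w m V := by
  by_cases hm : m ∈ supp u v s
  · have hκ := measurable_transition u v htw
    rw [← Measure.bind_apply hV hκ.aemeasurable]
    congr 1
    exact bind_eq_of_hasMoments hκ (S := supp u v t) (by positivity) (momentGrowth_phi (u - s / 2) m)
      (transition_compl_supp huv hs hst (htw.trans hw) hm)
      (hasMoments_transition huv hs hst (htw.trans hw) hm)
      (hasMoments_transition huv hs (hst.trans htw) hw hm)
      (ae_neg_le (transition_compl_supp huv hs (hst.trans htw) hw hm))
      (fun r hr => hasMoments_transition huv (hs.trans hst.le) htw hw hr)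
      (fun r hr => ae_neg_le (transition_compl_supp huv (hs.trans hst.le) htw hw hr))
  · rw [transition_of_notMem hm, transition_of_notMem hm]
    simp

/-! ### The marginal measures as limits -/

/-- The density of the marginal measures, in terms of `a, b = u - s/2, v + s/2` in any order. -/
noncomputable def pairDensity (a b r : ℝ) : ℝ :=
  if 0 < r then
    (a + b) * (a + b + 1) / (8 * Real.pi) *
      (‖Complex.Gamma (a + Complex.I * (√r / 2 : ℝ)) *
          Complex.Gamma (b + Complex.I * (√r / 2 : ℝ))‖ ^ 2 /
        (√r * ‖Complex.Gamma (Complex.I * (√r : ℝ))‖ ^ 2))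
  else 0

/-- The masses of the atoms of the marginal measures, in terms of `a, b = u - s/2, v + s/2` in any
order. -/
noncomputable def pairMass (a b : ℝ) (j : ℕ) : ℝ :=
  Real.Gamma (b - a) * Real.Gamma (a + b + 2) / Real.Gamma (-2 * a) *
    (((a + j) * (pochR (2 * a) j * pochR (a + b) j)) / (a * (pochR 1 j * pochR (1 - b + a) j)))

/-- The marginal measure in terms of the two parameters, of which only the first may be negative. -/
noncomputable def pairMeasure (a b : ℝ) : Measure ℝ :=
  (volume.withDensity fun r => ENNReal.ofReal (pairDensity a b r)) +
    ∑ j ∈ Finset.range ⌈-a⌉₊, ENNReal.ofReal (pairMass a b j) • Measure.dirac (-4 * (a + j) ^ 2)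

theorem sum_pairMass {a : ℝ} (b : ℝ) (ha : a < 0) :
    ∑ j ∈ Finset.range (⌊-a⌋₊ + 1), ENNReal.ofReal (pairMass a b j) • Measure.dirac
      (-4 * (a + j) ^ 2) =
    ∑ j ∈ Finset.range ⌈-a⌉₊, ENNReal.ofReal (pairMass a b j) • Measure.dirac
      (-4 * (a + j) ^ 2) := by
  refine sum_range_floor_eq_sum_range_ceil ha _ fun j hj => ?_
  rw [pairMass, hj]
  simp

theorem marginal_eq_of_pos {u v s : ℝ} (hv : 0 < v + s / 2) :
    marginal u v s = pairMeasure (u - s / 2) (v + s / 2) := by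
  have hd : marginalDensity u v s = pairDensity (u - s / 2) (v + s / 2) := by
    ext r
    rw [marginalDensity, pairDensity]
    congr 1
    rw [show u - s / 2 + (v + s / 2) = v + u by ring, show s / 2 + v = v + s / 2 by ring,
      show -(s / 2) + u = u - s / 2 by ring,
      mul_comm (Complex.Gamma ((v + s / 2 : ℝ) + Complex.I * (√r / 2 : ℝ)))]
  have hm : ∀ j, marginalMassU u v s j = pairMass (u - s / 2) (v + s / 2) j := fun j => by
    rw [marginalMassU, pairMass]
    congr 1
    · congr 2
      · congr 1; ring
      · congr 1; ring
      · ring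
    · congr 1
      · congr 1
        · ring
        · congr 2 <;> ring
      · congr 3; ring
  rw [marginal, hd, if_neg hv.not_gt, add_zero, pairMeasure]
  congr 1
  split_ifs with hu
  · rw [← sum_pairMass _ hu, show -u + s / 2 = -(u - s / 2) by ring]
    simp only [hm, xU_eq]
  · rw [Nat.ceil_eq_zero.2 (by linarith)]
    simp

theorem marginal_eq_of_nonpos {u v s : ℝ} (huv : 0 < u + v) (hv : v + s / 2 ≤ 0) :
    marginal u v s = pairMeasure (v + s / 2) (u - s / 2) := by
  have hd : marginalDensity u v s = pairDensity (v + s / 2) (u - s / 2) := by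
    ext r
    rw [marginalDensity, pairDensity]
    congr 1
    rw [show v + s / 2 + (u - s / 2) = v + u by ring, show s / 2 + v = v + s / 2 by ring,
      show -(s / 2) + u = u - s / 2 by ring]
  have hm : ∀ j, marginalMassV u v s j = pairMass (v + s / 2) (u - s / 2) j := fun j => by
    rw [marginalMassV, pairMass]
    congr 1
    · congr 2
      · congr 1; ring
      · congr 1; ring
      · ring
    · congr 1
      · congr 1
        · ring
        · congr 2 <;> ring
      · congr 3; ring
  have hu : ¬ u - s / 2 < 0 := by linarith
  rw [marginal, hd, if_neg hu, add_zero, pairMeasure]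
  congr 1
  split_ifs with hv'
  · rw [← sum_pairMass _ hv', show -v - s / 2 = -(v + s / 2) by ring]
    simp only [hm, xV_eq]
  · rw [Nat.ceil_eq_zero.2 (by linarith)]
    simp

/-- The normalisation turning `cdh a b c` into an approximation of `pairMeasure a b`. -/
noncomputable def pairNorm (a b c : ℝ) : ℝ :=
  Real.Gamma (a + c) * Real.Gamma (b + c) / Real.Gamma c ^ 2

theorem admissible_ofReal_of_add_pos {a b c : ℝ} (hb : 0 < b) (hc : 0 < c) (hab : 0 < a + b) (hac : 0 < a + c) :
    Admissible a b c :=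
  Or.inr ⟨⟨Complex.ofReal_im _, Complex.ofReal_im _⟩, by simpa, by simpa, by simpa, by simpa⟩

/-- The rescaled density; its last factor increases to `1` as `c → ∞`. -/
theorem cdhDensity_mul_pairNorm {a b c : ℝ} (hb : 0 < b) (hc : 0 < c) (hab : 0 < a + b)
    (hac : 0 < a + c) (x : ℝ) :
    Real.Gamma (a + b + 2) * pairNorm a b c * cdhDensity a b c x =
      pairDensity a b x * (‖Complex.Gamma (c + Complex.I * (√x / 2 : ℝ))‖ / Real.Gamma c) ^ 2 := by
  rcases le_or_gt x 0 with hx | hx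
  · rw [cdhDensity_of_nonpos _ _ _ hx, pairDensity, if_neg hx.not_gt]; ring
  have hN : cdhNorm a b c = Real.Gamma (a + b) * Real.Gamma (a + c) * Real.Gamma (b + c) := by
    rw [cdhNorm]
    simp only [← Complex.ofReal_add, Complex.Gamma_ofReal, ← Complex.ofReal_mul, Complex.ofReal_re]
  have g : Real.Gamma (a + b + 2) = (a + b) * (a + b + 1) * Real.Gamma (a + b) := by
    rw [show a + b + 2 = a + b + 1 + 1 by ring, Real.Gamma_add_one (by linarith),
      Real.Gamma_add_one hab.ne']
    ring
  have g1 := (Real.Gamma_pos_of_pos hab).ne'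
  have g2 := (Real.Gamma_pos_of_pos hac).ne'
  have g3 := (Real.Gamma_pos_of_pos (add_pos hb hc)).ne'
  have g4 := (Real.Gamma_pos_of_pos hc).ne'
  rw [cdhDensity, if_pos hx, ← cdhNorm, hN, pairDensity, if_pos hx, pairNorm, g,
    norm_mul (_ * _) (Complex.Gamma (c + _)), div_pow]
  generalize ‖Complex.Gamma (a + Complex.I * (√x / 2 : ℝ)) *
          Complex.Gamma (b + Complex.I * (√x / 2 : ℝ))‖ = A
  generalize ‖Complex.Gamma (c + Complex.I * (√x / 2 : ℝ))‖ = C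
  generalize ‖Complex.Gamma (Complex.I * (√x : ℝ))‖ = D
  have hpi := Real.pi_ne_zero
  have hx' := (Real.sqrt_pos.2 hx).ne'
  rcases eq_or_ne D 0 with rfl | hD
  · simp
  field_simp

/-- The rescaled masses; their last factor tends to `1` as `c → ∞`. -/
theorem cdhMass_mul_pairNorm {a b c : ℝ} (hb : 0 < b) (hc : 0 < c) (hac : 0 < a + c) {j : ℕ}
    (hj : (j : ℝ) < -a) :
    Real.Gamma (a + b + 2) * pairNorm a b c * cdhMass a b c j =
      pairMass a b j * (Real.Gamma (c + a + j) * Real.Gamma (c - a - j) / Real.Gamma c ^ 2) := by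
  have hj0 := (Nat.cast_nonneg j : (0 : ℝ) ≤ j)
  have g1 : Real.Gamma (c + a + j) = pochR (a + c) j * Real.Gamma (a + c) := by
    have := Gamma_add_nat_eq_poch_mul (z := ((a + c : ℝ) : ℂ))
      (Complex.Gamma_ne_zero_of_re_pos (by simpa using hac)) j
    rw [← ofReal_pochR, Complex.Gamma_ofReal, ← Complex.ofReal_natCast, ← Complex.ofReal_add,
      Complex.Gamma_ofReal, ← Complex.ofReal_mul, Complex.ofReal_inj] at this
    rw [← this]; congr 1; ring
  have g2 : Real.Gamma (c - a) = (-1) ^ j * pochR (a - c + 1) j * Real.Gamma (c - a - j) := by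
    have := Gamma_eq_poch_mul (z := ((c - a : ℝ) : ℂ)) (n := j) (by
      rw [Complex.sub_re, Complex.ofReal_re, Complex.natCast_re]; linarith)
    rw [show (1 : ℂ) - ((c - a : ℝ) : ℂ) = ((a - c + 1 : ℝ) : ℂ) by push_cast; ring,
      ← ofReal_pochR, Complex.Gamma_ofReal, ← Complex.ofReal_natCast, ← Complex.ofReal_sub,
      Complex.Gamma_ofReal] at this
    exact_mod_cast this
  have n1 := (Real.Gamma_pos_of_pos (show 0 < c - a by linarith)).ne'
  have n2 : pochR (a - c + 1) j ≠ 0 := fun h0 => n1 (by rw [g2, h0]; simp)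
  have n3 := (Real.Gamma_pos_of_pos (add_pos hb hc)).ne'
  have e : cdhMass a b c j = (pochR (2 * a) j * pochR (a + b) j * pochR (a + c) j * (a + j) *
      Real.Gamma (b - a) * Real.Gamma (c - a)) /
      (pochR 1 j * pochR (a - b + 1) j * pochR (a - c + 1) j * a *
      Real.Gamma (-2 * a) * Real.Gamma (b + c)) * (-1) ^ j := by
    rw [cdhMass, ← Complex.ofReal_re ((_ : ℝ) / _ * _)]
    congr 1
    push_cast [ofReal_pochR, ← Complex.Gamma_ofReal]
    rfl
  rw [e, g2, pairMass, pairNorm, g1, show 1 - b + a = a - b + 1 by ring]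
  have hs : ((-1 : ℝ) ^ j) * (-1) ^ j = 1 := by rw [← mul_pow]; simp
  generalize (-1 : ℝ) ^ j = σ at *
  generalize pochR (a - c + 1) j = P at *
  generalize Real.Gamma (b + c) = G at *
  calc _ = (σ * σ) * (P / P) * (G / G) * (Real.Gamma (a + b + 2) * (Real.Gamma (a + c) /
        Real.Gamma c ^ 2) * ((pochR (2 * a) j * pochR (a + b) j * pochR (a + c) j * (a + j) *
      Real.Gamma (b - a) * Real.Gamma (c - a - j)) / (pochR 1 j * pochR (a - b + 1) j * a *
      Real.Gamma (-2 * a)))) := by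
        simp only [div_eq_mul_inv, mul_inv]; ring
    _ = _ := by
        rw [hs, div_self n2, div_self n3]
        simp only [div_eq_mul_inv, mul_inv]; ring

theorem pairDensity_nonneg {a b : ℝ} (hab : 0 < a + b) (x : ℝ) : 0 ≤ pairDensity a b x := by
  rw [pairDensity]
  split_ifs
  · have := Real.pi_pos
    positivity
  · rfl

theorem norm_Gamma_div_mono {σ τ : ℝ} (hσ : 0 < σ) (h : σ ≤ τ) (y : ℝ) :
    ‖Complex.Gamma (σ + Complex.I * y)‖ / Real.Gamma σ ≤
      ‖Complex.Gamma (τ + Complex.I * y)‖ / Real.Gamma τ := by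
  rw [div_le_div_iff₀ (Real.Gamma_pos_of_pos hσ) (Real.Gamma_pos_of_pos (hσ.trans_le h))]
  exact norm_Gamma_mul_Gamma_le hσ h y

open Filter Topology in
theorem tendsto_norm_Gamma_div {σ : ℝ} (hσ : 0 < σ) (y : ℝ) :
    Tendsto (fun n : ℕ => (‖Complex.Gamma ((σ + n + 1 : ℝ) + Complex.I * y)‖ /
      Real.Gamma (σ + n + 1)) ^ 2) atTop (𝓝 1) := by
  have h := tendsto_norm_Gamma_ratio (z₁ := σ + Complex.I * y) (z₂ := σ + Complex.I * y) (z₃ := σ)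
    (z₄ := σ) (by simpa) (by simpa) (by simpa) (by simpa) (by simp)
  refine h.congr fun n => ?_
  have hn : 0 < σ + n + 1 := by positivity
  rw [show (σ : ℂ) + n + 1 = ((σ + n + 1 : ℝ) : ℂ) by push_cast; ring,
    show (σ : ℂ) + Complex.I * y + n + 1 = ((σ + n + 1 : ℝ) : ℂ) + Complex.I * y by push_cast; ring,
    norm_Gamma_ofReal hn]
  ring

open Filter Topology in
theorem tendsto_Gamma_ratio {p q r s : ℝ} (hp : 0 < p) (hq : 0 < q) (hr : 0 < r) (hs : 0 < s)
    (h : p + q = r + s) : Tendsto (fun n : ℕ => Real.Gamma (p + n + 1) * Real.Gamma (q + n + 1) /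
      (Real.Gamma (r + n + 1) * Real.Gamma (s + n + 1))) atTop (𝓝 1) := by
  have := tendsto_norm_Gamma_ratio (z₁ := p) (z₂ := q) (z₃ := r)
    (z₄ := s) (by simpa) (by simpa) (by simpa) (by simpa) (by simpa)
  refine this.congr fun n => ?_
  have e : ∀ x : ℝ, 0 < x → ‖Complex.Gamma ((x : ℂ) + n + 1)‖ = Real.Gamma (x + n + 1) := fun x hx => by
    rw [← norm_Gamma_ofReal (by positivity)]; push_cast; rfl
  rw [e p hp, e q hq, e r hr, e s hs]

open Filter Topology in
/-- Rescaled continuous dual Hahn measures converge to the marginal measure as `c → ∞`: the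
densities increase to the limiting density and the atoms converge. -/
theorem tendsto_lintegral_cdh {a b σ : ℝ} (hb : 0 < b) (hab : 0 < a + b) (hσ : 0 < σ)
    (haσ : 0 < a + σ) {pts : ℕ → ℝ} (hpts : ∀ j, pts j = -4 * (a + j) ^ 2) {f : ℝ → ENNReal}
    (hf : Measurable f) (hft : ∀ x, f x ≠ ⊤) :
    Tendsto (fun n : ℕ => ENNReal.ofReal (Real.Gamma (a + b + 2) * pairNorm a b (σ + n + 1)) *
      ∫⁻ x, f x ∂(cdh a b (σ + n + 1 : ℝ) pts)) atTop (𝓝 (∫⁻ x, f x ∂(pairMeasure a b))) := by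
  have hc : ∀ n : ℕ, 0 < σ + n + 1 := fun n => by positivity
  have hac : ∀ n : ℕ, 0 < a + (σ + n + 1) := fun n => by
    have := (Nat.cast_nonneg n : (0 : ℝ) ≤ n); linarith
  have hadm : ∀ n : ℕ, Admissible a (b : ℂ) ((σ + n + 1 : ℝ) : ℂ) := fun n =>
    admissible_ofReal_of_add_pos hb (hc n) hab (hac n)
  have hGab := Real.Gamma_pos_of_pos (show 0 < a + b + 2 by linarith)
  have hN : ∀ n : ℕ, 0 ≤ Real.Gamma (a + b + 2) * pairNorm a b (σ + n + 1) := fun n => by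
    have := Real.Gamma_pos_of_pos (hac n)
    have := Real.Gamma_pos_of_pos (add_pos hb (hc n))
    rw [pairNorm]; positivity
  -- the rescaled integral, split into its two parts
  have key : ∀ n : ℕ, ENNReal.ofReal (Real.Gamma (a + b + 2) * pairNorm a b (σ + n + 1)) *
      ∫⁻ x, f x ∂(cdh a b (σ + n + 1 : ℝ) pts) =
      (∫⁻ x, ENNReal.ofReal (pairDensity a b x *
        (‖Complex.Gamma ((σ + n + 1 : ℝ) + Complex.I * (√x / 2 : ℝ))‖ /
          Real.Gamma (σ + n + 1)) ^ 2) * f x) +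
      ∑ j ∈ Finset.range ⌈-a⌉₊, ENNReal.ofReal (pairMass a b j *
        (Real.Gamma (σ + a + j + n + 1) * Real.Gamma (σ - a - j + n + 1) /
          (Real.Gamma (σ + n + 1) * Real.Gamma (σ + n + 1)))) * f (-4 * (a + j) ^ 2) := by
    intro n
    have hm := (measurable_cdhDensity a b ((σ + n + 1 : ℝ) : ℂ)).ennreal_ofReal
    rw [cdh_of_admissible (hadm n) hpts, lintegral_add_measure, mul_add, contMeasure,
      lintegral_withDensity_eq_lintegral_mul _ hm hf, ← lintegral_const_mul _ (hm.mul hf),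
      atomMeasure, lintegral_finsetSum_measure, Finset.mul_sum]
    congr 1
    · refine lintegral_congr fun x => ?_
      rw [Pi.mul_apply, ← mul_assoc, ← ENNReal.ofReal_mul (hN n),
        cdhDensity_mul_pairNorm hb (hc n) hab (hac n)]
    · refine Finset.sum_congr rfl fun j hj => ?_
      rw [lintegral_smul_measure, lintegral_dirac, smul_eq_mul, ← mul_assoc,
        ← ENNReal.ofReal_mul (hN n), cdhMass_mul_pairNorm hb (hc n) (hac n)
          (Nat.lt_ceil.1 (Finset.mem_range.1 hj)), sq (Real.Gamma _),
        show σ + n + 1 + a + j = σ + a + j + n + 1 by ring,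
        show σ + n + 1 - a - j = σ - a - j + n + 1 by ring]
  have hs : Measurable fun x : ℝ => √x := Real.continuous_sqrt.measurable
  have hI : Measurable fun x : ℝ => Complex.I * ((√x / 2 : ℝ) : ℂ) :=
    (Complex.measurable_ofReal.comp (hs.div_const 2)).const_mul _
  have hI2 : Measurable fun x : ℝ => Complex.I * ((√x : ℝ) : ℂ) :=
    (Complex.measurable_ofReal.comp hs).const_mul _
  have hd : Measurable (pairDensity a b) := by
    unfold pairDensity
    refine Measurable.ite measurableSet_Ioi ?_ measurable_const
    refine Measurable.const_mul (Measurable.div ?_ ?_) _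
    · exact ((measurable_Gamma_comp (hI.const_add _)).mul
        (measurable_Gamma_comp (hI.const_add _))).norm.pow_const 2
    · exact hs.mul ((measurable_Gamma_comp hI2).norm.pow_const 2)
  rw [pairMeasure, lintegral_add_measure, lintegral_withDensity_eq_lintegral_mul _
    hd.ennreal_ofReal hf, lintegral_finsetSum_measure]
  simp only [key]
  refine Tendsto.add ?_ ?_
  · refine lintegral_tendsto_of_tendsto_of_monotone (fun n => ?_) ?_ ?_
    · refine (Measurable.mul (Measurable.ennreal_ofReal (hd.mul ?_)) hf).aemeasurable
      exact ((measurable_Gamma_comp (hI.const_add _)).norm.div_const _).pow_const 2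
    · refine Eventually.of_forall fun x n k hnk => ?_
      have hnk' : (n : ℝ) ≤ k := by exact_mod_cast hnk
      have := Real.Gamma_pos_of_pos (hc n)
      refine mul_le_mul_left (ENNReal.ofReal_le_ofReal (mul_le_mul_of_nonneg_left
        (pow_le_pow_left₀ (by positivity) (norm_Gamma_div_mono (hc n) (by linarith) _) 2)
        (pairDensity_nonneg hab x))) _
    · refine Eventually.of_forall fun x => ?_
      have h1 := (tendsto_norm_Gamma_div hσ (√x / 2)).const_mul (pairDensity a b x)
      rw [mul_one] at h1
      exact ENNReal.Tendsto.mul_const (ENNReal.tendsto_ofReal h1) (Or.inr (hft x))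
  · refine tendsto_finsetSum _ fun j hj => ?_
    have hj' := Nat.lt_ceil.1 (Finset.mem_range.1 hj)
    have hj0 := (Nat.cast_nonneg j : (0 : ℝ) ≤ j)
    rw [lintegral_smul_measure, lintegral_dirac, smul_eq_mul]
    have h1 := (tendsto_Gamma_ratio (p := σ + a + j) (q := σ - a - j) (r := σ) (s := σ) (by linarith)
      (by linarith) hσ hσ (by ring)).const_mul (pairMass a b j)
    rw [mul_one] at h1
    exact ENNReal.Tendsto.mul_const (ENNReal.tendsto_ofReal h1) (Or.inr (hft _))

/-! ### Invariance of the marginal measures -/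

/-- The probability measures with moments `[u+v]_n [u+K]_n` in the basis `phi (u - s/2)`,
approximating the marginal measure at time `s`. -/
noncomputable def approx (u v s K : ℝ) : Measure ℝ :=
  if 0 < v + s / 2 then
    cdh (u - s / 2) (v + s / 2 : ℝ) (K + s / 2 : ℝ) (xU u s)
  else cdh (v + s / 2) (u - s / 2 : ℝ) (K + s / 2 : ℝ) (xV v s)

theorem approx_spec {u v s K : ℝ} (huv : 0 < u + v) (hK : 0 < K + s / 2) (huK : 0 < u + K)
    (hvK : 0 < v + s + K) : HasMoments (approx u v s K) (u - s / 2)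
      (fun n => pochR (u + v) n * pochR (u + K) n) ∧ approx u v s K (supp u v s)ᶜ = 0 := by
  have hcont : ∀ (a : ℝ) (b c : ℂ), contMeasure a b c (supp u v s)ᶜ = 0 := fun a b c =>
    measure_mono_null (Set.compl_subset_compl.2 fun x hx => Or.inl (Or.inl hx))
      (contMeasure_compl_Ioi a b c)
  rw [approx]
  split_ifs with hv
  · have hA : Admissible (u - s / 2) (v + s / 2 : ℝ) (K + s / 2 : ℝ) :=
      admissible_ofReal_of_add_pos hv hK (by linarith) (by linarith)
    constructor
    · refine hasMoments_cdh hA (fun j => by rw [xU_eq]) fun n => ?_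
      push_cast [ofReal_pochR]
      congr 2 <;> ring
    · rw [cdh_of_admissible hA (fun j => by rw [xU_eq]), Measure.add_apply, hcont, zero_add]
      refine atomMeasure_eq_zero fun i hi => ?_
      have := Nat.lt_ceil.1 hi
      rw [← xU_eq]
      exact xU_mem_supp (by linarith)
  · have hA : Admissible (v + s / 2) (u - s / 2 : ℝ) (K + s / 2 : ℝ) :=
      admissible_ofReal_of_add_pos (by linarith) hK (by linarith) (by linarith)
    constructor
    · have h := hasMoments_cdh hA (pts := xV v s) (fun j => by rw [xV_eq])
        (M := fun n => pochR (v + s / 2 + (K + s / 2)) n * pochR (v + s / 2 + (u - s / 2)) n)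
        fun n => by push_cast [ofReal_pochR]; ring
      have h2 := h.swap
      refine ⟨h2.1, fun n => (h2.2 n).trans ?_⟩
      rw [show u - s / 2 + (K + s / 2) = u + K by ring,
        show v + s / 2 + (u - s / 2) = u + v by ring]
      exact mul_comm _ _
    · rw [cdh_of_admissible hA (fun j => by rw [xV_eq]), Measure.add_apply, hcont, zero_add]
      refine atomMeasure_eq_zero fun i hi => ?_
      have := Nat.lt_ceil.1 hi
      rw [← xV_eq]
      exact xV_mem_supp (by linarith)

theorem momentGrowth_pochR (x y : ℝ) : MomentGrowth fun n => pochR x n * pochR y n := by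
  refine ⟨1, (|x| + 1) * (|y| + 1), zero_le_one, by positivity, fun n => ?_⟩
  rw [abs_mul, one_mul, mul_pow]
  calc _ ≤ ((|x| + 1) ^ n * n.factorial) * ((|y| + 1) ^ n * n.factorial) :=
        mul_le_mul (abs_pochR_le x n) (abs_pochR_le y n) (abs_nonneg _) (by positivity)
    _ = _ := by ring

/-- The scaling factor of `approx`. -/
noncomputable def approxNorm (u v s K : ℝ) : ℝ :=
  Real.Gamma (u + K) * Real.Gamma (v + s + K) / Real.Gamma (s / 2 + K) ^ 2

open Filter Topology in
theorem tendsto_lintegral_approx {u v s κ : ℝ} (huv : 0 < u + v) (hs : 0 ≤ s) (hκ : 0 < κ)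
    (huκ : 0 < u + κ) (hvκ : 0 < v + κ) {f : ℝ → ENNReal} (hf : Measurable f)
    (hft : ∀ x, f x ≠ ⊤) :
    Tendsto (fun n : ℕ => ENNReal.ofReal (Real.Gamma (u + v + 2) * approxNorm u v s (κ + n + 1)) *
      ∫⁻ x, f x ∂(approx u v s (κ + n + 1))) atTop (𝓝 (∫⁻ x, f x ∂(marginal u v s))) := by
  by_cases hv : 0 < v + s / 2
  · rw [marginal_eq_of_pos hv]
    refine (tendsto_lintegral_cdh hv (by linarith) (σ := s / 2 + κ) (by linarith) (by linarith)
      (pts := xU u s) (fun j => by rw [xU_eq]) hf hft).congr fun n => ?_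
    rw [approx, if_pos hv, approxNorm, pairNorm,
      show κ + n + 1 + s / 2 = s / 2 + κ + n + 1 by ring]
    congr 3
    · congr 1; ring
    · congr 3 <;> ring
  · rw [marginal_eq_of_nonpos huv (not_lt.1 hv)]
    refine (tendsto_lintegral_cdh (a := v + s / 2) (b := u - s / 2) (by linarith) (by linarith)
      (σ := s / 2 + κ) (by linarith) (by linarith)
      (pts := xV v s) (fun j => by rw [xV_eq]) hf hft).congr fun n => ?_
    rw [approx, if_neg hv, approxNorm, pairNorm,
      show κ + n + 1 + s / 2 = s / 2 + κ + n + 1 by ring,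
      mul_comm (Real.Gamma (v + s / 2 + _))]
    congr 3
    · congr 1; ring
    · congr 3 <;> ring

open Filter Topology in
theorem tendsto_approxNorm_div {u v s t κ : ℝ} (hs : 0 ≤ s) (ht : 0 ≤ t) (hκ : 0 < κ)
    (huκ : 0 < u + κ) (hvκ : 0 < v + κ) :
    Tendsto (fun n : ℕ => approxNorm u v s (κ + n + 1) / approxNorm u v t (κ + n + 1)) atTop
      (𝓝 1) := by
  have h1 := tendsto_Gamma_ratio (p := v + s + κ) (q := t / 2 + κ) (r := v + (s + t) / 2 + κ)
    (s := s / 2 + κ) (by linarith) (by linarith) (by linarith) (by linarith) (by ring)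
  have h2 := tendsto_Gamma_ratio (p := v + (s + t) / 2 + κ) (q := t / 2 + κ) (r := v + t + κ)
    (s := s / 2 + κ) (by linarith) (by linarith) (by linarith) (by linarith) (by ring)
  have h := h1.mul h2
  rw [mul_one] at h
  refine h.congr fun n => ?_
  have g : ∀ x : ℝ, 0 < x + κ → Real.Gamma (x + κ + n + 1) ≠ 0 := fun x hx =>
    (Real.Gamma_pos_of_pos (by positivity)).ne'
  have g1 := g u huκ
  have g2 := g (v + t) (by linarith)
  have g3 := g (v + (s + t) / 2) (by linarith)
  have g4 := g (s / 2) (by linarith)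
  have g5 := g (t / 2) (by linarith)
  rw [approxNorm, approxNorm]
  simp only [← add_assoc]
  generalize Real.Gamma (v + (s + t) / 2 + κ + n + 1) = G at *
  field_simp

open Filter Topology in
/-- The marginal measures are consistent with the transition measures, because their approximations
are, up to scaling factors of asymptotic ratio `1`. -/
theorem lintegral_transition_marginal {u v s t : ℝ} (huv : 0 < u + v) (hs : 0 ≤ s) (hst : s < t)
    (ht : t < timeBound u) {V : Set ℝ} (hV : MeasurableSet V) :
    ∫⁻ m, transition u v s t m V ∂(marginal u v s) = marginal u v t V := by
  obtain ⟨κ, hκ, huκ, hvκ⟩ : ∃ κ : ℝ, 0 < κ ∧ 0 < u + κ ∧ 0 < v + κ :=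
    ⟨|u| + |v| + 1, by positivity, by linarith [neg_abs_le u, abs_nonneg v],
      by linarith [neg_abs_le v, abs_nonneg u]⟩
  have ht0 : 0 ≤ t := hs.trans hst.le
  have hmeas := measurable_transition u v hst
  have hf : Measurable fun m => transition u v s t m V := (Measure.measurable_coe hV).comp hmeas
  have hft : ∀ m, transition u v s t m V ≠ ⊤ := fun m => by
    by_cases hm : m ∈ supp u v s
    · have := isProbabilityMeasure_transition huv hs hst ht hm
      exact measure_ne_top _ _
    · rw [transition_of_notMem hm]; simp
  have hstep : ∀ n : ℕ, ∫⁻ m, transition u v s t m V ∂(approx u v s (κ + n + 1)) =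
      approx u v t (κ + n + 1) V := fun n => by
    have hn := (Nat.cast_nonneg n : (0 : ℝ) ≤ n)
    obtain ⟨h1, h2⟩ := approx_spec (s := s) (K := κ + n + 1) huv (by linarith) (by linarith)
      (by linarith)
    obtain ⟨h3, h4⟩ := approx_spec (s := t) (K := κ + n + 1) huv (by linarith) (by linarith)
      (by linarith)
    rw [← Measure.bind_apply hV hmeas.aemeasurable]
    congr 1
    exact bind_eq_of_hasMoments hmeas (S := supp u v s) (by positivity)
      (momentGrowth_pochR (u + v) (u + (κ + n + 1))) h2 h1 h3 (ae_neg_le h4)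
      (fun r hr => hasMoments_transition huv hs hst ht hr)
      (fun r hr => ae_neg_le (transition_compl_supp huv hs hst ht hr))
  have hA := tendsto_lintegral_approx huv hs hκ huκ hvκ hf hft
  have hB := tendsto_lintegral_approx (f := V.indicator 1) huv ht0 hκ huκ hvκ
    (measurable_one.indicator hV) (fun x => by
      by_cases hx : x ∈ V <;> simp [hx])
  simp only [lintegral_indicator_one hV] at hB
  have hC := ENNReal.tendsto_ofReal (tendsto_approxNorm_div (s := s) hs ht0 hκ huκ hvκ)
  rw [ENNReal.ofReal_one] at hC
  have hD := ENNReal.Tendsto.mul hC (Or.inl one_ne_zero) hB (Or.inr ENNReal.one_ne_top)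
  rw [one_mul] at hD
  refine tendsto_nhds_unique hA (hD.congr fun n => ?_)
  have g : ∀ x : ℝ, 0 < x + κ → 0 < Real.Gamma (x + (κ + n + 1)) := fun x hx =>
    Real.Gamma_pos_of_pos (by linarith [(Nat.cast_nonneg n : (0 : ℝ) ≤ n)])
  have hpos : ∀ r : ℝ, 0 ≤ r → 0 < approxNorm u v r (κ + n + 1) := fun r hr => by
    have g1 := g u huκ
    have g2 := g (v + r) (by linarith)
    have g3 := g (r / 2) (by linarith)
    rw [approxNorm]; positivity
  have p1 := hpos s hs
  have p2 := hpos t ht0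
  rw [hstep, ← mul_assoc, ← ENNReal.ofReal_mul (by positivity)]
  congr 2
  field_simp

end DualHahn

theorem lemma7p6 (u v s t w : ℝ) (huv : 0 < u + v) (hs : 0 ≤ s) (hst : s < t) (htw : t < w)
    (hw : w < DualHahn.timeBound u) :
    -- the transition measures form a measurable kernel, Markov from `S_s` to `S_t`
    (Measurable (DualHahn.transition u v s t) ∧
      ∀ m ∈ DualHahn.supp u v s,
        IsProbabilityMeasure (DualHahn.transition u v s t m) ∧
          DualHahn.transition u v s t m (DualHahn.supp u v t)ᶜ = 0) ∧
    -- consistency with the marginals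
    (∀ V : Set ℝ, MeasurableSet V →
      ∫⁻ m, DualHahn.transition u v s t m V ∂(DualHahn.marginal u v s) =
        DualHahn.marginal u v t V) ∧
    -- Chapman-Kolmogorov
    (∀ (m : ℝ) (V : Set ℝ), MeasurableSet V →
      ∫⁻ r, DualHahn.transition u v t w r V ∂(DualHahn.transition u v s t m) =
        DualHahn.transition u v s w m V) :=
  ⟨⟨DualHahn.measurable_transition u v hst, fun _ hm =>
    ⟨DualHahn.isProbabilityMeasure_transition huv hs hst (htw.trans hw) hm,
      DualHahn.transition_compl_supp huv hs hst (htw.trans hw) hm⟩⟩,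
    fun _ hV => DualHahn.lintegral_transition_marginal huv hs hst (htw.trans hw) hV,
    fun m _ hV => DualHahn.lintegral_transition huv hs hst htw hw m hV⟩
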